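/- Fix an integer $t\ge 2$. A $\Pi_t^+$ circuit is a finite directed acyclic graph whose vertices of indegree $0$ are the (positive) input variables, whose other vertices (the gates) are labelled AND or OR, with a designated output AND-gate of outdegree $0$, in which every gate has outdegree at most $1$, gates adjacent to each other have different types, and every directed path from a variable to the output gate has at most $t$ edges. The genus of a circuit is the genus (least number of handles of an orientable closed surface on which it can be drawn without crossings) of the underlying undirected graph after removal of the output gate. An instance of WSAT$^+[t]$ is a pair $(C,k)$ of a $\Pi_t^+$ circuit $C$ and a parameter $k\in\mathbb N$; it is a yes-instance if some assignment of weight exactly $k$ (that is, with exactly $k$ variables set to $1$) satisfies $C$. A critical gate is an OR-gate incoming to the output gate, and for a critical gate $p$, $T_p$ is the subtree, rooted at $p$, of the tree formed by the gates. A circuit is simplified if every vertex other than the output gate is incoming to some gate and every gate other than the output gate has indegree at least $2$. A complexity function is a computable, nondecreasing, unbounded function $\mathbb N\to\mathbb N$. Let $g:\mathbb N\to\mathbb N$ satisfy $g(n)=n^{o(1)}$ effectively, that is, there are a complexity function $\mu$ and an $n_0$ with $g(n)\le n^{1/\mu(n)}$ for all $n\ge n_0$. Then there are an algorithm $\mathcal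 A$, complexity functions $f,h$ and constants $c,d$ such that the following holds for every instance $(C,k)$ of WSAT$^+[t]$ for which $C$ has $n$ variables and genus at most $g(n)$. On input $(C,k)$, of length $N$, the algorithm $\mathcal A$ halts within time $f(k)\,N^{c}$, and it either decides correctly whether $(C,k)$ is a yes-instance, or outputs a list of at most $h(k)\,n^{d}$ instances $(C',k')$ of WSAT$^+[t]$ with $C'$ simplified and $k'\le k$ such that $(C,k)$ is a yes-instance if and only if at least one of the listed instances is, and such that for each listed instance $(C',k')$: (1) $C'$ has at most $2k'$ critical gates; (2) for every variable of $C'$ there are at most two critical gates $p$ of $C'$ such that the variable is incoming to a gate of $T_p$; (3) the genus of $C'$ is at most the genus of $C$ (hence at most $g(n)$). -/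

import Mathlib

/-! ### Complexity functions -/

/-- A complexity function: computable, nondecreasing and unbounded. -/
def IsComplexityFunction (f : ℕ → ℕ) : Prop :=
  Computable f ∧ Monotone f ∧ Filter.Tendsto f Filter.atTop Filter.atTop

/-- `g(n) = n^{o(1)}`, with the effective little-o: `g(n) ≤ n^{1/μ(n)}` for all large `n`, for some
computable nondecreasing unbounded `μ`. -/
def IsSubpolynomial (g : ℕ → ℕ) : Prop :=
  ∃ μ : ℕ → ℕ, IsComplexityFunction μ ∧
    ∃ n₀ : ℕ, ∀ n : ℕ, n₀ ≤ n → (g n : ℝ) ≤ (n : ℝ) ^ (1 / (μ n : ℝ))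

/-! ### Machine model

Structured programs over binary trees. Running a construct on a tree `x` costs the number of nodes
of `x`, in addition to the cost of the sub-programs that are run. Since the data are charged by
size, time in this model and time on Turing machines are polynomially related. -/

/-- Binary trees, the data of the machine model. -/
inductive Data : Type
  | nil : Data
  | cons : Data → Data → Data

namespace Data

/-- Number of nodes of the tree. -/
def size : Data → ℕ
  | nil => 1
  | cons a b => a.size + b.size + 1

/-- Left subtree (`nil` for the empty tree). -/
def head : Data → Data
  | nil => nil
  | cons a _ => a

/-- Right subtree (`nil` for the empty tree). -/
def tail : Data → Data
  | nil => nil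
  | cons _ b => b

/-- Unary numerals. -/
def ofNat : ℕ → Data
  | 0 => nil
  | n + 1 => cons nil (ofNat n)

/-- Truth values. -/
def ofBool : Bool → Data
  | false => nil
  | true => cons nil nil

/-- Lists of trees. -/
def ofList : List Data → Data
  | [] => nil
  | a :: l => cons a (ofList l)

end Data

/-- Programs; each one transforms a tree into a tree. -/
inductive Prog : Type
  | skip : Prog
  | nil : Prog
  | head : Prog
  | tail : Prog
  | pair : Prog → Prog → Prog
  | seq : Prog → Prog → Prog
  | ite : Prog → Prog → Prog → Prog
  | loop : Prog → Prog → Prog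

/-- `p.Runs x y T`: on input `x` the program `p` halts with output `y` after time exactly `T`. -/
inductive Prog.Runs : Prog → Data → Data → ℕ → Prop
  | skip (x : Data) : Runs .skip x x x.size
  | nil (x : Data) : Runs .nil x .nil x.size
  | head (x : Data) : Runs .head x x.head x.size
  | tail (x : Data) : Runs .tail x x.tail x.size
  | pair {p q : Prog} {x a b : Data} {S T : ℕ} :
      Runs p x a S → Runs q x b T → Runs (.pair p q) x (.cons a b) (x.size + S + T)
  | seq {p q : Prog} {x y z : Data} {S T : ℕ} :
      Runs p x y S → Runs q y z T → Runs (.seq p q) x z (x.size + S + T)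
  | ite_true {c p q : Prog} {x a b y : Data} {S T : ℕ} :
      Runs c x (.cons a b) S → Runs p x y T → Runs (.ite c p q) x y (x.size + S + T)
  | ite_false {c p q : Prog} {x y : Data} {S T : ℕ} :
      Runs c x .nil S → Runs q x y T → Runs (.ite c p q) x y (x.size + S + T)
  | loop_done {c p : Prog} {x : Data} {S : ℕ} :
      Runs c x .nil S → Runs (.loop c p) x x (x.size + S)
  | loop_step {c p : Prog} {x a b y z : Data} {S T U : ℕ} :
      Runs c x (.cons a b) S → Runs p x y T → Runs (.loop c p) y z U →
        Runs (.loop c p) x z (x.size + S + T + U)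

/-! ### Genus of a graph -/

/-- A rotation system: a cyclic order of the darts (directed edges) leaving each vertex. By the
Heffter–Edmonds correspondence these are the cellular embeddings of the connected components of
the graph in oriented closed surfaces. -/
structure RotationSystem {V : Type*} (G : SimpleGraph V) where
  next : Equiv.Perm G.Dart
  fst_next : ∀ d : G.Dart, (next d).fst = d.fst
  cyclic : ∀ d e : G.Dart, d.fst = e.fst → next.SameCycle d e

/-- The permutation of the darts that traces the boundaries of the faces. -/
def RotationSystem.facePerm {V : Type*} {G : SimpleGraph V} (R : RotationSystem G) :
    Equiv.Perm G.Dart :=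
  (SimpleGraph.Dart.symm_involutive (G := G)).toPerm.trans R.next

/-- Number of faces, summed over the components; a component that is a single vertex has one
face, which is not traced by any dart. -/
noncomputable def RotationSystem.numFaces {V : Type*} {G : SimpleGraph V}
    (R : RotationSystem G) : ℕ :=
  Nat.card (Quotient (Equiv.Perm.SameCycle.setoid R.facePerm)) +
    Nat.card {v : V // ∀ w : V, ¬ G.Adj v w}

/-- The finite graph `G` can be drawn without crossings on the sphere with `g` handles. By Euler's
formula, the component genera of a rotation system sum to `(2c - V + E - F) / 2`, where `c` is the
number of components. -/
def SimpleGraph.EmbedsInGenus {V : Type*} (G : SimpleGraph V) (g : ℕ) : Prop :=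
  ∃ R : RotationSystem G,
    2 * Nat.card G.ConnectedComponent + Nat.card G.edgeSet ≤ Nat.card V + R.numFaces + 2 * g

/-- The (minimum) genus of a finite graph. -/
noncomputable def SimpleGraph.minGenus {V : Type*} (G : SimpleGraph V) : ℕ :=
  sInf {g : ℕ | G.EmbedsInGenus g}

/-! ### Monotone circuits -/

/-- Vertex labels of a monotone circuit. All literals are positive, so that an input vertex is the
same as a variable. -/
inductive VertexKind : Type
  | var : VertexKind
  | and : VertexKind
  | or : VertexKind

/-- A finite directed graph with vertex labels and a designated output vertex;
`adj u v = true` means that there is an edge from `u` to `v` (`u` is incoming to `v`). -/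
structure MonotoneCircuit where
  order : ℕ
  kind : Fin order → VertexKind
  adj : Fin order → Fin order → Bool
  out : Fin order

namespace MonotoneCircuit

/-- There is an edge from `u` to `v`. -/
def Edge (C : MonotoneCircuit) (u v : Fin C.order) : Prop := C.adj u v = true

def IsVar (C : MonotoneCircuit) (v : Fin C.order) : Prop := C.kind v = .var

def IsGate (C : MonotoneCircuit) (v : Fin C.order) : Prop := C.kind v ≠ .var

/-- Number of variables. -/
noncomputable def numVars (C : MonotoneCircuit) : ℕ := {v | C.IsVar v}.ncard

noncomputable def indegree (C : MonotoneCircuit) (v : Fin C.order) : ℕ := {u | C.Edge u v}.ncard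

noncomputable def outdegree (C : MonotoneCircuit) (v : Fin C.order) : ℕ := {w | C.Edge v w}.ncard

/-- There is a directed path with `ℓ` edges from the first vertex to the second one. -/
inductive PathOfLength (C : MonotoneCircuit) : ℕ → Fin C.order → Fin C.order → Prop
  | refl (v : Fin C.order) : PathOfLength C 0 v v
  | step {ℓ : ℕ} {u v w : Fin C.order} :
      C.Edge u v → PathOfLength C ℓ v w → PathOfLength C (ℓ + 1) u w

/-- The vertices that have value 1 when exactly the variables in `τ` are assigned 1. -/
inductive Satisfies (C : MonotoneCircuit) (τ : Finset (Fin C.order)) : Fin C.order → Prop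
  | var {v : Fin C.order} : C.kind v = .var → v ∈ τ → Satisfies C τ v
  | and {v : Fin C.order} : C.kind v = .and → (∀ u, C.Edge u v → Satisfies C τ u) →
      Satisfies C τ v
  | or {u v : Fin C.order} : C.kind v = .or → C.Edge u v → Satisfies C τ u → Satisfies C τ v

/-- `(C, k)` is a yes-instance: `C` has a satisfying assignment of weight (exactly) `k`. -/
def HasWeightedSat (C : MonotoneCircuit) (k : ℕ) : Prop :=
  ∃ τ : Finset (Fin C.order), (∀ v ∈ τ, C.IsVar v) ∧ τ.card = k ∧ C.Satisfies τ C.out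

/-- `C` is a `Π_t⁺` circuit: a directed acyclic graph whose vertices of indegree 0 are the
variables, whose output gate is an and-gate of outdegree 0, in which every gate has outdegree at
most 1 and and-gates alternate with or-gates, and which has depth at most `t`. -/
structure IsPiPlus (C : MonotoneCircuit) (t : ℕ) : Prop where
  acyclic : ∀ v, ¬ Relation.TransGen C.Edge v v
  var_iff : ∀ v, C.IsVar v ↔ C.indegree v = 0
  out_and : C.kind C.out = .and
  out_outdegree : C.outdegree C.out = 0
  gate_outdegree : ∀ v, C.IsGate v → C.outdegree v ≤ 1
  alternating : ∀ u v, C.IsGate u → C.Edge u v → C.kind u ≠ C.kind v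
  depth_le : ∀ v ℓ, C.IsVar v → C.PathOfLength ℓ v C.out → ℓ ≤ t

/-- No simplification applies: every vertex other than the output gate is incoming to some gate,
and every gate other than the output gate has at least two inputs. (That adjacent gates have
different types is part of `IsPiPlus`.) -/
structure IsSimplified (C : MonotoneCircuit) : Prop where
  outdegree_pos : ∀ v, v ≠ C.out → 1 ≤ C.outdegree v
  two_le_indegree : ∀ v, C.IsGate v → v ≠ C.out → 2 ≤ C.indegree v

/-- A critical gate is an or-gate that is incoming to the output gate. -/
def IsCritical (C : MonotoneCircuit) (p : Fin C.order) : Prop :=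
  C.kind p = .or ∧ C.Edge p C.out

noncomputable def numCritical (C : MonotoneCircuit) : ℕ := {p | C.IsCritical p}.ncard

/-- The gates of the subtree `T_p` of the tree of gates that is rooted at the gate `p`. -/
def subtree (C : MonotoneCircuit) (p : Fin C.order) : Set (Fin C.order) :=
  {q | C.IsGate q ∧ Relation.ReflTransGen C.Edge q p}

/-- Number of critical gates `p` such that `x` is incoming to some gate of `T_p`. -/
noncomputable def numSubtreesFed (C : MonotoneCircuit) (x : Fin C.order) : ℕ :=
  {p | C.IsCritical p ∧ ∃ q ∈ C.subtree p, C.Edge x q}.ncard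

/-- The underlying undirected graph after the output gate has been removed. -/
def graph (C : MonotoneCircuit) : SimpleGraph {v : Fin C.order // v ≠ C.out} :=
  SimpleGraph.fromRel fun u v => C.Edge u.1 v.1

/-- The genus of a circuit. -/
noncomputable def genus (C : MonotoneCircuit) : ℕ := C.graph.minGenus

end MonotoneCircuit

/-! ### Encodings of inputs and outputs -/

def VertexKind.encode : VertexKind → Data
  | .var => Data.ofNat 0
  | .and => Data.ofNat 1
  | .or => Data.ofNat 2

/-- The output vertex, followed by the list of all vertices `v`, each with its label and the
`v`-th column of the adjacency matrix. -/
def MonotoneCircuit.encode (C : MonotoneCircuit) : Data :=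
  .cons (Data.ofNat C.out) (Data.ofList ((List.finRange C.order).map fun v =>
    .cons (C.kind v).encode
      (Data.ofList ((List.finRange C.order).map fun u => Data.ofBool (C.adj u v)))))

/-- Encoding of an instance `(C, k)`. -/
def encodeInstance (I : MonotoneCircuit × ℕ) : Data :=
  .cons I.1.encode (Data.ofNat I.2)

/-- The result of the algorithm: a yes/no answer, or a list of instances. -/
inductive Outcome : Type
  | decided : Bool → Outcome
  | reduced : List (MonotoneCircuit × ℕ) → Outcome

def Outcome.encode : Outcome → Data
  | .decided b => .cons (Data.ofBool false) (Data.ofBool b)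
  | .reduced L => .cons (Data.ofBool true) (Data.ofList (L.map encodeInstance))

/-- What the result has to satisfy on the instance `(C, k)`, if at most `M` instances may be
produced: an answer is correct; a list of instances of the problem for `Π_t⁺` circuits has a
yes-instance if and only if `(C, k)` is one, and satisfies the structural conditions. -/
def Outcome.IsValid (t : ℕ) (C : MonotoneCircuit) (k M : ℕ) : Outcome → Prop
  | .decided b => b = true ↔ C.HasWeightedSat k
  | .reduced L =>
      L.length ≤ M ∧
      (C.HasWeightedSat k ↔ ∃ I ∈ L, I.1.HasWeightedSat I.2) ∧
      ∀ I ∈ L,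
        I.1.IsPiPlus t ∧ I.1.IsSimplified ∧ I.2 ≤ k ∧
        I.1.numCritical ≤ 2 * I.2 ∧
        (∀ x, I.1.IsVar x → I.1.numSubtreesFed x ≤ 2) ∧
        I.1.genus ≤ C.genus

/-! The instances come from a search tree. Let `X` be the variables chosen so far (at the root,
those incoming to the output), `T` the vertices that are true under `X`, `r = k - |X|`, and `m` the
number of critical gates outside `T`. The degree of a variable is the number of these critical gates
whose subtree it feeds through a live gate, that is, a gate with no vertex of `T` on its way to the
output. A variable outside `T` is a candidate if its degree is at least 3 and `m ≤ degree * r`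
(`RawCircuit.isCand`). A solution that contains `X` either contains a candidate, and the tree
branches over all of them, or contains none, and then the candidates can be set to 0.

In the second case at most `r` further variables have to reach `m` critical subtrees. If `m > 2r`,
one of them has degree at least `m / r > 2` and is a candidate after all; so `m ≤ 2r`
(`RawCircuit.IsPi.length_crit_le`). But then every variable of degree at least 3 is a candidate, so
the remaining ones have degree at most 2 (`RawCircuit.IsPi.deg_le_two`). These are the two bounds
required of the residual circuit, in which `T` and the candidates are removed.

To simplify the residual circuit, and-gates with one remaining input are merged with the or-gates
around them, and gates are padded with `r + 2` new variables. At an and-gate that lost a candidate,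
or below an additional and-gate, these cannot all be true at weight `r`, so that the gate is false
as it should be. At an or-gate with a genuine variable as input, a new variable can be exchanged for
that variable. Equivalence is `RawCircuit.IsPi.sat_of_residual` and
`RawCircuit.IsPi.residual_of_sat`. The graph of the residual circuit is a minor of the given one
with leaves attached, so its genus does not increase (`MonotoneCircuit.IsPiPlus.genus_residual_le`).

Candidates are few: contracting the critical subtrees yields a bipartite graph of genus at most `g`
between `s` candidates and `m` gates, and Euler's formula bounds the sum of the degrees by `2(m + s)
+ 4g`. With both thresholds this gives `s ≤ 6r + 12rg` (`MonotoneCircuit.IsPiPlus.card_cand_le`).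
The tree has depth at most `k`, so its size is about `(kg)^(k+1)`. Once `μ(n) > k`, `g(n)^(k+1) ≤
n`; all smaller `n` are bounded in terms of `k`. Thus there are at most `F(k) n` nodes
(`IsSubpolynomial.exists_bound`).

The genus arguments use pairs of permutations of darts. The inequality `HypermapGenusLE` is stable
under splitting a cycle, under joining components and under duality; deletion, contraction and
leaves follow from these. The algorithm is composed from polynomial-time functions on trees, with
one fold whose accumulator is the list of the nodes of the search tree (`exists_prog`). -/

section

/-! ### Classes of generated equivalence relations -/

/-- The number of classes of the equivalence relation generated by `r`. -/
noncomputable def numClasses {α : Type*} (r : α → α → Prop) : ℕ := Nat.card (Quot r)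

section numClasses

variable {α : Type*} {r s : α → α → Prop}

theorem eqvGen_of_forall (h : ∀ x y, r x y → Relation.EqvGen s x y) {x y : α}
    (hxy : Relation.EqvGen r x y) : Relation.EqvGen s x y := by
  induction hxy with
  | rel x y hr => exact h x y hr
  | refl x => exact .refl x
  | symm x y _ ih => exact .symm _ _ ih
  | trans x y z _ _ ih₁ ih₂ => exact .trans _ _ _ ih₁ ih₂

theorem eqvGen_map {β : Type*} {s : β → β → Prop} {f : α → β}
    (h : ∀ x y, r x y → Relation.EqvGen s (f x) (f y)) {x y : α}
    (hxy : Relation.EqvGen r x y) : Relation.EqvGen s (f x) (f y) := by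
  induction hxy with
  | rel x y hr => exact h x y hr
  | refl x => exact .refl _
  | symm x y _ ih => exact .symm _ _ ih
  | trans x y z _ _ ih₁ ih₂ => exact .trans _ _ _ ih₁ ih₂

theorem numClasses_anti [Finite α] (h : ∀ x y, r x y → Relation.EqvGen s x y) :
    numClasses s ≤ numClasses r := by
  have : Finite (Quot r) := Finite.of_surjective _ Quot.mk_surjective
  refine Nat.card_le_card_of_surjective
    (Quot.lift (Quot.mk s) fun x y hr => Quot.eqvGen_sound (h x y hr)) ?_
  rintro ⟨x⟩
  exact ⟨Quot.mk r x, rfl⟩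

theorem numClasses_congr [Finite α] (h : ∀ x y, r x y → Relation.EqvGen s x y)
    (h' : ∀ x y, s x y → Relation.EqvGen r x y) : numClasses r = numClasses s :=
  le_antisymm (numClasses_anti h') (numClasses_anti h)

/-- One additional pair fuses at most two classes, those of `a` and `b`. So the quotient map is
injective once the class of `a` is set aside. -/
theorem numClasses_le_add_one [Finite α] (r : α → α → Prop) (a b : α) :
    numClasses r ≤ numClasses (fun x y => r x y ∨ (x = a ∧ y = b)) + 1 := by
  classical
  set s : α → α → Prop := fun x y => r x y ∨ (x = a ∧ y = b) with hs
  have : Finite (Quot s) := Finite.of_surjective _ Quot.mk_surjective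
  have key : ∀ x y, Relation.EqvGen s x y → Quot.mk r x = Quot.mk r y ∨
      ((Quot.mk r x = Quot.mk r a ∨ Quot.mk r x = Quot.mk r b) ∧
        (Quot.mk r y = Quot.mk r a ∨ Quot.mk r y = Quot.mk r b)) := by
    intro x y h
    induction h with
    | rel x y h =>
      rcases h with h | ⟨rfl, rfl⟩
      · exact .inl (Quot.sound h)
      · exact .inr ⟨.inl rfl, .inr rfl⟩
    | refl x => exact .inl rfl
    | symm x y _ ih => rcases ih with ih | ih; exacts [.inl ih.symm, .inr ⟨ih.2, ih.1⟩]
    | trans x y z _ _ ih₁ ih₂ =>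
      rcases ih₁ with ih₁ | ih₁
      · rw [ih₁]; exact ih₂
      · rcases ih₂ with ih₂ | ih₂
        · rw [← ih₂]; exact .inr ih₁
        · exact .inr ⟨ih₁.1, ih₂.2⟩
  let π : Quot r → Quot s := Quot.lift (Quot.mk s) fun x y hr => Quot.sound (Or.inl hr)
  -- The class of `a` goes to `none`; this extra point is the `+ 1`.
  let f : Quot r → Option (Quot s) := fun q => if q = Quot.mk r a then none else some (π q)
  have hf : Function.Injective f := by
    rintro ⟨x⟩ ⟨y⟩ h
    change f (Quot.mk r x) = f (Quot.mk r y) at h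
    by_cases hx : Quot.mk r x = Quot.mk r a <;> by_cases hy : Quot.mk r y = Quot.mk r a
    · rw [hx, hy]
    · simp [f, hx, hy] at h
    · simp [f, hx, hy] at h
    · simp only [f, hx, hy, if_false, Option.some.injEq] at h
      rcases key x y (Quot.eqvGen_exact h) with h | ⟨h₁, h₂⟩
      · exact h
      · rw [h₁.resolve_left hx, h₂.resolve_left hy]
  have := Nat.card_le_card_of_injective f hf
  rwa [Finite.card_option] at this

/-- The quotient map is surjective and identifies the classes of `a` and `b`. -/
theorem numClasses_add_one_le [Finite α] {a b : α} (h : ∀ x y, r x y → Relation.EqvGen s x y)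
    (hab : ¬ Relation.EqvGen r a b) (hab' : Relation.EqvGen s a b) :
    numClasses s + 1 ≤ numClasses r := by
  have : Finite (Quot r) := Finite.of_surjective _ Quot.mk_surjective
  have : Finite (Quot s) := Finite.of_surjective _ Quot.mk_surjective
  have := Fintype.ofFinite (Quot r)
  have := Fintype.ofFinite (Quot s)
  rw [numClasses, numClasses, Nat.card_eq_fintype_card, Nat.card_eq_fintype_card]
  refine Fintype.card_lt_of_surjective_not_injective
    (Quot.lift (Quot.mk s) fun x y hr => Quot.eqvGen_sound (h x y hr)) ?_ ?_
  · rintro ⟨x⟩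
    exact ⟨Quot.mk r x, rfl⟩
  · intro hinj
    exact hab (Quot.eqvGen_exact (hinj (a₁ := Quot.mk r a) (a₂ := Quot.mk r b)
      (Quot.eqvGen_sound hab')))

/-- Points outside of the range of an embedding that are related only to themselves each contribute
one class. -/
theorem numClasses_extend {β : Type*} [Finite β] {ι : α → β} (hι : Function.Injective ι)
    {r : α → α → Prop} {s : β → β → Prop} (h : ∀ x y, r x y → s (ι x) (ι y))
    (h' : ∀ x y, s x y → x = y ∨ ∃ a b, x = ι a ∧ y = ι b ∧ r a b) :
    numClasses s = numClasses r + Nat.card {y : β // y ∉ Set.range ι} := by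
  classical
  have : Finite α := Finite.of_injective ι hι
  have : Finite (Quot r) := Finite.of_surjective _ Quot.mk_surjective
  rw [numClasses, numClasses, ← Nat.card_sum]
  let g : β → Quot r ⊕ {y : β // y ∉ Set.range ι} := fun y =>
    if hy : ∃ x, ι x = y then .inl (Quot.mk r hy.choose) else .inr ⟨y, hy⟩
  have hg : ∀ x, g (ι x) = .inl (Quot.mk r x) := by
    intro x
    have hy : ∃ x', ι x' = ι x := ⟨x, rfl⟩
    simp only [g, hy, dif_pos]
    rw [hι hy.choose_spec]
  refine Nat.card_congr
    { toFun := Quot.lift g ?_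
      invFun := Sum.elim (Quot.lift (fun x => Quot.mk s (ι x)) fun x y hr => Quot.sound (h x y hr))
        fun y => Quot.mk s y.1
      left_inv := ?_
      right_inv := ?_ }
  · intro x y hs
    rcases h' x y hs with rfl | ⟨a, b, rfl, rfl, hr⟩
    · rfl
    · rw [hg, hg, Quot.sound hr]
  · rintro ⟨y⟩
    change Sum.elim _ _ (g y) = Quot.mk s y
    by_cases hy : ∃ x, ι x = y
    · obtain ⟨x, rfl⟩ := hy
      rw [hg]; rfl
    · simp [g, hy]
  · rintro (q | ⟨y, hy⟩)
    · induction q using Quot.ind with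
      | mk x => exact hg x
    · change g y = _
      have hy' : ¬ ∃ x, ι x = y := hy
      simp [g, hy']

end numClasses

/-! ### Cycles of permutations and transpositions -/

namespace Equiv.Perm

variable {D : Type*} {π σ α : Equiv.Perm D} {a b : D}

theorem eqvGen_sameCycle {x y : D} : Relation.EqvGen (SameCycle π) x y ↔ SameCycle π x y :=
  (SameCycle.equivalence π).eqvGen_iff

/-- The number of cycles, fixed points included. -/
noncomputable def numCycles (π : Equiv.Perm D) : ℕ := numClasses (SameCycle π)

theorem numCycles_inv (π : Equiv.Perm D) : numCycles π⁻¹ = numCycles π := by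
  unfold numCycles
  congr 1
  ext x y
  exact sameCycle_inv

theorem numCycles_conj [Finite D] (π τ : Equiv.Perm D) :
    numCycles (τ * π * τ⁻¹) = numCycles π := by
  unfold numCycles numClasses
  refine Nat.card_congr (Quot.congr τ.symm fun x y => ?_)
  exact sameCycle_conj

theorem sameCycle_of_forall_apply {x y : D} (h : ∀ x, SameCycle σ x (π x))
    (hxy : SameCycle π x y) : SameCycle σ x y := by
  obtain ⟨i, rfl⟩ := hxy
  induction i using Int.induction_on with
  | zero => exact SameCycle.refl _ _
  | succ i ih =>
    rw [add_comm, zpow_add, zpow_one]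
    exact ih.trans (h _)
  | pred i ih =>
    refine ih.trans ?_
    have := h ((π ^ (-(i : ℤ) - 1)) x)
    rw [← Equiv.Perm.mul_apply, ← zpow_one_add] at this
    rw [show (1 : ℤ) + (-(i : ℤ) - 1) = -i by ring] at this
    exact this.symm

variable [DecidableEq D]

/-- Powers agree as long as the transposed points are not met. -/
theorem swap_mul_pow_apply {x : D} {n : ℕ}
    (h : ∀ i < n, (π ^ (i + 1)) x ≠ a ∧ (π ^ (i + 1)) x ≠ b) :
    ((swap a b * π) ^ n) x = (π ^ n) x := by
  induction n with
  | zero => rfl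
  | succ n ih =>
    rw [pow_succ', Equiv.Perm.mul_apply, ih fun i hi => h i (hi.trans n.lt_succ_self),
      Equiv.Perm.mul_apply, ← Equiv.Perm.mul_apply π, ← pow_succ']
    exact swap_apply_of_ne_of_ne (h n n.lt_succ_self).1 (h n n.lt_succ_self).2

/-- The `π`-orbit of `a` does not meet `b`; at its first return to `a` the transposition diverts it
to `b`. -/
theorem sameCycle_swap_mul_of_not [Finite D] (h : ¬ SameCycle π a b) :
    SameCycle (swap a b * π) a b := by
  classical
  have hex : ∃ n, 0 < n ∧ (π ^ n) a = a := ⟨orderOf π, orderOf_pos π, by simp⟩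
  obtain ⟨hn, hna⟩ := Nat.find_spec hex
  have hmin : ∀ m, 0 < m → m < Nat.find hex → (π ^ m) a ≠ a := fun m hm hlt hma =>
    Nat.find_min hex hlt ⟨hm, hma⟩
  obtain ⟨n, hn'⟩ : ∃ n, Nat.find hex = n + 1 := ⟨Nat.find hex - 1, by omega⟩
  refine ⟨(n + 1 : ℕ), ?_⟩
  rw [zpow_natCast, pow_succ', Equiv.Perm.mul_apply, swap_mul_pow_apply, Equiv.Perm.mul_apply,
    ← Equiv.Perm.mul_apply π, ← pow_succ', ← hn', hna, swap_apply_left]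
  intro i hi
  refine ⟨hmin _ i.succ_pos (by omega), fun hb => h ⟨(i + 1 : ℕ), ?_⟩⟩
  rw [zpow_natCast]; exact hb

/-- If `n + 1` is the first time at which `π` carries `a` to `b`, the product carries `a` back to
`a` at that time. Its cycle therefore consists of iterates before the visit to `b`. -/
theorem not_sameCycle_swap_mul [Finite D] (h : SameCycle π a b) (hab : a ≠ b) :
    ¬ SameCycle (swap a b * π) a b := by
  classical
  have hex : ∃ n, (π ^ n) a = b := h.exists_nat_pow_eq
  have hna := Nat.find_spec hex
  have hmin : ∀ m, m < Nat.find hex → (π ^ m) a ≠ b := fun m hlt hma => Nat.find_min hex hlt hma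
  obtain ⟨n, hn'⟩ : ∃ n, Nat.find hex = n + 1 := by
    refine ⟨Nat.find hex - 1, ?_⟩
    rcases Nat.eq_zero_or_pos (Nat.find hex) with h0 | h0
    · rw [h0] at hna; exact absurd hna hab
    · omega
  -- An earlier return to `a` would lead to an earlier visit to `b`.
  have hmina : ∀ i, i < n → (π ^ (i + 1)) a ≠ a := by
    intro i hi hia
    refine hmin (n - i) (by omega) ?_
    have : (π ^ (n - i)) ((π ^ (i + 1)) a) = b := by
      rw [← Equiv.Perm.mul_apply, ← pow_add, show n - i + (i + 1) = n + 1 by omega, ← hn', hna]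
    rwa [hia] at this
  have hpow : ∀ m ≤ n, ((swap a b * π) ^ m) a = (π ^ m) a := fun m hm =>
    swap_mul_pow_apply fun i hi => ⟨hmina i (by omega), hmin _ (by omega)⟩
  have hret : ((swap a b * π) ^ (n + 1)) a = a := by
    rw [pow_succ', Equiv.Perm.mul_apply, hpow n le_rfl, Equiv.Perm.mul_apply,
      ← Equiv.Perm.mul_apply π, ← pow_succ', ← hn', hna, swap_apply_right]
  intro hs
  obtain ⟨m, hm⟩ := hs.exists_nat_pow_eq
  have hm' : ((swap a b * π) ^ (m % (n + 1))) a = b := by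
    rw [← Nat.div_add_mod m (n + 1), add_comm, pow_add, Equiv.Perm.mul_apply, pow_mul] at hm
    have : (((swap a b * π) ^ (n + 1)) ^ (m / (n + 1))) a = a := by
      generalize m / (n + 1) = j
      induction j with
      | zero => rfl
      | succ j ih => rw [pow_succ, Equiv.Perm.mul_apply, hret, ih]
    rwa [this] at hm
  have hlt : m % (n + 1) < n + 1 := Nat.mod_lt _ n.succ_pos
  rw [hpow _ (by omega)] at hm'
  exact hmin _ (by omega) hm'

/-- In the joining case cycles only grow: a step of `π` differs from a step of the product at most
by an exchange of `a` and `b`. -/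
theorem sameCycle_swap_mul [Finite D] {x y : D} (hab : SameCycle (swap a b * π) a b)
    (h : SameCycle π x y) : SameCycle (swap a b * π) x y := by
  refine sameCycle_of_forall_apply (fun x => ?_) h
  have hx : SameCycle (swap a b * π) x (swap a b (π x)) := by
    rw [← Equiv.Perm.mul_apply]
    exact sameCycle_apply_right.2 (SameCycle.refl _ _)
  rcases eq_or_ne (π x) a with h₁ | h₁
  · rw [h₁] at hx ⊢
    rw [swap_apply_left] at hx
    exact hx.trans hab.symm
  rcases eq_or_ne (π x) b with h₂ | h₂
  · rw [h₂] at hx ⊢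
    rw [swap_apply_right] at hx
    exact hx.trans hab
  rwa [swap_apply_of_ne_of_ne h₁ h₂] at hx

/-- A cycle minus a point is still a cycle. -/
theorem sameCycle_swap_apply_mul [Finite D] {x y d : D} (hx : x ≠ d) (hy : y ≠ d)
    (h : SameCycle π x y) : SameCycle (swap d (π d) * π) x y := by
  obtain ⟨n, rfl⟩ := h.exists_nat_pow_eq
  clear h
  -- Strong induction, because passing through `d` uses two steps of `π` but only one step of the
  -- new permutation.
  induction n using Nat.strong_induction_on generalizing x with
  | _ n ih =>
    rcases n with _ | n
    · exact SameCycle.refl _ _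
    have step : SameCycle (swap d (π d) * π) x (swap d (π d) (π x)) := by
      rw [← Equiv.Perm.mul_apply]
      exact sameCycle_apply_right.2 (SameCycle.refl _ _)
    have hne : π x ≠ π d := fun h => hx (π.injective h)
    rcases eq_or_ne (π x) d with h₁ | h₁
    · rcases n with _ | n
      · exact absurd h₁ (by simpa using hy)
      · rw [h₁, swap_apply_left] at step
        refine step.trans ?_
        have e : (π ^ (n + 1 + 1)) x = (π ^ n) (π d) := by
          rw [pow_succ, pow_succ, Equiv.Perm.mul_apply, Equiv.Perm.mul_apply, h₁]
        rw [e] at hy ⊢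
        have hd : π d ≠ d := by
          intro hd
          exact hx (π.injective (h₁.trans hd.symm))
        exact ih n (by omega) hd hy
    · rw [swap_apply_of_ne_of_ne h₁ hne] at step
      refine step.trans ?_
      have e : (π ^ (n + 1)) x = (π ^ n) (π x) := by rw [pow_succ, Equiv.Perm.mul_apply]
      rw [e] at hy ⊢
      exact ih n (by omega) h₁ hy

/-- The other half of the count: multiplying by a transposition identifies nothing beyond its two
points, so at most one cycle is lost. -/
theorem eqvGen_swap_mul (x y : D) (h : SameCycle (swap a b * π) x y) :
    Relation.EqvGen (fun x y => SameCycle π x y ∨ (x = a ∧ y = b)) x y := by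
  obtain ⟨i, rfl⟩ := h
  have step : ∀ z, Relation.EqvGen (fun x y => SameCycle π x y ∨ (x = a ∧ y = b)) z
      ((swap a b * π) z) := by
    intro z
    have h1 : Relation.EqvGen (fun x y => SameCycle π x y ∨ (x = a ∧ y = b)) z (π z) :=
      .rel _ _ (.inl (sameCycle_apply_right.2 (SameCycle.refl _ _)))
    have hab : Relation.EqvGen (fun x y => SameCycle π x y ∨ (x = a ∧ y = b)) a b :=
      .rel _ _ (.inr ⟨rfl, rfl⟩)
    rw [Equiv.Perm.mul_apply]
    rcases eq_or_ne (π z) a with h₁ | h₁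
    · rw [h₁] at h1 ⊢
      rw [swap_apply_left]
      exact .trans _ _ _ h1 hab
    rcases eq_or_ne (π z) b with h₂ | h₂
    · rw [h₂] at h1 ⊢
      rw [swap_apply_right]
      exact .trans _ _ _ h1 (.symm _ _ hab)
    rwa [swap_apply_of_ne_of_ne h₁ h₂]
  induction i using Int.induction_on with
  | zero => exact .refl _
  | succ i ih =>
    rw [add_comm, zpow_add, zpow_one]
    exact .trans _ _ _ ih (step _)
  | pred i ih =>
    refine .trans _ _ _ ih (.symm _ _ ?_)
    have := step (((swap a b * π) ^ (-(i : ℤ) - 1)) x)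
    rw [← Equiv.Perm.mul_apply, ← zpow_one_add] at this
    rwa [show (1 : ℤ) + (-(i : ℤ) - 1) = -i by ring] at this

theorem numCycles_swap_mul_of_not [Finite D] (h : ¬ SameCycle π a b) :
    numCycles (swap a b * π) + 1 = numCycles π := by
  have hs := sameCycle_swap_mul_of_not h
  have h1 : numCycles (swap a b * π) + 1 ≤ numCycles π :=
    numClasses_add_one_le (a := a) (b := b)
      (fun x y hxy => .rel _ _ (sameCycle_swap_mul hs hxy))
      (by rwa [eqvGen_sameCycle]) (.rel _ _ hs)
  have h2 := numClasses_le_add_one (SameCycle π) a b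
  have h3 : numClasses (fun x y => SameCycle π x y ∨ (x = a ∧ y = b)) ≤ numCycles (swap a b * π) :=
    numClasses_anti eqvGen_swap_mul
  have h4 : numCycles π = numClasses (SameCycle π) := rfl
  omega

/-- Splitting is joining read backwards: multiplying by the transposition again restores `π`. -/
theorem numCycles_swap_mul_of_sameCycle [Finite D] (h : SameCycle π a b) (hab : a ≠ b) :
    numCycles (swap a b * π) = numCycles π + 1 := by
  have := numCycles_swap_mul_of_not (not_sameCycle_swap_mul h hab)
  rw [swap_mul_self_mul] at this
  exact this.symm

end Equiv.Perm

end

/-! ### Genus of pairs of permutations; deletion and contraction of edges. -/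

section

open Equiv Equiv.Perm

/-! ### Genus of a pair of permutations -/

section Hypermap

variable {D : Type*} {σ α : Equiv.Perm D} {a b d : D} {g : ℕ}

/-- Two darts are joined by one of the two permutations. -/
def Linked (σ α : Equiv.Perm D) (x y : D) : Prop := SameCycle σ x y ∨ SameCycle α x y

/-- The hypermap with vertex permutation `σ`, edge permutation `α` and face permutation `σ * α`
has genus at most `g`. -/
def HypermapGenusLE (σ α : Equiv.Perm D) (g : ℕ) : Prop :=
  2 * numClasses (Linked σ α) + Nat.card D ≤
    numCycles σ + numCycles α + numCycles (σ * α) + 2 * g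

theorem eqvGen_linked_mul {x y : D} (h : SameCycle (σ * α) x y) :
    Relation.EqvGen (Linked σ α) x y := by
  have step : ∀ z, Relation.EqvGen (Linked σ α) z ((σ * α) z) := fun z =>
    .trans _ (α z) _ (.rel _ _ (.inr (sameCycle_apply_right.2 (SameCycle.refl _ _))))
      (.rel _ _ (.inl (sameCycle_apply_right.2 (SameCycle.refl _ _))))
  obtain ⟨i, rfl⟩ := h
  induction i using Int.induction_on with
  | zero => exact .refl _
  | succ i ih =>
    rw [add_comm, zpow_add, zpow_one]
    exact .trans _ _ _ ih (step _)
  | pred i ih =>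
    refine .trans _ _ _ ih (.symm _ _ ?_)
    have := step (((σ * α) ^ (-(i : ℤ) - 1)) x)
    rw [← Equiv.Perm.mul_apply, ← zpow_one_add] at this
    rwa [show (1 : ℤ) + (-(i : ℤ) - 1) = -i by ring] at this

section

variable [DecidableEq D]

theorem eqvGen_linked_swap_mul (h : Relation.EqvGen (Linked (Equiv.swap a b * σ) α) a b) {x y : D}
    (hxy : Linked σ α x y) : Relation.EqvGen (Linked (Equiv.swap a b * σ) α) x y := by
  rcases hxy with hxy | hxy
  · have hσ : σ = Equiv.swap a b * (Equiv.swap a b * σ) := by rw [swap_mul_self_mul]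
    rw [hσ] at hxy
    refine eqvGen_of_forall ?_ (eqvGen_swap_mul x y hxy)
    rintro x y (h' | ⟨rfl, rfl⟩)
    · exact .rel _ _ (.inl h')
    · exact h
  · exact .rel _ _ (.inr hxy)

end

variable [Finite D]

/-- Vertices and edges play symmetric roles, since `σ * α` and `α * σ` are conjugate. -/
theorem HypermapGenusLE.swap (h : HypermapGenusLE σ α g) : HypermapGenusLE α σ g := by
  have h1 : numClasses (Linked α σ) = numClasses (Linked σ α) :=
    numClasses_congr (fun x y h => .rel _ _ h.symm) (fun x y h => .rel _ _ h.symm)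
  have h2 : numCycles (α * σ) = numCycles (σ * α) := by
    rw [← numCycles_conj (α * σ) α⁻¹]
    congr 1
    group
  unfold HypermapGenusLE at *
  omega

/-- Faces become vertices. The product of the new pair is `σ` again, so the three cycle counts are
merely permuted, and the same darts are linked. -/
theorem HypermapGenusLE.dual (h : HypermapGenusLE σ α g) : HypermapGenusLE (σ * α) α⁻¹ g := by
  have h1 : numClasses (Linked (σ * α) α⁻¹) = numClasses (Linked σ α) := by
    refine numClasses_congr (fun x y h => ?_) (fun x y h => ?_)
    · rcases h with h | h
      · exact eqvGen_linked_mul h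
      · exact .rel _ _ (.inr (sameCycle_inv.1 h))
    · rcases h with h | h
      · have : σ = σ * α * α⁻¹ := by group
        rw [this] at h
        exact eqvGen_linked_mul h
      · exact .rel _ _ (.inr (sameCycle_inv.2 h))
  have h2 : σ * α * α⁻¹ = σ := by group
  unfold HypermapGenusLE at *
  rw [h1, h2, numCycles_inv]
  omega

variable [DecidableEq D]

/-- Splitting a cycle of one of the permutations does not increase the genus. -/
theorem HypermapGenusLE.split (h : HypermapGenusLE σ α g) (hab : SameCycle σ a b) :
    HypermapGenusLE (Equiv.swap a b * σ) α g := by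
  rcases eq_or_ne a b with rfl | hne
  · rw [Equiv.swap_self]
    exact h
  have h1 := numCycles_swap_mul_of_sameCycle hab hne
  have hmul : Equiv.swap a b * σ * α = Equiv.swap a b * (σ * α) := mul_assoc _ _ _
  unfold HypermapGenusLE at *
  rw [h1, hmul]
  -- If `a` and `b` lie on one face, it splits as well, and two new cycles pay for at most one new
  -- component. Otherwise two faces fuse, the number of cycles is unchanged, and the fused face
  -- keeps `a` and `b` linked, so that no component is created.
  by_cases hφ : SameCycle (σ * α) a b
  · have h2 := numCycles_swap_mul_of_sameCycle hφ hne
    have h3 := numClasses_le_add_one (Linked (Equiv.swap a b * σ) α) a b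
    have h4 : numClasses (fun x y => Linked (Equiv.swap a b * σ) α x y ∨ (x = a ∧ y = b)) ≤
        numClasses (Linked σ α) := by
      refine numClasses_anti fun x y hxy => ?_
      rcases hxy with hxy | hxy
      · have hσ : σ = Equiv.swap a b * (Equiv.swap a b * σ) := by rw [swap_mul_self_mul]
        rw [hσ] at hxy
        refine eqvGen_of_forall ?_ (eqvGen_swap_mul x y hxy)
        rintro x y (h' | h')
        · exact .rel _ _ (.inl (.inl h'))
        · exact .rel _ _ (.inr h')
      · exact .rel _ _ (.inl (.inr hxy))
    omega
  · have h2 := numCycles_swap_mul_of_not hφ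
    have h5 : Relation.EqvGen (Linked (Equiv.swap a b * σ) α) a b := by
      apply eqvGen_linked_mul
      rw [hmul]
      exact sameCycle_swap_mul_of_not hφ
    have h3 : numClasses (Linked (Equiv.swap a b * σ) α) ≤ numClasses (Linked σ α) :=
      numClasses_anti fun x y hxy => eqvGen_linked_swap_mul h5 hxy
    omega

/-- Joining two components does not increase the genus. -/
theorem HypermapGenusLE.join (h : HypermapGenusLE σ α g)
    (hab : ¬ Relation.EqvGen (Linked σ α) a b) : HypermapGenusLE (Equiv.swap a b * σ) α g := by
  -- Points of different components lie on different vertices and faces. One vertex and one face are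
  -- lost, and the lost component counts twice.
  have h1 := numCycles_swap_mul_of_not (π := σ) (a := a) (b := b)
    fun h => hab (.rel _ _ (.inl h))
  have h2 := numCycles_swap_mul_of_not (π := σ * α) (a := a) (b := b)
    fun h => hab (eqvGen_linked_mul h)
  have hs : Relation.EqvGen (Linked (Equiv.swap a b * σ) α) a b :=
    .rel _ _ (.inl (sameCycle_swap_mul_of_not fun h => hab (.rel _ _ (.inl h))))
  have h3 : numClasses (Linked (Equiv.swap a b * σ) α) + 1 ≤ numClasses (Linked σ α) :=
    numClasses_add_one_le (fun x y hxy => eqvGen_linked_swap_mul hs hxy) hab hs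
  unfold HypermapGenusLE at *
  rw [mul_assoc]
  omega

end Hypermap

/-! ### Embedded multigraphs with labelled vertices -/

/-- The darts `d` with `α d ≠ d` are those of a multigraph that is embedded with genus at most `g`
by the rotation `σ`; `vert` is the vertex at which a dart starts. Darts that are fixed by `α` are
not part of the multigraph. -/
structure IsEmbedding {D V : Type*} (vert : D → V) (σ α : Equiv.Perm D) (g : ℕ) : Prop where
  invol : ∀ d, α (α d) = d
  dead : ∀ d, α d = d → σ d = d
  vert_apply : ∀ d, vert (σ d) = vert d
  cyclic : ∀ d e, α d ≠ d → α e ≠ e → vert d = vert e → SameCycle σ d e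
  genus_le : HypermapGenusLE σ α g

namespace IsEmbedding

variable {D V : Type*} {vert : D → V} {σ α : Equiv.Perm D} {g : ℕ}

theorem inv_eq (h : IsEmbedding vert σ α g) : α⁻¹ = α := by
  ext d
  rw [Equiv.Perm.inv_eq_iff_eq, h.invol]

theorem vert_eq_of_sameCycle (h : IsEmbedding vert σ α g) {d e : D} (hde : SameCycle σ d e) :
    vert d = vert e := by
  obtain ⟨i, rfl⟩ := hde
  induction i using Int.induction_on with
  | zero => rfl
  | succ i ih => rw [add_comm, zpow_add, zpow_one, Equiv.Perm.mul_apply, h.vert_apply, ih]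
  | pred i ih =>
    rw [ih]
    conv_lhs => rw [show -(i : ℤ) = 1 + (-(i : ℤ) - 1) by ring, zpow_one_add,
      Equiv.Perm.mul_apply, h.vert_apply]

section

variable [DecidableEq D]

theorem swap_apply_self_mul_apply {d x : D} (hx : x ≠ d) (hx' : σ x ≠ d) :
    (Equiv.swap d (σ d) * σ) x = σ x := by
  rw [Equiv.Perm.mul_apply]
  exact swap_apply_of_ne_of_ne hx' fun h => hx (σ.injective h)

theorem swap_apply_self_mul_self (σ : Equiv.Perm D) (d : D) : (Equiv.swap d (σ d) * σ) d = d := by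
  rw [Equiv.Perm.mul_apply, swap_apply_right]

theorem swap_apply_self_mul_fixed {d x : D} (hx : σ x = x) :
    (Equiv.swap d (σ d) * σ) x = x := by
  rcases eq_or_ne x d with rfl | hxd
  · exact swap_apply_self_mul_self σ x
  · rw [swap_apply_self_mul_apply hxd (by rwa [hx]), hx]

/-- The edge involution after removal of the edge of `d`. -/
theorem swap_mul_edge (h : ∀ d, α (α d) = d) (d : D) :
    (Equiv.swap d (α d) * α) d = d ∧ (Equiv.swap d (α d) * α) (α d) = α d ∧
      ∀ x, x ≠ d → x ≠ α d → (Equiv.swap d (α d) * α) x = α x := by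
  refine ⟨swap_apply_self_mul_self α d, ?_, fun x hx hx' => ?_⟩
  · rw [Equiv.Perm.mul_apply, h, swap_apply_left]
  · refine swap_apply_self_mul_apply hx fun hx'' => hx' ?_
    rw [← hx'', h]

theorem invol_swap_mul_edge (h : ∀ d, α (α d) = d) (d x : D) :
    (Equiv.swap d (α d) * α) ((Equiv.swap d (α d) * α) x) = x := by
  obtain ⟨h1, h2, h3⟩ := swap_mul_edge h d
  rcases eq_or_ne x d with rfl | hx
  · rw [h1, h1]
  rcases eq_or_ne x (α d) with rfl | hx'
  · rw [h2, h2]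
  rw [h3 x hx hx', h3 _ (fun e => hx' (by rw [← e, h])) (fun e => hx (α.injective e)), h]

/-- The genus bound survives the removal of an edge from the vertex and edge permutations. -/
theorem _root_.HypermapGenusLE.removeEdge [Finite D] {σ α : Equiv.Perm D} {g : ℕ}
    (h : HypermapGenusLE σ α g) (d : D) :
    ∃ τ : Equiv.Perm D,
      τ = Equiv.swap (α d) ((Equiv.swap d (σ d) * σ) (α d)) * (Equiv.swap d (σ d) * σ) ∧
      HypermapGenusLE τ (Equiv.swap d (α d) * α) g := by
  refine ⟨_, rfl, ?_⟩
  -- Both darts of the edge are split off as fixed points of the vertex permutation; then, with the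
  -- roles exchanged, the 2-cycle of `α` is split.
  have h1 := h.split (a := d) (b := σ d) (sameCycle_apply_right.2 (SameCycle.refl _ _))
  have h2 := h1.split (a := α d) (b := (Equiv.swap d (σ d) * σ) (α d))
    (sameCycle_apply_right.2 (SameCycle.refl _ _))
  exact (h2.swap.split (sameCycle_apply_right.2 (SameCycle.refl _ _))).swap

/-- Removal of an edge. -/
theorem delete [Finite D] (h : IsEmbedding vert σ α g) (d : D) :
    ∃ σ' α' : Equiv.Perm D, IsEmbedding vert σ' α' g ∧ α' d = d ∧ α' (α d) = α d ∧
      ∀ x, x ≠ d → x ≠ α d → α' x = α x := by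
  obtain ⟨τ, hτ, hg⟩ := h.genus_le.removeEdge d
  obtain ⟨h1, h2, h3⟩ := swap_mul_edge h.invol d
  have hfix : ∀ x, σ x = x → τ x = x := fun x hx => by
    rw [hτ]
    exact swap_apply_self_mul_fixed (swap_apply_self_mul_fixed hx)
  have hvert : ∀ (π : Equiv.Perm D) (e : D), (∀ x, vert (π x) = vert x) →
      ∀ x, vert ((Equiv.swap e (π e) * π) x) = vert x := by
    intro π e hπ x
    rw [Equiv.Perm.mul_apply, swap_apply_def]
    split_ifs with h₁ h₂
    · rw [hπ, ← h₁, hπ]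
    · rw [π.injective h₂]
    · exact hπ x
  refine ⟨τ, _, ⟨invol_swap_mul_edge h.invol d, ?_, ?_, ?_, hg⟩, h1, h2, h3⟩
  · intro x hx
    rcases eq_or_ne x d with rfl | hxd
    · rw [hτ]
      exact swap_apply_self_mul_fixed (swap_apply_self_mul_self _ _)
    rcases eq_or_ne x (α d) with rfl | hxd'
    · rw [hτ]
      exact swap_apply_self_mul_self _ _
    rw [h3 x hxd hxd'] at hx
    exact hfix x (h.dead x hx)
  · rw [hτ]
    exact hvert _ _ (hvert _ _ h.vert_apply)
  · intro x y hx hy hxy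
    have hx1 : x ≠ d := by rintro rfl; exact hx h1
    have hx2 : x ≠ α d := by rintro rfl; exact hx h2
    have hy1 : y ≠ d := by rintro rfl; exact hy h1
    have hy2 : y ≠ α d := by rintro rfl; exact hy h2
    rw [h3 x hx1 hx2] at hx
    rw [h3 y hy1 hy2] at hy
    rw [hτ]
    exact sameCycle_swap_apply_mul hx2 hy2
      (sameCycle_swap_apply_mul hx1 hy1 (h.cyclic x y hx hy hxy))


/-- Needed in `contract` to identify the permutation obtained from the dual with a fusion of two
vertex cycles from which two darts are dropped. -/
theorem swap_mul_swap_aux (d d' s : D) (hs : s ≠ d) (hd : d' ≠ d) :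
    Equiv.swap d' s * Equiv.swap s d =
      Equiv.swap d (Equiv.swap d' d s) * Equiv.swap d' d := by
  ext x
  simp only [Equiv.Perm.mul_apply, swap_apply_def]
  split_ifs <;> simp_all

/-- Contraction of an edge that is not a loop. -/
theorem contract [Finite D] [DecidableEq V] (h : IsEmbedding vert σ α g) {d : D} (hd : α d ≠ d)
    (hv : vert d ≠ vert (α d)) :
    ∃ σ' α' : Equiv.Perm D,
      IsEmbedding (fun x => if vert x = vert d then vert (α d) else vert x) σ' α' g ∧
      α' d = d ∧ α' (α d) = α d ∧ ∀ x, x ≠ d → x ≠ α d → α' x = α x := by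
  set W : D → V := fun x => if vert x = vert d then vert (α d) else vert x with hW
  -- Contraction is deletion in the dual: the edge is removed from the faces, and dualizing again
  -- gives the new rotation.
  have hdual := h.genus_le.dual
  rw [h.inv_eq] at hdual
  obtain ⟨τ, hτ, hg⟩ := hdual.removeEdge d
  obtain ⟨h1, h2, h3⟩ := swap_mul_edge h.invol d
  set α' := Equiv.swap d (α d) * α with hα'
  have hinv' := invol_swap_mul_edge h.invol d
  rw [← hα'] at hinv'
  have hα'inv : α'⁻¹ = α' := by
    ext x
    rw [Equiv.Perm.inv_eq_iff_eq, hinv']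
  replace hg := hg.dual
  rw [hα'inv] at hg
  have hτd : τ d = d := by
    rw [hτ]; exact swap_apply_self_mul_fixed (swap_apply_self_mul_self _ _)
  have hτd' : τ (α d) = α d := by
    rw [hτ]; exact swap_apply_self_mul_self _ _
  have hWd : W d = W (α d) := by simp [hW]
  have hWσ : ∀ x, W (σ x) = W x := fun x => by simp [hW, h.vert_apply]
  have hWskip : ∀ (π : Equiv.Perm D) (e : D), (∀ y, W (π y) = W (α y)) → W e = W (α e) →
      ∀ y, W ((Equiv.swap e (π e) * π) y) = W (α y) := by
    intro π e hπ he y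
    rw [Equiv.Perm.mul_apply, swap_apply_def]
    split_ifs with h₁ h₂
    · rw [hπ, ← he, ← h₁, hπ]
    · rw [π.injective h₂, he]
    · exact hπ y
  have hWτ : ∀ y, W (τ y) = W (α y) := by
    rw [hτ]
    refine hWskip _ _ (hWskip _ _ (fun y => ?_) hWd) ?_
    · rw [Equiv.Perm.mul_apply, hWσ]
    · rw [h.invol, hWd]
  refine ⟨τ * α', α', ⟨hinv', ?_, ?_, ?_, hg⟩, h1, h2, h3⟩
  · intro x hx
    rw [Equiv.Perm.mul_apply, hx]
    rcases eq_or_ne x d with rfl | hxd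
    · exact hτd
    rcases eq_or_ne x (α d) with rfl | hxd'
    · exact hτd'
    rw [h3 x hxd hxd'] at hx
    have : (σ * α) x = x := by rw [Equiv.Perm.mul_apply, hx, h.dead x hx]
    rw [hτ]
    exact swap_apply_self_mul_fixed (swap_apply_self_mul_fixed this)
  · intro x
    rw [Equiv.Perm.mul_apply, hWτ]
    rcases eq_or_ne x d with rfl | hxd
    · rw [h1, hWd]
    rcases eq_or_ne x (α d) with rfl | hxd'
    · rw [h2, h.invol, hWd]
    rw [h3 x hxd hxd', h.invol]
  · intro x y hx hy hxy
    have hx1 : x ≠ d := by rintro rfl; exact hx h1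
    have hx2 : x ≠ α d := by rintro rfl; exact hx h2
    have hy1 : y ≠ d := by rintro rfl; exact hy h1
    have hy2 : y ≠ α d := by rintro rfl; exact hy h2
    rw [h3 x hx1 hx2] at hx
    rw [h3 y hy1 hy2] at hy
    have hαα : α * α = 1 := by
      ext z; exact h.invol z
    -- `σ₁` fuses the rotations at the two ends of the edge; the new rotation is `σ₁` with `d` and
    -- `α d` skipped.
    set σ₁ := Equiv.swap d (σ (α d)) * σ with hσ₁
    have hnot : ¬ SameCycle σ d (σ (α d)) := fun hs =>
      hv ((h.vert_eq_of_sameCycle hs).trans (h.vert_apply _))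
    have hmerge : SameCycle σ₁ d (σ (α d)) := sameCycle_swap_mul_of_not hnot
    have hmono : ∀ {x y}, SameCycle σ x y → SameCycle σ₁ x y := fun hs =>
      sameCycle_swap_mul hmerge hs
    have hdd' : SameCycle σ₁ d (α d) :=
      hmerge.trans (hmono (sameCycle_apply_left.2 (SameCycle.refl _ _)))
    have hd'' : α (α d) ≠ α d := fun e => hd (α.injective e)
    have hcyc : SameCycle σ₁ x y := by
      simp only [hW] at hxy
      split_ifs at hxy with ha hb hb
      · exact hmono (h.cyclic x y hx hy (ha.trans hb.symm))
      · exact ((hmono (h.cyclic x d hx hd ha)).trans hdd').trans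
          (hmono (h.cyclic _ y hd'' hy hxy))
      · exact ((hmono (h.cyclic x _ hx hd'' hxy)).trans hdd'.symm).trans
          (hmono (h.cyclic _ y hd hy hb.symm))
      · exact hmono (h.cyclic x y hx hy hxy)
    have hσ₁d' : σ₁ (α d) = d := by
      rw [hσ₁, Equiv.Perm.mul_apply, swap_apply_right]
    have hs : σ₁ d ≠ d := fun e => hd (σ₁.injective (hσ₁d'.trans e.symm))
    have hφ₁ : Equiv.swap d ((σ * α) d) * (σ * α) = σ₁ * α := by
      rw [hσ₁, Equiv.Perm.mul_apply, mul_assoc]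
    have hτ' : τ = Equiv.swap (α d) (σ₁ d) * (σ₁ * α) := by
      rw [hτ, hφ₁, Equiv.Perm.mul_apply, h.invol]
    have hα'' : α * α' = Equiv.swap d (α d) := by
      rw [hα', ← mul_assoc, mul_swap_eq_swap_mul, h.invol, mul_assoc, hαα, mul_one,
        Equiv.swap_comm]
    clear_value σ₁
    have key : τ * α' =
        Equiv.swap d ((Equiv.swap (α d) (σ₁ (α d)) * σ₁) d) *
          (Equiv.swap (α d) (σ₁ (α d)) * σ₁) := by
      rw [hτ', mul_assoc, mul_assoc, hα'', mul_swap_eq_swap_mul, hσ₁d', ← mul_assoc, ← mul_assoc,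
        Equiv.Perm.mul_apply, swap_mul_swap_aux d (α d) (σ₁ d) hs hd]
    rw [key]
    exact sameCycle_swap_apply_mul hx1 hy1 (sameCycle_swap_apply_mul hx2 hy2 hcyc)

end

theorem relabel {W : Type*} (h : IsEmbedding vert σ α g) (f : V → W)
    (hf : ∀ d e, α d ≠ d → α e ≠ e → f (vert d) = f (vert e) → vert d = vert e) :
    IsEmbedding (fun d => f (vert d)) σ α g where
  invol := h.invol
  dead := h.dead
  vert_apply d := by rw [h.vert_apply]
  cyclic d e hd he hde := h.cyclic d e hd he (hf d e hd he hde)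
  genus_le := h.genus_le

/-- Contraction of the fibres of a map on the vertices, if they are connected. -/
theorem contractFibers [Finite D] {W : Type*} (f : V → W) (h : IsEmbedding vert σ α g)
    (hconn : ∀ d e, α d ≠ d → α e ≠ e → f (vert d) = f (vert e) →
      Relation.EqvGen (fun x y => f x = f y ∧ ∃ a, α a ≠ a ∧ vert a = x ∧ vert (α a) = y)
        (vert d) (vert e)) :
    ∃ σ' α' : Equiv.Perm D, IsEmbedding (fun d => f (vert d)) σ' α' g ∧
      (∀ d, α' d = d ∨ α' d = α d) ∧
      ∀ d, f (vert d) ≠ f (vert (α d)) → α' d = α d := by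
  classical
  have := Fintype.ofFinite D
  -- Induction on the number of live darts. While an edge other than a loop lies inside a fibre, it
  -- is contracted; when none is left, connectedness of the fibres makes `f` injective on the
  -- vertices with live darts, and relabelling suffices.
  induction hn : (Finset.univ.filter fun d => α d ≠ d).card using Nat.strong_induction_on
    generalizing vert σ α with
  | _ n ih =>
  by_cases hex : ∃ d, α d ≠ d ∧ vert d ≠ vert (α d) ∧ f (vert d) = f (vert (α d))
  · obtain ⟨d, hd, hv, hfd⟩ := hex
    obtain ⟨σ₁, α₁, h₁, hd₁, hd₁', hα₁⟩ := h.contract hd hv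
    set W₁ : D → V := fun x => if vert x = vert d then vert (α d) else vert x with hW₁
    have hfW : ∀ x, f (W₁ x) = f (vert x) := by
      intro x
      simp only [hW₁]
      split_ifs with hx
      · rw [hx, hfd]
      · rfl
    have halive : ∀ x, α₁ x ≠ x → α x ≠ x ∧ x ≠ d ∧ x ≠ α d ∧ α₁ x = α x := by
      intro x hx
      have e1 : x ≠ d := by rintro rfl; exact hx hd₁
      have e2 : x ≠ α d := by rintro rfl; exact hx hd₁'
      have e3 := hα₁ x e1 e2
      exact ⟨by rwa [e3] at hx, e1, e2, e3⟩
    have hlt : (Finset.univ.filter fun d => α₁ d ≠ d).card < n := by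
      rw [← hn]
      refine Finset.card_lt_card (Finset.ssubset_iff_subset_ne.2 ⟨?_, fun e => ?_⟩)
      · intro x hx
        simp only [Finset.mem_filter, Finset.mem_univ, true_and] at hx ⊢
        exact (halive x hx).1
      · have : d ∈ Finset.univ.filter fun d => α₁ d ≠ d := by
          rw [e]; simpa using hd
        simp only [Finset.mem_filter, Finset.mem_univ, true_and] at this
        exact this hd₁
    obtain ⟨σ', α', h', hα', hα''⟩ := ih _ hlt h₁ (by
      intro x y hx hy hxy
      have hx' := (halive x hx).1
      have hy' := (halive y hy).1
      rw [hfW, hfW] at hxy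
      refine eqvGen_map (f := fun v => if v = vert d then vert (α d) else v) ?_
        (hconn x y hx' hy' hxy)
      rintro u v ⟨huv, a, ha, rfl, rfl⟩
      rcases eq_or_ne a d with rfl | had
      · have : (if vert a = vert a then vert (α a) else vert a) =
          (if vert (α a) = vert a then vert (α a) else vert (α a)) := by simp
        rw [this]
        exact .refl _
      rcases eq_or_ne a (α d) with rfl | had'
      · have : (if vert (α d) = vert d then vert (α d) else vert (α d)) =
          (if vert (α (α d)) = vert d then vert (α d) else vert (α (α d))) := by
          simp [h.invol]
        rw [this]
        exact .refl _
      · have e := hα₁ a had had'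
        refine .rel _ _ ⟨?_, a, by rwa [e], rfl, by rw [e]⟩
        have := hfW a
        have h2 := hfW (α a)
        simp only [hW₁] at this h2
        rw [this, h2, huv]) rfl
    refine ⟨σ', α', ?_, fun x => ?_, fun x hx => ?_⟩
    · simpa only [hfW] using h'
    · rcases hα' x with e | e
      · exact .inl e
      · rcases eq_or_ne (α₁ x) x with e' | e'
        · exact .inl (e.trans e')
        · exact .inr (e.trans (halive x e').2.2.2)
    · have e1 : x ≠ d := by rintro rfl; exact hx hfd
      have e2 : x ≠ α d := by rintro rfl; exact hx (by rw [h.invol, hfd])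
      have e3 := hα₁ x e1 e2
      have := hα'' x (by rwa [hfW, hfW, e3])
      rw [this, e3]
  · push Not at hex
    refine ⟨σ, α, h.relabel f fun d e hd he hde => ?_, fun d => .inr rfl, fun d _ => rfl⟩
    have := hconn d e hd he hde
    have := eqvGen_of_forall (s := (· = ·)) ?_ this
    · rwa [eq_equivalence.eqvGen_iff] at this
    rintro u v ⟨huv, a, ha, rfl, rfl⟩
    by_contra hne
    exact hex a ha (fun e => hne (.rel _ _ e)) huv

/-- Removal of all edges outside of a symmetric set of darts. -/
theorem restrict [Finite D] (h : IsEmbedding vert σ α g) (S : Set D)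
    (hS : ∀ d ∈ S, α d ≠ d ∧ α d ∈ S) :
    ∃ σ' α' : Equiv.Perm D, IsEmbedding vert σ' α' g ∧ (∀ d ∈ S, α' d = α d) ∧
      ∀ d ∉ S, α' d = d := by
  classical
  have := Fintype.ofFinite D
  induction hn : (Finset.univ.filter fun d => α d ≠ d).card using Nat.strong_induction_on
    generalizing σ α with
  | _ n ih =>
  by_cases hex : ∃ d, d ∉ S ∧ α d ≠ d
  · obtain ⟨d, hdS, hd⟩ := hex
    have hdS' : α d ∉ S := fun hmem => hdS (by have := (hS _ hmem).2; rwa [h.invol] at this)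
    obtain ⟨σ₁, α₁, h₁, hd₁, hd₁', hα₁⟩ := h.delete d
    have hlt : (Finset.univ.filter fun d => α₁ d ≠ d).card < n := by
      rw [← hn]
      refine Finset.card_lt_card (Finset.ssubset_iff_subset_ne.2 ⟨?_, fun e => ?_⟩)
      · intro x hx
        simp only [Finset.mem_filter, Finset.mem_univ, true_and] at hx ⊢
        have e1 : x ≠ d := by rintro rfl; exact hx hd₁
        have e2 : x ≠ α d := by rintro rfl; exact hx hd₁'
        rwa [hα₁ x e1 e2] at hx
      · have : d ∈ Finset.univ.filter fun d => α₁ d ≠ d := by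
          rw [e]; simpa using hd
        simp only [Finset.mem_filter, Finset.mem_univ, true_and] at this
        exact this hd₁
    have hS₁ : ∀ x ∈ S, α₁ x = α x := fun x hx =>
      hα₁ x (by rintro rfl; exact hdS hx) (by rintro rfl; exact hdS' hx)
    obtain ⟨σ', α', h', e1, e2⟩ := ih _ hlt h₁
      (fun x hx => by rw [hS₁ x hx]; exact hS x hx) rfl
    exact ⟨σ', α', h', fun x hx => (e1 x hx).trans (hS₁ x hx), e2⟩
  · push Not at hex
    exact ⟨σ, α, h, fun d _ => rfl, hex⟩

end IsEmbedding

end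

/-! ### From permutations to graphs: rotation systems, minors, leaves. -/

section

open Equiv Equiv.Perm

/-! ### Extension by fixed darts -/

section Extend

variable {A B : Type*} [Finite B] {ι : A → B}

theorem sameCycle_extend_iff (hι : Function.Injective ι) {σ : Equiv.Perm A} {σ' : Equiv.Perm B}
    (h : ∀ a, σ' (ι a) = ι (σ a)) (a b : A) : SameCycle σ' (ι a) (ι b) ↔ SameCycle σ a b := by
  have : Finite A := Finite.of_injective ι hι
  have hpow : ∀ (n : ℕ) (a : A), (σ' ^ n) (ι a) = ι ((σ ^ n) a) := by
    intro n
    induction n with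
    | zero => intro a; rfl
    | succ n ih => intro a; rw [pow_succ, pow_succ, Equiv.Perm.mul_apply, Equiv.Perm.mul_apply, h, ih]
  constructor
  · intro hs
    obtain ⟨n, hn⟩ := hs.exists_nat_pow_eq
    rw [hpow] at hn
    exact ⟨n, by rw [zpow_natCast]; exact hι hn⟩
  · intro hs
    obtain ⟨n, hn⟩ := hs.exists_nat_pow_eq
    exact ⟨n, by rw [zpow_natCast, hpow, hn]⟩

theorem exists_of_sameCycle_extend {σ : Equiv.Perm A} {σ' : Equiv.Perm B}
    (h : ∀ a, σ' (ι a) = ι (σ a)) (h' : ∀ b, b ∉ Set.range ι → σ' b = b) {x y : B}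
    (hxy : SameCycle σ' x y) : x = y ∨ ∃ a b, x = ι a ∧ y = ι b := by
  by_cases hx : x ∈ Set.range ι
  · right
    obtain ⟨a, rfl⟩ := hx
    obtain ⟨n, hn⟩ := hxy.exists_nat_pow_eq
    have : ∀ (n : ℕ), ∃ b, (σ' ^ n) (ι a) = ι b := by
      intro n
      induction n with
      | zero => exact ⟨a, rfl⟩
      | succ n ih =>
        obtain ⟨b, hb⟩ := ih
        exact ⟨σ b, by rw [pow_succ', Equiv.Perm.mul_apply, hb, h]⟩
    obtain ⟨b, hb⟩ := this n
    exact ⟨a, b, rfl, by rw [← hn, hb]⟩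
  · exact .inl (hxy.eq_of_left (h' x hx))

theorem numCycles_extend (hι : Function.Injective ι) {σ : Equiv.Perm A} {σ' : Equiv.Perm B}
    (h : ∀ a, σ' (ι a) = ι (σ a)) (h' : ∀ b, b ∉ Set.range ι → σ' b = b) :
    numCycles σ' = numCycles σ + Nat.card {y : B // y ∉ Set.range ι} := by
  refine numClasses_extend hι (fun x y hxy => (sameCycle_extend_iff hι h x y).2 hxy) ?_
  intro x y hxy
  rcases exists_of_sameCycle_extend h h' hxy with e | ⟨a, b, rfl, rfl⟩
  · exact .inl e
  · exact .inr ⟨a, b, rfl, rfl, (sameCycle_extend_iff hι h a b).1 hxy⟩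

/-- A dart fixed by both permutations is a component, a vertex, an edge and a face by itself, so
both sides of the inequality grow by 3. -/
theorem hypermapGenusLE_extend_iff (hι : Function.Injective ι) {σ α : Equiv.Perm A}
    {σ' α' : Equiv.Perm B} (hσ : ∀ a, σ' (ι a) = ι (σ a)) (hσ' : ∀ b, b ∉ Set.range ι → σ' b = b)
    (hα : ∀ a, α' (ι a) = ι (α a)) (hα' : ∀ b, b ∉ Set.range ι → α' b = b) (g : ℕ) :
    HypermapGenusLE σ' α' g ↔ HypermapGenusLE σ α g := by
  have : Finite A := Finite.of_injective ι hι
  have h1 := numCycles_extend hι hσ hσ'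
  have h2 := numCycles_extend hι hα hα'
  have h3 : numCycles (σ' * α') = numCycles (σ * α) + Nat.card {y : B // y ∉ Set.range ι} :=
    numCycles_extend hι (fun a => by simp [hα, hσ]) (fun b hb => by simp [hα' b hb, hσ' b hb])
  have h4 : numClasses (Linked σ' α') =
      numClasses (Linked σ α) + Nat.card {y : B // y ∉ Set.range ι} := by
    refine numClasses_extend hι ?_ ?_
    · rintro x y (h | h)
      · exact .inl ((sameCycle_extend_iff hι hσ x y).2 h)
      · exact .inr ((sameCycle_extend_iff hι hα x y).2 h)
    · rintro x y (h | h)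
      · rcases exists_of_sameCycle_extend hσ hσ' h with e | ⟨a, b, rfl, rfl⟩
        · exact .inl e
        · exact .inr ⟨a, b, rfl, rfl, .inl ((sameCycle_extend_iff hι hσ a b).1 h)⟩
      · rcases exists_of_sameCycle_extend hα hα' h with e | ⟨a, b, rfl, rfl⟩
        · exact .inl e
        · exact .inr ⟨a, b, rfl, rfl, .inr ((sameCycle_extend_iff hι hα a b).1 h)⟩
  have h5 : Nat.card B = Nat.card A + Nat.card {y : B // y ∉ Set.range ι} := by
    classical
    rw [Nat.card_congr (Equiv.ofInjective ι hι), ← Nat.card_sum]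
    exact Nat.card_congr (Equiv.sumCompl (· ∈ Set.range ι)).symm
  unfold HypermapGenusLE
  omega

end Extend

/-! ### Rotation systems as pairs of permutations -/

namespace SimpleGraph

variable {V W : Type*} {G : SimpleGraph V} {H : SimpleGraph W} {g : ℕ}

/-- The involution that reverses the darts. -/
def dartPerm (G : SimpleGraph V) : Equiv.Perm G.Dart :=
  (SimpleGraph.Dart.symm_involutive (G := G)).toPerm

@[simp] theorem dartPerm_apply (d : G.Dart) : G.dartPerm d = d.symm := rfl

instance [Finite V] : Finite G.Dart :=
  Finite.of_injective (fun d : G.Dart => d.toProd) fun _ _ h => SimpleGraph.Dart.ext _ _ h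

theorem sameCycle_dartPerm_iff [Finite V] {d e : G.Dart} :
    SameCycle G.dartPerm d e ↔ d.edge = e.edge := by
  rw [SimpleGraph.dart_edge_eq_iff]
  constructor
  · intro h
    obtain ⟨n, rfl⟩ := h.exists_nat_pow_eq
    induction n with
    | zero => exact .inl rfl
    | succ n ih =>
      rcases ih ⟨n, by simp⟩ with ih | ih
      · right; rw [pow_succ', Equiv.Perm.mul_apply, dartPerm_apply, SimpleGraph.Dart.symm_symm]
        exact ih
      · left; rw [pow_succ', Equiv.Perm.mul_apply, dartPerm_apply]; exact ih
  · rintro (rfl | h)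
    · exact SameCycle.refl _ _
    · refine ⟨1, ?_⟩
      rw [zpow_one, dartPerm_apply, h, SimpleGraph.Dart.symm_symm]

theorem numCycles_dartPerm [Finite V] (G : SimpleGraph V) :
    numCycles G.dartPerm = Nat.card G.edgeSet := by
  refine Nat.card_congr (Equiv.ofBijective
    (Quot.lift (fun d : G.Dart => (⟨d.edge, d.edge_mem⟩ : G.edgeSet)) ?_) ⟨?_, ?_⟩)
  · intro d e h
    exact Subtype.ext (sameCycle_dartPerm_iff.1 h)
  · rintro ⟨d⟩ ⟨e⟩ h
    exact Quot.sound (sameCycle_dartPerm_iff.2 (Subtype.ext_iff.1 h))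
  · rintro ⟨e, he⟩
    induction e with
    | _ u v => exact ⟨Quot.mk _ ⟨(u, v), he⟩, rfl⟩

theorem card_dart_eq [Finite V] (G : SimpleGraph V) :
    Nat.card G.Dart = 2 * Nat.card G.edgeSet := by
  classical
  have := Fintype.ofFinite V
  rw [Nat.card_eq_fintype_card, SimpleGraph.dart_card_eq_twice_card_edges, Nat.card_eq_fintype_card,
    SimpleGraph.edgeFinset_card]

theorem eqvGen_linked_of_reachable (R : RotationSystem G) {u v : V} (p : G.Walk u v) {d e : G.Dart}
    (hd : d.fst = u) (he : e.fst = v) :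
    Relation.EqvGen (Linked R.next G.dartPerm) d e := by
  induction p generalizing d with
  | nil => exact .rel _ _ (.inl (R.cyclic d e (hd.trans he.symm)))
  | @cons u v w hadj p ih =>
    let a : G.Dart := ⟨(u, v), hadj⟩
    refine .trans _ a _ (.rel _ _ (.inl (R.cyclic d a hd))) (.trans _ a.symm _ (.rel _ _ (.inr ?_)) ?_)
    · exact ⟨1, by simp⟩
    · exact ih rfl he

theorem RotationSystem.fst_eq_of_sameCycle [Finite V] (R : RotationSystem G) {d e : G.Dart}
    (h : SameCycle R.next d e) : d.fst = e.fst := by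
  obtain ⟨n, rfl⟩ := h.exists_nat_pow_eq
  clear h
  induction n with
  | zero => rfl
  | succ n ih => rw [pow_succ', Equiv.Perm.mul_apply, R.fst_next, ih]

theorem reachable_of_eqvGen_linked [Finite V] (R : RotationSystem G) {d e : G.Dart}
    (h : Relation.EqvGen (Linked R.next G.dartPerm) d e) : G.Reachable d.fst e.fst := by
  induction h with
  | rel d e h =>
    rcases h with h | h
    · rw [RotationSystem.fst_eq_of_sameCycle R h]
    · rcases (SimpleGraph.dart_edge_eq_iff d e).1 (sameCycle_dartPerm_iff.1 h) with rfl | rfl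
      · exact .refl _
      · exact e.adj.symm.reachable
  | refl => exact .refl _
  | symm _ _ _ ih => exact ih.symm
  | trans _ _ _ _ _ ih₁ ih₂ => exact ih₁.trans ih₂

/-- Isolated vertices carry no darts and are invisible to the permutations; here and in
`numCycles_next_add` they are restored. -/
theorem numClasses_linked_add [Finite V] (R : RotationSystem G) :
    numClasses (Linked R.next G.dartPerm) + Nat.card {v : V // ∀ w, ¬ G.Adj v w} =
      Nat.card G.ConnectedComponent := by
  have : Finite (Quot (Linked R.next G.dartPerm)) := Finite.of_surjective _ Quot.mk_surjective
  rw [numClasses, ← Nat.card_sum]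
  refine Nat.card_congr (Equiv.ofBijective (Sum.elim
    (Quot.lift (fun d => G.connectedComponentMk d.fst) ?_)
    fun v => G.connectedComponentMk v.1) ⟨?_, ?_⟩)
  · intro d e h
    exact SimpleGraph.ConnectedComponent.sound (reachable_of_eqvGen_linked R (.rel _ _ h))
  · have iso : ∀ (v : V) (_ : ∀ w, ¬ G.Adj v w) (u : V), G.Reachable v u → v = u := by
      rintro v hv u ⟨p⟩
      cases p with
      | nil => rfl
      | cons h _ => exact absurd h (hv _)
    rintro (q | ⟨v, hv⟩) (q' | ⟨w, hw⟩) h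
    · obtain ⟨d, rfl⟩ := Quot.exists_rep q
      obtain ⟨e, rfl⟩ := Quot.exists_rep q'
      obtain ⟨p⟩ := SimpleGraph.ConnectedComponent.exact h
      exact congrArg Sum.inl (Quot.eqvGen_sound (eqvGen_linked_of_reachable R p rfl rfl))
    · obtain ⟨d, rfl⟩ := Quot.exists_rep q
      have := iso w hw d.fst (SimpleGraph.ConnectedComponent.exact h).symm
      exact absurd d.adj (this ▸ hw _)
    · obtain ⟨e, rfl⟩ := Quot.exists_rep q'
      have := iso v hv e.fst (SimpleGraph.ConnectedComponent.exact h)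
      exact absurd e.adj (this ▸ hv _)
    · have := iso v hv _ (SimpleGraph.ConnectedComponent.exact h)
      subst this
      rfl
  · intro c
    induction c using SimpleGraph.ConnectedComponent.ind with
    | _ v =>
    by_cases hv : ∃ w, G.Adj v w
    · obtain ⟨w, hw⟩ := hv
      exact ⟨.inl (Quot.mk _ ⟨(v, w), hw⟩), rfl⟩
    · exact ⟨.inr ⟨v, fun w hw => hv ⟨w, hw⟩⟩, rfl⟩

theorem numCycles_next_add [Finite V] (R : RotationSystem G) :
    numCycles R.next + Nat.card {v : V // ∀ w, ¬ G.Adj v w} = Nat.card V := by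
  have : Finite (Quot (SameCycle R.next)) := Finite.of_surjective _ Quot.mk_surjective
  rw [numCycles, numClasses, ← Nat.card_sum]
  refine Nat.card_congr (Equiv.ofBijective (Sum.elim (Quot.lift (fun d => d.fst) ?_)
    fun v => v.1) ⟨?_, ?_⟩)
  · intro d e h
    exact RotationSystem.fst_eq_of_sameCycle R h
  · rintro (q | ⟨v, hv⟩) (q' | ⟨w, hw⟩) h
    · obtain ⟨d, rfl⟩ := Quot.exists_rep q
      obtain ⟨e, rfl⟩ := Quot.exists_rep q'
      exact congrArg Sum.inl (Quot.sound (R.cyclic d e h))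
    · obtain ⟨d, rfl⟩ := Quot.exists_rep q
      have : d.fst = w := h
      exact absurd d.adj (this ▸ hw _)
    · obtain ⟨e, rfl⟩ := Quot.exists_rep q'
      have : v = e.fst := h
      exact absurd e.adj (this ▸ hv _)
    · have : v = w := h
      subst this
      rfl
  · intro v
    by_cases hv : ∃ w, G.Adj v w
    · obtain ⟨w, hw⟩ := hv
      exact ⟨.inl (Quot.mk _ ⟨(v, w), hw⟩), rfl⟩
    · exact ⟨.inr ⟨v, fun w hw => hv ⟨w, hw⟩⟩, rfl⟩

/-- An isolated vertex contributes 2 through its component and 1 each through vertices and faces,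
which cancels. The darts number twice the edges, and one half cancels against the cycles of
`G.dartPerm`. -/
theorem hypermapGenusLE_iff [Finite V] (R : RotationSystem G) (g : ℕ) :
    HypermapGenusLE R.next G.dartPerm g ↔
      2 * Nat.card G.ConnectedComponent + Nat.card G.edgeSet ≤
        Nat.card V + R.numFaces + 2 * g := by
  have h1 := numClasses_linked_add R
  have h2 := numCycles_next_add R
  have h3 := numCycles_dartPerm G
  have h4 := card_dart_eq G
  have h5 : R.numFaces = numCycles (R.next * G.dartPerm) +
    Nat.card {v : V // ∀ w, ¬ G.Adj v w} := rfl
  unfold HypermapGenusLE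
  omega

theorem EmbedsInGenus.exists_isEmbedding [Finite V] (h : G.EmbedsInGenus g) :
    ∃ σ : Equiv.Perm G.Dart, IsEmbedding (fun d : G.Dart => d.fst) σ G.dartPerm g := by
  obtain ⟨R, hR⟩ := h
  exact ⟨R.next, fun d => d.symm_symm, fun d hd => absurd hd d.symm_ne, R.fst_next,
    fun d e _ _ => R.cyclic d e, (hypermapGenusLE_iff R g).2 hR⟩

/-- A graph whose darts are the darts of an embedded multigraph. -/
theorem embedsInGenus_of_isEmbedding [Finite W] {D : Type*} [Finite D] {vert : D → Option W}
    {σ α : Equiv.Perm D} (h : IsEmbedding vert σ α g) (ι : H.Dart → D)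
    (hι : Function.Injective ι) (hvert : ∀ e, vert (ι e) = some e.fst)
    (hα : ∀ e, α (ι e) = ι e.symm) (hdead : ∀ d, d ∉ Set.range ι → α d = d) :
    H.EmbedsInGenus g := by
  have hmem : ∀ d, d ∈ Set.range ι ↔ α d ≠ d := by
    intro d
    constructor
    · rintro ⟨e, rfl⟩
      rw [hα]
      exact fun he => e.symm_ne (hι he)
    · intro hd
      by_contra hr
      exact hd (hdead d hr)
  -- Darts outside of the range are fixed by `σ`, so `σ` restricts to the range and can be
  -- transported to the darts of `H`.
  have hσmem : ∀ d, d ∈ Set.range ι ↔ σ d ∈ Set.range ι := by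
    intro d
    rw [hmem, hmem]
    constructor
    · intro hd he
      have h1 := h.dead _ he
      have := σ.injective h1
      rw [this] at he
      exact hd he
    · intro hd he
      rw [h.dead d he] at hd
      exact hd he
  let ε := Equiv.ofInjective ι hι
  let ν : Equiv.Perm H.Dart := ε.symm.permCongr (σ.subtypePerm fun d => (hσmem d).symm)
  have hν : ∀ e, σ (ι e) = ι (ν e) := by
    intro e
    have : (ε (ν e) : D) = σ (ι e) := by
      simp only [ν, Equiv.permCongr_apply, Equiv.symm_symm, Equiv.apply_symm_apply]
      rfl
    exact this.symm
  let R : RotationSystem H :=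
    { next := ν
      fst_next := fun d => by
        have h1 := h.vert_apply (ι d)
        rw [hν, hvert, hvert] at h1
        exact Option.some_injective _ h1
      cyclic := fun d e hde => by
        rw [← sameCycle_extend_iff hι hν]
        refine h.cyclic _ _ ((hmem _).1 ⟨d, rfl⟩) ((hmem _).1 ⟨e, rfl⟩) ?_
        rw [hvert, hvert, hde] }
  refine ⟨R, (hypermapGenusLE_iff R g).1 ?_⟩
  exact (hypermapGenusLE_extend_iff hι hν (fun b hb => h.dead b (hdead b hb)) hα hdead g).1
    h.genus_le

/-- The genus does not increase when passing to a minor: `f` maps the vertices of the branch set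
of `w` to `some w`. -/
theorem EmbedsInGenus.minor [Finite V] [Finite W] [LinearOrder W] (f : V → Option W)
    (hconn : ∀ u v w, f u = some w → f v = some w →
      Relation.EqvGen (fun x y => G.Adj x y ∧ f x = some w ∧ f y = some w) u v)
    (hadj : ∀ a b, H.Adj a b → ∃ u v, f u = some a ∧ f v = some b ∧ G.Adj u v)
    (hG : G.EmbedsInGenus g) : H.EmbedsInGenus g := by
  classical
  obtain ⟨σ, hσ⟩ := hG.exists_isEmbedding
  -- Keep the darts with both ends in branch sets, contract the branch sets, and finally keep one
  -- edge for each edge of `H`.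
  obtain ⟨σ₁, α₁, h₁, hα₁, hα₁'⟩ := hσ.restrict {d | f d.fst ≠ none ∧ f d.snd ≠ none}
    fun d hd => ⟨d.symm_ne, hd.2, hd.1⟩
  have alive₁ : ∀ d : G.Dart, α₁ d ≠ d → f d.fst ≠ none ∧ f d.snd ≠ none := fun d hd => by
    by_contra hn
    exact hd (hα₁' d hn)
  obtain ⟨σ₂, α₂, h₂, hα₂, hα₂'⟩ := h₁.contractFibers f (by
    intro d e hd he hde
    obtain ⟨w, hw⟩ := Option.ne_none_iff_exists'.1 (alive₁ d hd).1
    refine eqvGen_of_forall ?_ (hconn d.fst e.fst w hw (hde ▸ hw))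
    rintro x y ⟨hxy, hx, hy⟩
    have ha := hα₁ ⟨(x, y), hxy⟩ ⟨by simp [hx], by simp [hy]⟩
    refine .rel _ _ ⟨hx.trans hy.symm, ⟨(x, y), hxy⟩, ?_, rfl, ?_⟩
    · rw [ha]; exact SimpleGraph.Dart.symm_ne _
    · rw [ha]; rfl)
  have hlift : ∀ e : H.Dart, ∃ d : G.Dart, f d.fst = some e.fst ∧ f d.snd = some e.snd := by
    intro e
    obtain ⟨u, v, hu, hv, huv⟩ := hadj _ _ e.adj
    exact ⟨⟨(u, v), huv⟩, hu, hv⟩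
  choose lift hl₁ hl₂ using hlift
  -- The order on `W` singles out one orientation of every edge of `H`. The other one is represented
  -- by the reversed dart, so that `ι` commutes with reversal.
  let ι : H.Dart → G.Dart := fun e => if e.fst < e.snd then lift e else (lift e.symm).symm
  have hι₁ : ∀ e, f (ι e).fst = some e.fst := by
    intro e
    simp only [ι]
    split_ifs
    · exact hl₁ e
    · exact hl₂ e.symm
  have hι₂ : ∀ e, f (ι e).snd = some e.snd := by
    intro e
    simp only [ι]
    split_ifs
    · exact hl₂ e
    · exact hl₁ e.symm
  have hιsymm : ∀ e, ι e.symm = (ι e).symm := by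
    intro e
    have hne : e.fst ≠ e.snd := e.adj.ne
    have e1 : e.symm.fst = e.snd := rfl
    have e2 : e.symm.snd = e.fst := rfl
    simp only [ι, e1, e2, SimpleGraph.Dart.symm_symm]
    rcases lt_or_gt_of_ne hne with h | h
    · rw [if_neg h.not_gt, if_pos h]
    · rw [if_pos h, if_neg h.not_gt, SimpleGraph.Dart.symm_symm]
  have hιinj : Function.Injective ι := by
    intro d e hde
    have h1 := hι₁ d
    have h2 := hι₂ d
    rw [hde, hι₁] at h1
    rw [hde, hι₂] at h2
    exact SimpleGraph.Dart.ext _ _ (Prod.ext (Option.some_injective _ h1.symm)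
      (Option.some_injective _ h2.symm))
  have hα₂ι : ∀ e, α₂ (ι e) = ι e.symm := by
    intro e
    have h1 : α₁ (ι e) = (ι e).symm := hα₁ (ι e) ⟨by simp [hι₁], by simp [hι₂]⟩
    rw [hα₂' (ι e) ?_, h1, hιsymm]
    rw [h1]
    change f (ι e).fst ≠ f (ι e).snd
    rw [hι₁, hι₂]
    exact fun h => e.adj.ne (Option.some_injective _ h)
  obtain ⟨σ₃, α₃, h₃, hα₃, hα₃'⟩ := h₂.restrict (Set.range ι) (by
    rintro _ ⟨e, rfl⟩
    rw [hα₂ι]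
    exact ⟨fun he => e.symm_ne (hιinj he), e.symm, rfl⟩)
  refine embedsInGenus_of_isEmbedding h₃ ι hιinj hι₁ (fun e => ?_) hα₃'
  rw [hα₃ _ ⟨e, rfl⟩, hα₂ι]

/-- Attaching a leaf does not increase the genus. -/
theorem EmbedsInGenus.addLeaf [Finite V] {G H : SimpleGraph V} {x y : V} (hxy : G.Adj x y)
    (hx : ∀ z, G.Adj x z → z = y) (hH : ∀ a b, H.Adj a b ↔ G.Adj a b ∧ a ≠ x ∧ b ≠ x)
    (h : H.EmbedsInGenus g) : G.EmbedsInGenus g := by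
  classical
  obtain ⟨σ, hσ⟩ := h.exists_isEmbedding
  let ι : H.Dart → G.Dart := fun e => ⟨e.toProd, ((hH _ _).1 e.adj).1⟩
  have hι : Function.Injective ι := fun d e hde =>
    SimpleGraph.Dart.ext _ _ (congrArg (fun a : G.Dart => a.toProd) hde)
  have hrange : ∀ d : G.Dart, d ∈ Set.range ι ↔ d.fst ≠ x ∧ d.snd ≠ x := by
    intro d
    constructor
    · rintro ⟨e, rfl⟩
      exact ((hH _ _).1 e.adj).2
    · intro hd
      exact ⟨⟨d.toProd, (hH _ _).2 ⟨d.adj, hd⟩⟩, rfl⟩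
  let ε := Equiv.ofInjective ι hι
  let σ₀ : Equiv.Perm G.Dart := σ.extendDomain ε
  let α₀ : Equiv.Perm G.Dart := H.dartPerm.extendDomain ε
  have hσ₀ : ∀ a, σ₀ (ι a) = ι (σ a) := fun a => σ.extendDomain_apply_image ε a
  have hα₀ : ∀ a, α₀ (ι a) = ι a.symm := fun a => H.dartPerm.extendDomain_apply_image ε a
  have hσ₀' : ∀ b, b ∉ Set.range ι → σ₀ b = b := fun b hb =>
    σ.extendDomain_apply_not_subtype ε hb
  have hα₀' : ∀ b, b ∉ Set.range ι → α₀ b = b := fun b hb =>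
    H.dartPerm.extendDomain_apply_not_subtype ε hb
  have hg₀ : HypermapGenusLE σ₀ α₀ g :=
    (hypermapGenusLE_extend_iff hι hσ₀ hσ₀' hα₀ hα₀' g).2 hσ.genus_le
  let d₀ : G.Dart := ⟨(x, y), hxy⟩
  have hd₀ : d₀ ∉ Set.range ι := fun h => ((hrange _).1 h).1 rfl
  have hd₁ : d₀.symm ∉ Set.range ι := fun h => ((hrange _).1 h).2 rfl
  have hnot : ∀ d : G.Dart, d ∉ Set.range ι → d = d₀ ∨ d = d₀.symm := by
    intro d hd
    rw [hrange] at hd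
    by_cases h1 : d.fst = x
    · left
      refine SimpleGraph.Dart.ext _ _ (Prod.ext h1 ?_)
      exact hx _ (h1 ▸ d.adj)
    · have h2 : d.snd = x := by by_contra h2; exact hd ⟨h1, h2⟩
      right
      refine SimpleGraph.Dart.ext _ _ (Prod.ext ?_ h2)
      exact hx _ (h2 ▸ d.adj.symm)
  have hfst₀ : ∀ d, (σ₀ d).fst = d.fst := by
    intro d
    by_cases hd : d ∈ Set.range ι
    · obtain ⟨e, rfl⟩ := hd
      rw [hσ₀]
      exact hσ.vert_apply e
    · rw [hσ₀' d hd]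
  have hcyc₀ : ∀ d e : G.Dart, d ∈ Set.range ι → e ∈ Set.range ι → d.fst = e.fst →
      SameCycle σ₀ d e := by
    rintro _ _ ⟨d, rfl⟩ ⟨e, rfl⟩ hde
    rw [sameCycle_extend_iff hι hσ₀]
    exact hσ.cyclic d e d.symm_ne e.symm_ne hde
  -- insertion of the dart at the old vertex
  obtain ⟨σ₁, hσ₁g, hσ₁d₀, hfst₁, hcyc₁⟩ : ∃ σ₁ : Equiv.Perm G.Dart, HypermapGenusLE σ₁ α₀ g ∧
      σ₁ d₀ = d₀ ∧ (∀ d, (σ₁ d).fst = d.fst) ∧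
      ∀ d e : G.Dart, d ≠ d₀ → e ≠ d₀ → d.fst = e.fst → SameCycle σ₁ d e := by
    by_cases hex : ∃ e ∈ Set.range ι, e.fst = y
    · obtain ⟨e, he, hey⟩ := hex
      -- `d₀.symm` is fixed by both permutations, hence a component by itself; inserting it next to
      -- `e` joins two components.
      have hne : ¬ Relation.EqvGen (Linked σ₀ α₀) d₀.symm e := by
        intro hl
        have : ∀ a b : G.Dart, Relation.EqvGen (Linked σ₀ α₀) a b →
            (a = d₀.symm ↔ b = d₀.symm) := by
          intro a b hab
          induction hab with
          | rel a b hab =>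
            have : ∀ π : Equiv.Perm G.Dart, π d₀.symm = d₀.symm → SameCycle π a b →
                (a = d₀.symm ↔ b = d₀.symm) := by
              intro π hπ hs
              constructor
              · rintro rfl; exact (hs.eq_of_left hπ).symm
              · rintro rfl; exact hs.eq_of_right hπ
            rcases hab with hab | hab
            · exact this _ (hσ₀' _ hd₁) hab
            · exact this _ (hα₀' _ hd₁) hab
          | refl => rfl
          | symm _ _ _ ih => exact ih.symm
          | trans _ _ _ _ _ ih₁ ih₂ => exact ih₁.trans ih₂
        have := (this _ _ hl).1 rfl
        exact hd₁ (this ▸ he)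
      refine ⟨Equiv.swap d₀.symm e * σ₀, hg₀.join hne, ?_, ?_, ?_⟩
      · rw [Equiv.Perm.mul_apply, hσ₀' _ hd₀]
        exact swap_apply_of_ne_of_ne d₀.symm_ne.symm (by rintro rfl; exact hd₀ he)
      · intro d
        rw [Equiv.Perm.mul_apply, swap_apply_def]
        split_ifs with h1 h2
        · rw [hey, ← hfst₀ d, h1]; rfl
        · rw [← hfst₀ d, h2, hey]; rfl
        · exact hfst₀ d
      · have hs : SameCycle (Equiv.swap d₀.symm e * σ₀) d₀.symm e :=
          sameCycle_swap_mul_of_not fun h => hne (.rel _ _ (.inl h))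
        intro a b ha hb hab
        by_cases har : a ∈ Set.range ι <;> by_cases hbr : b ∈ Set.range ι
        · exact sameCycle_swap_mul hs (hcyc₀ a b har hbr hab)
        · obtain rfl := (hnot b hbr).resolve_left hb
          exact (sameCycle_swap_mul hs (hcyc₀ a e har he (hab.trans hey.symm))).trans hs.symm
        · obtain rfl := (hnot a har).resolve_left ha
          exact hs.trans (sameCycle_swap_mul hs (hcyc₀ e b he hbr (hey.trans hab)))
        · obtain rfl := (hnot a har).resolve_left ha
          obtain rfl := (hnot b hbr).resolve_left hb
          exact SameCycle.refl _ _
    · refine ⟨σ₀, hg₀, hσ₀' _ hd₀, hfst₀, ?_⟩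
      intro a b ha hb hab
      by_cases har : a ∈ Set.range ι <;> by_cases hbr : b ∈ Set.range ι
      · exact hcyc₀ a b har hbr hab
      · obtain rfl := (hnot b hbr).resolve_left hb
        exact absurd ⟨a, har, hab⟩ hex
      · obtain rfl := (hnot a har).resolve_left ha
        exact absurd ⟨b, hbr, hab.symm⟩ hex
      · obtain rfl := (hnot a har).resolve_left ha
        obtain rfl := (hnot b hbr).resolve_left hb
        exact SameCycle.refl _ _
  -- `d₀` is still a component by itself, so making an edge out of the two darts is again a joining
  -- of components.
  have hne : ¬ Relation.EqvGen (Linked α₀ σ₁) d₀ d₀.symm := by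
    intro hl
    have : ∀ a b : G.Dart, Relation.EqvGen (Linked α₀ σ₁) a b → (a = d₀ ↔ b = d₀) := by
      intro a b hab
      induction hab with
      | rel a b hab =>
        have : ∀ π : Equiv.Perm G.Dart, π d₀ = d₀ → SameCycle π a b → (a = d₀ ↔ b = d₀) := by
          intro π hπ hs
          constructor
          · rintro rfl; exact (hs.eq_of_left hπ).symm
          · rintro rfl; exact hs.eq_of_right hπ
        rcases hab with hab | hab
        · exact this _ (hα₀' _ hd₀) hab
        · exact this _ hσ₁d₀ hab
      | refl => rfl
      | symm _ _ _ ih => exact ih.symm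
      | trans _ _ _ _ _ ih₁ ih₂ => exact ih₁.trans ih₂
    exact d₀.symm_ne ((this _ _ hl).1 rfl)
  have hg₂ := (hσ₁g.swap.join hne).swap
  have hα : Equiv.swap d₀ d₀.symm * α₀ = G.dartPerm := by
    ext1 d
    rw [Equiv.Perm.mul_apply, dartPerm_apply]
    by_cases hd : d ∈ Set.range ι
    · obtain ⟨e, rfl⟩ := hd
      rw [hα₀]
      rw [swap_apply_of_ne_of_ne]
      · rfl
      · intro h; exact hd₀ (h ▸ ⟨_, rfl⟩)
      · intro h; exact hd₁ (h ▸ ⟨_, rfl⟩)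
    · rw [hα₀' d hd]
      rcases hnot d hd with rfl | rfl
      · rw [swap_apply_left]
      · rw [swap_apply_right, SimpleGraph.Dart.symm_symm]
  rw [hα] at hg₂
  let R : RotationSystem G :=
    { next := σ₁
      fst_next := hfst₁
      cyclic := fun d e hde => by
        have hx₀ : ∀ d : G.Dart, d.fst = x → d = d₀ := fun d hd =>
          SimpleGraph.Dart.ext _ _ (Prod.ext hd (hx _ (hd ▸ d.adj)))
        by_cases hd : d = d₀
        · rw [hd, hx₀ e (by rw [← hde, hd])]
        · by_cases he : e = d₀
          · exact absurd (hx₀ d (by rw [hde, he])) hd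
          · exact hcyc₁ d e hd he hde }
  exact ⟨R, (hypermapGenusLE_iff R g).1 hg₂⟩

/-- Attaching leaves does not increase the genus. -/
theorem EmbedsInGenus.addLeaves [Finite V] {H G : SimpleGraph V} (A : Finset V)
    (hle : H ≤ G) (hA : ∀ a ∈ A, ∀ b, ¬ H.Adj a b)
    (hG : ∀ a b, G.Adj a b → H.Adj a b ∨ a ∈ A ∨ b ∈ A)
    (huniq : ∀ a ∈ A, ∀ b b', G.Adj a b → G.Adj a b' → b = b')
    (h : H.EmbedsInGenus g) : G.EmbedsInGenus g := by
  classical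
  induction A using Finset.induction_on generalizing G with
  | empty =>
    have : H = G := le_antisymm hle fun a b hab => by simpa using hG a b hab
    exact this ▸ h
  | insert x A hxA ih =>
    -- In `K` the vertex `x` is isolated rather than removed, so the vertex type does not change.
    let K : SimpleGraph V :=
      { Adj := fun a b => G.Adj a b ∧ a ≠ x ∧ b ≠ x
        symm := ⟨fun a b h => ⟨h.1.symm, h.2.2, h.2.1⟩⟩
        loopless := ⟨fun a h => h.1.ne rfl⟩ }
    have hK : K.EmbedsInGenus g := by
      refine ih (fun a b hab => ⟨hle hab, ?_, ?_⟩) (fun a ha => hA a (Finset.mem_insert_of_mem ha))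
        ?_ ?_
      · rintro rfl; exact hA a (Finset.mem_insert_self _ _) _ hab
      · rintro rfl; exact hA b (Finset.mem_insert_self _ _) _ hab.symm
      · rintro a b ⟨hab, hax, hbx⟩
        rcases hG a b hab with h | h | h
        · exact .inl h
        · exact .inr (.inl ((Finset.mem_insert.1 h).resolve_left hax))
        · exact .inr (.inr ((Finset.mem_insert.1 h).resolve_left hbx))
      · intro a ha b b' hb hb'
        exact huniq a (Finset.mem_insert_of_mem ha) b b' hb.1 hb'.1
    by_cases hx : ∃ y, G.Adj x y
    · obtain ⟨y, hxy⟩ := hx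
      exact EmbedsInGenus.addLeaf hxy
        (fun z hz => huniq x (Finset.mem_insert_self _ _) z y hz hxy) (fun a b => Iff.rfl) hK
    · have : K = G := by
        ext a b
        refine ⟨fun h => h.1, fun h => ⟨h, ?_, ?_⟩⟩
        · rintro rfl; exact hx ⟨_, h⟩
        · rintro rfl; exact hx ⟨_, h.symm⟩
      exact this ▸ hK

/-- Every finite graph has a rotation system. -/
theorem exists_rotationSystem [Finite V] (G : SimpleGraph V) : Nonempty (RotationSystem G) := by
  classical
  have := Fintype.ofFinite G.Dart
  have hf : ∀ v : V, ∃ f : Equiv.Perm G.Dart,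
      f.IsCycleOn ((Finset.univ.filter fun d : G.Dart => d.fst = v : Finset G.Dart) : Set G.Dart) :=
    fun v => by
      obtain ⟨f, hf, -⟩ := Finset.exists_cycleOn (Finset.univ.filter fun d : G.Dart => d.fst = v)
      exact ⟨f, hf⟩
  choose f hf using hf
  have hmem : ∀ d v, (f v d).fst = v ↔ d.fst = v := by
    intro d v
    have := (hf v).apply_mem_iff (x := d)
    simpa using this
  have hfst : ∀ d, (f d.fst d).fst = d.fst := fun d => (hmem d d.fst).2 rfl
  have hinj : Function.Injective fun d : G.Dart => f d.fst d := by
    intro d e hde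
    have h1 : d.fst = e.fst := by
      rw [← hfst d, ← hfst e]; exact congrArg (fun a : G.Dart => a.fst) hde
    simp only [h1] at hde
    exact (f e.fst).injective hde
  let ν : Equiv.Perm G.Dart := Equiv.ofBijective _ (Finite.injective_iff_bijective.1 hinj)
  refine ⟨⟨ν, hfst, fun d e hde => ?_⟩⟩
  obtain ⟨n, hn⟩ := ((hf d.fst).2 (x := d) (by simp) (y := e) (by simp [hde])).exists_nat_pow_eq
  have : ∀ n : ℕ, (ν ^ n) d = (f d.fst ^ n) d ∧ ((ν ^ n) d).fst = d.fst := by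
    intro n
    induction n with
    | zero => exact ⟨rfl, rfl⟩
    | succ n ih =>
      rw [pow_succ', pow_succ', Equiv.Perm.mul_apply, Equiv.Perm.mul_apply, ← ih.1]
      have : ν ((ν ^ n) d) = f d.fst ((ν ^ n) d) := by
        change f ((ν ^ n) d).fst ((ν ^ n) d) = _
        rw [ih.2]
      rw [this]
      exact ⟨rfl, (hmem _ _).2 ih.2⟩
  exact ⟨n, by rw [zpow_natCast, (this n).1, hn]⟩

theorem embedsInGenus_minGenus [Finite V] (G : SimpleGraph V) : G.EmbedsInGenus G.minGenus := by
  obtain ⟨R⟩ := exists_rotationSystem G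
  -- Nonemptiness ensures that the infimum is attained and is not the default value 0 of the empty
  -- set.
  have hne : {g : ℕ | G.EmbedsInGenus g}.Nonempty :=
    ⟨2 * Nat.card G.ConnectedComponent + Nat.card G.edgeSet, R, by omega⟩
  exact Nat.sInf_mem hne

theorem EmbedsInGenus.minGenus_le (h : G.EmbedsInGenus g) : G.minGenus ≤ g := Nat.sInf_le h

end SimpleGraph

end

/-! ### Euler's formula for bipartite graphs. -/

section

open Equiv Equiv.Perm

namespace SimpleGraph

variable {W : Type*} {H : SimpleGraph W} {g : ℕ}

/-- Euler's bound on the number of edges of a bipartite graph of bounded genus. -/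
theorem EmbedsInGenus.card_edgeSet_le_of_bipartite [Finite W] (h : H.EmbedsInGenus g) (B : Set W)
    (hB : ∀ a b, H.Adj a b → (a ∈ B ↔ b ∉ B))
    (hdeg : ∀ a ∈ B, ∀ b, H.Adj a b → ∃ b', b' ≠ b ∧ H.Adj a b') :
    Nat.card H.edgeSet ≤ 2 * Nat.card W + 4 * g := by
  classical
  obtain ⟨R, hR⟩ := h
  set φ : Equiv.Perm H.Dart := R.next * H.dartPerm with hφ
  have hφfst : ∀ d, (φ d).fst = d.snd := fun d => R.fst_next d.symm
  have hcol : ∀ d, ((φ d).fst ∈ B ↔ d.fst ∉ B) := fun d => by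
    rw [hφfst]
    have := hB _ _ d.adj
    tauto
  -- A face of length 2 would be an edge both of whose ends have degree 1, but one end lies in `B`
  -- and has a second neighbour.
  have h2 : ∀ d, φ (φ d) ≠ d := by
    intro d hd
    have he : φ d = d.symm := by
      refine SimpleGraph.Dart.ext _ _ (Prod.ext (hφfst d) ?_)
      have := hφfst (φ d)
      rw [hd] at this
      exact this.symm
    have h3 : R.next d.symm = d.symm := he
    have h4 : R.next d = d := by
      have : R.next (φ d).symm = d := hd
      rwa [he, SimpleGraph.Dart.symm_symm] at this
    have key : ∀ e : H.Dart, e.fst ∈ B → R.next e = e → False := by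
      intro e heB hfix
      obtain ⟨b', hb', hadj⟩ := hdeg _ heB _ e.adj
      have := (R.cyclic e ⟨(e.fst, b'), hadj⟩ rfl).eq_of_left hfix
      apply hb'
      rw [this]
    by_cases hdB : d.fst ∈ B
    · exact key d hdB h4
    · refine key d.symm ?_ h3
      have := hB _ _ d.adj
      change d.snd ∈ B
      tauto
  -- Faces of odd length are excluded by the bipartition.
  have h1 : ∀ d, φ d ≠ d := fun d hd => by
    have := hcol d; rw [hd] at this; tauto
  have h3 : ∀ d, φ (φ (φ d)) ≠ d := fun d hd => by
    have a1 := hcol d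
    have a2 := hcol (φ d)
    have a3 := hcol (φ (φ d))
    rw [hd] at a3; tauto
  have hdistinct : ∀ (d : H.Dart) (i j : Fin 4), i < j → (φ ^ (i : ℕ)) d ≠ (φ ^ (j : ℕ)) d := by
    intro d i j hij
    obtain ⟨m, hm⟩ : ∃ m : ℕ, (j : ℕ) = i + m := ⟨j - i, by omega⟩
    have hm' : m = 1 ∨ m = 2 ∨ m = 3 := by omega
    rw [hm, add_comm, pow_add, Equiv.Perm.mul_apply]
    intro he
    rcases hm' with rfl | rfl | rfl
    · exact h1 _ he.symm
    · exact h2 _ he.symm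
    · exact h3 _ he.symm
  have hfin : Finite (Quot (SameCycle φ)) := Finite.of_surjective _ Quot.mk_surjective
  -- Every face has at least four darts, so there are at most half as many traced faces as edges.
  have hcount : numCycles φ * 4 ≤ Nat.card H.Dart := by
    have : Function.Injective fun p : Quot (SameCycle φ) × Fin 4 =>
        (φ ^ (p.2 : ℕ)) (Quot.out p.1) := by
      rintro ⟨q, i⟩ ⟨q', j⟩ he
      simp only at he
      have hq : q = q' := by
        rw [← Quot.out_eq q, ← Quot.out_eq q']
        apply Quot.sound
        rw [← sameCycle_pow_left (n := i), he, sameCycle_pow_left]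
      subst hq
      rcases lt_trichotomy i j with hij | hij | hij
      · exact absurd he (hdistinct _ i j hij)
      · rw [hij]
      · exact absurd he.symm (hdistinct _ j i hij)
    have := Nat.card_le_card_of_injective _ this
    rwa [Nat.card_prod, Nat.card_fin] at this
  have h4 := card_dart_eq H
  have h5 : R.numFaces = numCycles φ + Nat.card {v : W // ∀ w, ¬ H.Adj v w} := rfl
  have h6 := numClasses_linked_add R
  omega

end SimpleGraph

end

section

/-! ### Polynomial-time functions in the machine model -/

open Polynomial

theorem Polynomial.eval_nat_mono (P : ℕ[X]) : Monotone fun n : ℕ => P.eval n := by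
  intro m n h
  induction P using Polynomial.induction_on' with
  | add p q hp hq => simpa using add_le_add hp hq
  | monomial k a =>
    simp only [eval_monomial]
    gcongr

theorem Data.size_pos (x : Data) : 1 ≤ x.size := by
  cases x <;> simp [Data.size]

theorem Data.head_size_le (x : Data) : x.head.size ≤ x.size := by
  cases x
  · exact le_rfl
  · simp only [Data.head, Data.size]; omega

theorem Data.tail_size_le (x : Data) : x.tail.size ≤ x.size := by
  cases x
  · exact le_rfl
  · simp only [Data.tail, Data.size]; omega

/-- Time bounds the size of the output, so a time bound for one program also bounds the input of the
next. -/
theorem Prog.Runs.size_le {p : Prog} {x y : Data} {T : ℕ} (h : p.Runs x y T) : y.size ≤ T := by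
  induction h with
  | skip x => exact le_rfl
  | nil x => exact x.size_pos
  | head x => exact x.head_size_le
  | tail x => exact x.tail_size_le
  | pair _ _ ih₁ ih₂ =>
    rename_i x _ _ _ _ _ _
    have := x.size_pos
    simp only [Data.size]; omega
  | seq _ _ _ ih => omega
  | ite_true _ _ _ ih => omega
  | ite_false _ _ _ ih => omega
  | loop_done _ _ => omega
  | loop_step _ _ _ _ _ ih => omega

/-- Types with an encoding by trees. -/
class Enc (α : Type) where
  toData : α → Data

/-- The encoding of an element. -/
abbrev enc {α : Type} [Enc α] (a : α) : Data := Enc.toData a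

instance : Enc Unit := ⟨fun _ => .nil⟩
instance : Enc ℕ := ⟨Data.ofNat⟩
instance : Enc Bool := ⟨Data.ofBool⟩
instance {α β : Type} [Enc α] [Enc β] : Enc (α × β) := ⟨fun p => .cons (enc p.1) (enc p.2)⟩
instance {α : Type} [Enc α] : Enc (List α) := ⟨fun l => Data.ofList (l.map enc)⟩

/-- The size of the encoding. -/
def sz {α : Type} [Enc α] (a : α) : ℕ := (enc a).size

section

variable {α β γ δ : Type} [Enc α] [Enc β] [Enc γ] [Enc δ]

theorem sz_pos (a : α) : 1 ≤ sz a := Data.size_pos _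

theorem sz_prod (a : α) (b : β) : sz (a, b) = sz a + sz b + 1 := rfl

theorem sz_nil : sz ([] : List α) = 1 := rfl

theorem sz_cons (a : α) (l : List α) : sz (a :: l) = sz a + sz l + 1 := rfl

theorem sz_nat (n : ℕ) : sz n = 2 * n + 1 := by
  induction n with
  | zero => rfl
  | succ n ih =>
    have : sz (n + 1) = 1 + sz n + 1 := rfl
    omega

theorem sz_append (l l' : List α) : sz (l ++ l') + 1 = sz l + sz l' := by
  induction l with
  | nil => simp [sz_nil]; omega
  | cons a l ih => rw [List.cons_append, sz_cons, sz_cons]; omega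

theorem sz_reverse (l : List α) : sz l.reverse = sz l := by
  induction l with
  | nil => rfl
  | cons a l ih =>
    have := sz_append l.reverse [a]
    rw [List.reverse_cons, sz_cons]
    rw [sz_cons, sz_nil] at this
    omega

theorem length_lt_sz (l : List α) : l.length < sz l := by
  induction l with
  | nil => simp [sz_nil]
  | cons a l ih => rw [sz_cons, List.length_cons]; omega

theorem sz_le_of_forall {l : List α} {B : ℕ} (h : ∀ a ∈ l, sz a ≤ B) :
    sz l ≤ l.length * (B + 1) + 1 := by
  induction l with
  | nil => simp [sz_nil]
  | cons a l ih =>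
    have h1 := ih fun a ha => h a (List.mem_cons_of_mem _ ha)
    have h2 := h a List.mem_cons_self
    rw [sz_cons, List.length_cons, add_mul]
    omega

theorem sz_le_of_mem {l : List α} {a : α} (h : a ∈ l) : sz a ≤ sz l := by
  induction l with
  | nil => simp at h
  | cons b l ih =>
    rw [sz_cons]
    rcases List.mem_cons.1 h with rfl | h
    · omega
    · have := ih h; omega

theorem sz_le_of_sublist {l l' : List α} (h : l.Sublist l') : sz l ≤ sz l' := by
  induction h with
  | slnil => exact le_rfl
  | cons a _ ih => rw [sz_cons]; omega
  | cons_cons a _ ih => rw [sz_cons, sz_cons]; omega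

/-- Computable in polynomial time. -/
def PolyTime (f : α → β) : Prop :=
  ∃ (p : Prog) (P : ℕ[X]), ∀ x, ∃ T, p.Runs (enc x) (enc (f x)) T ∧ T ≤ P.eval (sz x)

/-- Polynomially bounded. -/
def PolyBound (u : α → ℕ) : Prop := ∃ P : ℕ[X], ∀ x, u x ≤ P.eval (sz x)

theorem PolyBound.const (c : ℕ) : PolyBound fun _ : α => c := ⟨C c, fun x => by simp⟩

theorem PolyBound.add {u v : α → ℕ} (hu : PolyBound u) (hv : PolyBound v) :
    PolyBound fun x => u x + v x := by
  obtain ⟨P, hP⟩ := hu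
  obtain ⟨Q, hQ⟩ := hv
  exact ⟨P + Q, fun x => by simpa using add_le_add (hP x) (hQ x)⟩

theorem PolyBound.mul {u v : α → ℕ} (hu : PolyBound u) (hv : PolyBound v) :
    PolyBound fun x => u x * v x := by
  obtain ⟨P, hP⟩ := hu
  obtain ⟨Q, hQ⟩ := hv
  exact ⟨P * Q, fun x => by simpa using Nat.mul_le_mul (hP x) (hQ x)⟩

theorem PolyBound.eval {u : α → ℕ} (hu : PolyBound u) (Q : ℕ[X]) :
    PolyBound fun x => Q.eval (u x) := by
  obtain ⟨P, hP⟩ := hu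
  exact ⟨Q.comp P, fun x => by rw [eval_comp]; exact Q.eval_nat_mono (hP x)⟩

theorem PolyTime.bound {f : α → β} (hf : PolyTime f) : PolyBound fun x => sz (f x) := by
  obtain ⟨p, P, h⟩ := hf
  refine ⟨P, fun x => ?_⟩
  obtain ⟨T, hT, hle⟩ := h x
  exact hT.size_le.trans hle

theorem PolyTime.id : PolyTime fun x : α => x :=
  ⟨.skip, X, fun x => ⟨_, .skip _, by simp [sz]⟩⟩

/-- For changes of type that leave the tree as it is, such as pairs read as nonempty lists or lists
of units read as numerals. -/
theorem PolyTime.of_enc_eq {f : α → β} (h : ∀ x, enc (f x) = enc x) : PolyTime f :=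
  ⟨.skip, X, fun x => ⟨_, by rw [h]; exact .skip _, by simp [sz]⟩⟩

theorem PolyTime.comp {f : β → γ} {g : α → β} (hf : PolyTime f) (hg : PolyTime g) :
    PolyTime fun x => f (g x) := by
  obtain ⟨p, P, hp⟩ := hf
  obtain ⟨q, Q, hq⟩ := hg
  refine ⟨.seq q p, X + Q + P.comp Q, fun x => ?_⟩
  obtain ⟨T, hT, hTle⟩ := hq x
  obtain ⟨S, hS, hSle⟩ := hp (g x)
  refine ⟨_, .seq hT hS, ?_⟩
  have h1 : S ≤ P.eval (Q.eval (sz x)) := hSle.trans (P.eval_nat_mono (hT.size_le.trans hTle))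
  simp only [eval_add, eval_X, eval_comp]
  change sz x + T + S ≤ _
  omega

theorem PolyTime.pair {f : α → β} {g : α → γ} (hf : PolyTime f) (hg : PolyTime g) :
    PolyTime fun x => (f x, g x) := by
  obtain ⟨p, P, hp⟩ := hf
  obtain ⟨q, Q, hq⟩ := hg
  refine ⟨.pair p q, X + P + Q, fun x => ?_⟩
  obtain ⟨T, hT, hTle⟩ := hp x
  obtain ⟨S, hS, hSle⟩ := hq x
  refine ⟨_, .pair hT hS, ?_⟩
  simp only [eval_add, eval_X]
  change sz x + T + S ≤ _
  omega

theorem PolyTime.fst : PolyTime fun x : α × β => x.1 :=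
  ⟨.head, X, fun x => ⟨_, .head _, by simp [sz]⟩⟩

theorem PolyTime.snd : PolyTime fun x : α × β => x.2 :=
  ⟨.tail, X, fun x => ⟨_, .tail _, by simp [sz]⟩⟩

theorem exists_const_prog (d : Data) : ∃ (p : Prog) (P : ℕ[X]), ∀ x : Data, ∃ T,
    p.Runs x d T ∧ T ≤ P.eval x.size := by
  induction d with
  | nil => exact ⟨.nil, X, fun x => ⟨_, .nil _, by simp⟩⟩
  | cons a b iha ihb =>
    obtain ⟨p, P, hp⟩ := iha
    obtain ⟨q, Q, hq⟩ := ihb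
    refine ⟨.pair p q, X + P + Q, fun x => ?_⟩
    obtain ⟨T, hT, hTle⟩ := hp x
    obtain ⟨S, hS, hSle⟩ := hq x
    refine ⟨_, .pair hT hS, ?_⟩
    simp only [eval_add, eval_X]
    omega

theorem PolyTime.const (b : β) : PolyTime fun _ : α => b := by
  obtain ⟨p, P, h⟩ := exists_const_prog (enc b)
  exact ⟨p, P, fun x => h (enc x)⟩

theorem PolyTime.ite {c : α → Bool} {f g : α → β} (hc : PolyTime c) (hf : PolyTime f)
    (hg : PolyTime g) : PolyTime fun x => if c x = true then f x else g x := by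
  obtain ⟨r, R, hr⟩ := hc
  obtain ⟨p, P, hp⟩ := hf
  obtain ⟨q, Q, hq⟩ := hg
  refine ⟨.ite r p q, X + R + P + Q, fun x => ?_⟩
  obtain ⟨U, hU, hUle⟩ := hr x
  obtain ⟨T, hT, hTle⟩ := hp x
  obtain ⟨S, hS, hSle⟩ := hq x
  simp only [eval_add, eval_X]
  cases hcx : c x with
  | true =>
    rw [hcx] at hU
    refine ⟨_, .ite_true hU hT, ?_⟩
    change sz x + U + T ≤ _
    omega
  | false =>
    rw [hcx] at hU
    refine ⟨_, .ite_false hU hS, ?_⟩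
    change sz x + U + S ≤ _
    omega

theorem PolyTime.of_eq {f g : α → β} (hf : PolyTime f) (h : ∀ x, f x = g x) : PolyTime g := by
  rwa [← funext h]

theorem PolyTime.not {c : α → Bool} (hc : PolyTime c) : PolyTime fun x => !c x :=
  (PolyTime.ite hc (PolyTime.const false) (PolyTime.const true)).of_eq fun x => by
    cases c x <;> rfl

theorem PolyTime.and {c d : α → Bool} (hc : PolyTime c) (hd : PolyTime d) :
    PolyTime fun x => c x && d x :=
  (PolyTime.ite hc hd (PolyTime.const false)).of_eq fun x => by
    cases c x <;> rfl

theorem PolyTime.or {c d : α → Bool} (hc : PolyTime c) (hd : PolyTime d) :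
    PolyTime fun x => c x || d x :=
  (PolyTime.ite hc (PolyTime.const true) hd).of_eq fun x => by
    cases c x <;> rfl

/-- Iteration of a polynomial-time function a constant number of times. -/
theorem PolyTime.iterate {f : α → γ → γ} {s : α → γ} (hf : PolyTime fun p : α × γ => f p.1 p.2)
    (hs : PolyTime s) (n : ℕ) : PolyTime fun x => (f x)^[n] (s x) := by
  induction n with
  | zero => exact hs
  | succ n ih =>
    refine (hf.comp (PolyTime.id.pair ih)).of_eq fun x => ?_
    rw [Function.iterate_succ_apply']

theorem PolyTime.cons {f : α → β} {g : α → List β} (hf : PolyTime f) (hg : PolyTime g) :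
    PolyTime fun x => f x :: g x :=
  (PolyTime.of_enc_eq (f := fun p : β × List β => p.1 :: p.2) fun _ => rfl).comp (hf.pair hg)

theorem PolyTime.tail {f : α → List β} (hf : PolyTime f) : PolyTime fun x => (f x).tail := by
  have : PolyTime fun l : List β => l.tail :=
    ⟨.tail, X, fun l => ⟨_, by
      have : enc l.tail = (enc l).tail := by cases l <;> rfl
      rw [this]; exact .tail _, by simp [sz]⟩⟩
  exact this.comp hf

theorem PolyTime.succ {f : α → ℕ} (hf : PolyTime f) : PolyTime fun x => f x + 1 :=
  (PolyTime.of_enc_eq (f := fun p : Unit × ℕ => p.2 + 1) fun _ => rfl).comp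
    ((PolyTime.const ()).pair hf)

theorem PolyTime.isEmpty {f : α → List β} (hf : PolyTime f) :
    PolyTime fun x => (f x).isEmpty := by
  have : PolyTime fun l : List β => l.isEmpty := by
    obtain ⟨p, P, hp⟩ := PolyTime.const (α := List β) false
    obtain ⟨q, Q, hq⟩ := PolyTime.const (α := List β) true
    refine ⟨.ite .skip p q, X + X + P + Q, fun l => ?_⟩
    obtain ⟨T, hT, hTle⟩ := hp l
    obtain ⟨S, hS, hSle⟩ := hq l
    simp only [eval_add, eval_X]
    cases l with
    | nil =>
      refine ⟨_, .ite_false (.skip _) hS, ?_⟩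
      change sz ([] : List β) + sz ([] : List β) + S ≤ _
      omega
    | cons a l =>
      refine ⟨_, .ite_true (.skip _) hT, ?_⟩
      change sz (a :: l) + sz (a :: l) + T ≤ _
      omega
  exact this.comp hf

theorem PolyTime.headD {f : α → List β} {g : α → β} (hf : PolyTime f) (hg : PolyTime g) :
    PolyTime fun x => (f x).headD (g x) := by
  have : PolyTime fun p : List β × β => p.1.headD p.2 := by
    refine ⟨.ite .head (.seq .head .head) .tail, X + X + (X + X + X) + X, fun p => ?_⟩
    obtain ⟨l, b⟩ := p
    simp only [eval_add, eval_X]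
    have h1 : sz (l, b) = (enc (l, b)).size := rfl
    cases l with
    | nil =>
      refine ⟨_, .ite_false (.head _) (.tail _), ?_⟩
      omega
    | cons a l =>
      refine ⟨_, .ite_true (.head _) (.seq (.head _) (.head _)), ?_⟩
      have := Data.head_size_le (enc (a :: l, b))
      omega
  exact this.comp (hf.pair hg)

/-- The program that folds a list; it runs in polynomial time as long as the accumulator stays
small. -/
theorem exists_foldl_prog {step : γ → α → γ} (hs : PolyTime fun p : γ × α => step p.1 p.2) :
    ∃ (p : Prog) (Q : ℕ[X]), ∀ (l : List α) (s : γ) (S : ℕ),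
      (∀ l₁ l₂, l = l₁ ++ l₂ → sz (l₁.foldl step s) ≤ S) →
      ∃ T, p.Runs (enc (l, s)) (enc (l.foldl step s)) T ∧ T ≤ Q.eval (sz l + S) := by
  obtain ⟨p, P, hp⟩ := hs
  let body : Prog := .pair (.seq .head .tail) (.seq (.pair .tail (.seq .head .head)) p)
  -- A bound for one round: besides `p`, at most 14 constructs are run, each on a tree of size at
  -- most `K + 1`.
  let q : ℕ[X] := 14 * (X + 1) + P.comp (X + 1)
  have hloop : ∀ (l : List α) (s : γ) (S K : ℕ),
      (∀ l₁ l₂, l = l₁ ++ l₂ → sz (l₁.foldl step s) ≤ S) → sz l + S ≤ K →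
      ∃ T, (Prog.loop .head body).Runs (enc (l, s)) (enc (([] : List α), l.foldl step s)) T ∧
        T ≤ sz l * q.eval K := by
    intro l
    induction l with
    | nil =>
      intro s S K hS hK
      refine ⟨_, .loop_done (.head _), ?_⟩
      have h1 : sz s ≤ S := hS [] [] rfl
      have h2 : (enc (([] : List α), s)).size = 1 + sz s + 1 := rfl
      rw [sz_nil] at hK ⊢
      simp only [q, eval_add, eval_mul, eval_comp, eval_X, eval_one, eval_ofNat]
      omega
    | cons a l ih =>
      intro s S K hS hK
      rw [sz_cons] at hK
      have h1 : sz s ≤ S := hS [] (a :: l) rfl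
      obtain ⟨Tp, hTp, hTple⟩ := hp (s, a)
      obtain ⟨T, hT, hTle⟩ := ih (step s a) S K
        (fun l₁ l₂ h => hS (a :: l₁) l₂ (by rw [h]; rfl)) (by omega)
      refine ⟨_, .loop_step (.head _) (.pair (.seq (.head _) (.tail _))
        (.seq (.pair (.tail _) (.seq (.head _) (.head _))) hTp)) hT, ?_⟩
      have e1 : (enc (a :: l, s)).size = sz a + sz l + 1 + sz s + 1 := rfl
      have e2 : (enc (a :: l, s)).head.size = sz a + sz l + 1 := rfl
      have e3 : (Data.cons (enc (a :: l, s)).tail (enc (a :: l, s)).head.head).size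
        = sz s + sz a + 1 := rfl
      have e4 : Tp ≤ P.eval (K + 1) := by
        refine hTple.trans (P.eval_nat_mono ?_)
        rw [sz_prod]
        omega
      have e5 : (sz a + sz l + 1) * q.eval K ≥ sz l * q.eval K + q.eval K := by
        have : (sz l + 1) * q.eval K ≤ (sz a + sz l + 1) * q.eval K :=
          Nat.mul_le_mul_right _ (by omega)
        rwa [add_mul, one_mul] at this
      have e6 : q.eval K = 14 * (K + 1) + P.eval (K + 1) := by
        simp only [q, eval_add, eval_mul, eval_comp, eval_X, eval_one, eval_ofNat]
      rw [sz_cons]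
      have e7 := sz_pos a
      omega
  refine ⟨.seq (.loop .head body) .tail, X + 1 + X * q + X + 2, fun l s S hS => ?_⟩
  obtain ⟨T, hT, hTle⟩ := hloop l s S _ hS le_rfl
  refine ⟨_, .seq hT (.tail _), ?_⟩
  have h1 : sz s ≤ S := hS [] l rfl
  have h2 : sz (l.foldl step s) ≤ S := hS l [] (by simp)
  have e1 : (enc (l, s)).size = sz l + sz s + 1 := rfl
  have e2 : (enc (([] : List α), l.foldl step s)).size = 1 + sz (l.foldl step s) + 1 := rfl
  have e3 : sz l * q.eval (sz l + S) ≤ (sz l + S) * q.eval (sz l + S) :=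
    Nat.mul_le_mul_right _ (by omega)
  simp only [eval_add, eval_mul, eval_X, eval_one, eval_ofNat]
  omega

/-- The step may depend on the input `x`, so `x` travels with the accumulator. A bound on all
intermediate accumulators is required because iterating a polynomial-time step can produce
exponential growth. -/
theorem PolyTime.foldl {l : δ → List α} {s : δ → β} {step : δ → β → α → β} (hl : PolyTime l)
    (hs : PolyTime s) (hstep : PolyTime fun p : (β × δ) × α => step p.1.2 p.1.1 p.2)
    {u : δ → ℕ} (hu : PolyBound u)
    (hb : ∀ x l₁ l₂, l x = l₁ ++ l₂ → sz (l₁.foldl (step x) (s x)) ≤ u x) :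
    PolyTime fun x => (l x).foldl (step x) (s x) := by
  obtain ⟨p, Q, hp⟩ := exists_foldl_prog (γ := β × δ) (α := α)
    (step := fun c a => (step c.2 c.1 a, c.2))
    (hstep.pair (PolyTime.snd.comp PolyTime.fst))
  obtain ⟨q, P, hq⟩ := hl.pair (hs.pair (PolyTime.id (α := δ)))
  obtain ⟨U, hU⟩ := hu
  have key : ∀ (x : δ) (l : List α) (b : β),
      l.foldl (fun c a => (step c.2 c.1 a, c.2)) (b, x) = (l.foldl (step x) b, x) := by
    intro x l
    induction l with
    | nil => intro b; rfl
    | cons a l ih => intro b; exact ih _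
  refine ⟨.seq q (.seq p .head), X + P + (P + Q.comp (P + (U + X + 1)) + (U + X + 1)), fun x => ?_⟩
  obtain ⟨T, hT, hTle⟩ := hq x
  obtain ⟨S, hS, hSle⟩ := hp (l x) (s x, x) (U.eval (sz x) + sz x + 1) (by
    intro l₁ l₂ h
    rw [key, sz_prod]
    have := (hb x l₁ l₂ h).trans (hU x)
    omega)
  rw [key] at hS
  refine ⟨_, .seq hT (.seq hS (.head _)), ?_⟩
  have h1 : (enc (l x, s x, x)).size ≤ P.eval (sz x) := hT.size_le.trans hTle
  have h2 : sz (l x) ≤ P.eval (sz x) := le_trans (by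
    have : (enc (l x, s x, x)).size = sz (l x) + sz (s x, x) + 1 := rfl
    omega) h1
  have h3 : S ≤ Q.eval (P.eval (sz x) + (U.eval (sz x) + sz x + 1)) :=
    hSle.trans (Q.eval_nat_mono (by omega))
  have h4 : (enc ((l x).foldl (step x) (s x), x)).size ≤ U.eval (sz x) + sz x + 1 := by
    have := (hb x (l x) [] (by simp)).trans (hU x)
    have e : (enc ((l x).foldl (step x) (s x), x)).size =
      sz ((l x).foldl (step x) (s x)) + sz x + 1 := rfl
    omega
  have h5 : (enc x).size = sz x := rfl
  simp only [eval_add, eval_X, eval_comp, eval_one]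
  omega

theorem PolyTime.reverse {l : δ → List α} (hl : PolyTime l) : PolyTime fun x => (l x).reverse := by
  refine (PolyTime.foldl (step := fun _ b a => a :: b) hl (PolyTime.const [])
    (PolyTime.snd.cons (PolyTime.fst.comp PolyTime.fst)) (hl.bound.add (PolyBound.const 0))
    ?_).of_eq fun x => by simp
  intro x l₁ l₂ h
  have : l₁.foldl (fun b a => a :: b) [] = l₁.reverse := by simp
  rw [this, sz_reverse]
  have := sz_append l₁ l₂
  have h2 := sz_pos l₂
  rw [h]
  omega

theorem PolyTime.map {l : δ → List α} {f : δ → α → β} (hl : PolyTime l)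
    (hf : PolyTime fun p : δ × α => f p.1 p.2) : PolyTime fun x => (l x).map (f x) := by
  have key : ∀ (x : δ) (l : List α) (b : List β),
      l.foldl (fun b a => f x a :: b) b = (l.map (f x)).reverse ++ b := by
    intro x l
    induction l with
    | nil => intro b; rfl
    | cons a l ih => intro b; simp [ih]
  obtain ⟨P, hP⟩ := hf.bound
  have : PolyTime fun x => (l x).foldl (fun b a => f x a :: b) [] := by
    refine PolyTime.foldl (step := fun x b a => f x a :: b)
      (u := fun x => sz (l x) * (P.eval (sz x + sz (l x) + 1) + 1) + 1) hl (PolyTime.const [])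
      ?_ ?_ ?_
    · refine PolyTime.cons ?_ (PolyTime.fst.comp PolyTime.fst)
      exact hf.comp ((PolyTime.snd.comp PolyTime.fst).pair PolyTime.snd)
    · exact ((hl.bound.mul (((((PolyTime.id (α := δ)).bound.add hl.bound).add
        (PolyBound.const 1)).eval P).add (PolyBound.const 1))).add (PolyBound.const 1))
    · intro x l₁ l₂ h
      rw [key, List.append_nil, sz_reverse]
      have h1 : ∀ b ∈ l₁.map (f x), sz b ≤ P.eval (sz x + sz (l x) + 1) := by
        intro b hb
        obtain ⟨a, ha, rfl⟩ := List.mem_map.1 hb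
        refine (hP (x, a)).trans (P.eval_nat_mono ?_)
        rw [sz_prod]
        have : sz a ≤ sz (l x) := sz_le_of_mem (by rw [h]; exact List.mem_append_left _ ha)
        omega
      refine (sz_le_of_forall h1).trans ?_
      rw [List.length_map]
      have : l₁.length ≤ sz (l x) := by
        have := length_lt_sz (l x)
        rw [h, List.length_append] at this
        rw [h]
        omega
      gcongr
  exact this.reverse.of_eq fun x => by rw [key]; simp

theorem PolyTime.append {f g : δ → List α} (hf : PolyTime f) (hg : PolyTime g) :
    PolyTime fun x => f x ++ g x := by
  have key : ∀ (l : List α) (b : List α), l.foldl (fun b a => a :: b) b = l.reverse ++ b := by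
    intro l
    induction l with
    | nil => intro b; rfl
    | cons a l ih => intro b; simp [ih]
  refine (PolyTime.foldl (step := fun _ b a => a :: b) hf.reverse hg
    (PolyTime.snd.cons (PolyTime.fst.comp PolyTime.fst)) (hf.bound.add hg.bound)
    ?_).of_eq fun x => by rw [key]; simp
  intro x l₁ l₂ h
  rw [key]
  have h1 := sz_append l₁.reverse (g x)
  have h2 := sz_append l₁ l₂
  rw [← h, sz_reverse] at h2
  rw [sz_reverse] at h1
  have h3 := sz_pos l₂
  change _ ≤ sz (f x) + sz (g x)
  omega

theorem PolyTime.flatten {f : δ → List (List α)} (hf : PolyTime f) :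
    PolyTime fun x => (f x).flatten := by
  have key : ∀ (l : List (List α)) (b : List α), l.foldl (fun b a => b ++ a) b = b ++ l.flatten := by
    intro l
    induction l with
    | nil => intro b; simp
    | cons a l ih => intro b; simp [ih]
  have hsz : ∀ l : List (List α), sz l.flatten ≤ sz l := by
    intro l
    induction l with
    | nil => simp [sz_nil]
    | cons a l ih =>
      rw [List.flatten_cons, sz_cons]
      have := sz_append a l.flatten
      omega
  refine (PolyTime.foldl (step := fun _ b a => b ++ a) hf (PolyTime.const [])
    ((PolyTime.fst.comp PolyTime.fst).append PolyTime.snd) (hf.bound.add (PolyBound.const 0))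
    ?_).of_eq fun x => by rw [key]; simp
  intro x l₁ l₂ h
  rw [key, List.nil_append]
  have h2 := sz_append l₁ l₂
  rw [← h] at h2
  have h3 := sz_pos l₂
  have h4 := hsz l₁
  change _ ≤ sz (f x) + 0
  omega

theorem PolyTime.flatMap {l : δ → List α} {f : δ → α → List β} (hl : PolyTime l)
    (hf : PolyTime fun p : δ × α => f p.1 p.2) : PolyTime fun x => (l x).flatMap (f x) :=
  (hl.map hf).flatten.of_eq fun _ => by rw [List.flatMap_def]

theorem PolyTime.filter {l : δ → List α} {f : δ → α → Bool} (hl : PolyTime l)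
    (hf : PolyTime fun p : δ × α => f p.1 p.2) : PolyTime fun x => (l x).filter (f x) := by
  refine (hl.flatMap (f := fun x a => if f x a = true then [a] else [])
    (PolyTime.ite hf (PolyTime.snd.cons (PolyTime.const [])) (PolyTime.const []))).of_eq fun x => ?_
  induction l x with
  | nil => rfl
  | cons a l ih => cases h : f x a <;> simp [h, ih]

theorem PolyTime.any {l : δ → List α} {f : δ → α → Bool} (hl : PolyTime l)
    (hf : PolyTime fun p : δ × α => f p.1 p.2) : PolyTime fun x => (l x).any (f x) := by
  refine (hl.filter hf).isEmpty.not.of_eq fun x => ?_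
  induction l x with
  | nil => rfl
  | cons a l ih => cases h : f x a <;> simp [h, ih]

theorem PolyTime.all {l : δ → List α} {f : δ → α → Bool} (hl : PolyTime l)
    (hf : PolyTime fun p : δ × α => f p.1 p.2) : PolyTime fun x => (l x).all (f x) := by
  refine (hl.any (f := fun x a => !f x a) hf.not).not.of_eq fun x => ?_
  rw [List.any_eq_not_all_not]
  simp

/-- Unary numerals and lists of units are the same trees, which reduces arithmetic to operations on
lists. -/
theorem enc_replicate (n : ℕ) : enc (List.replicate n ()) = enc n := by
  induction n with
  | zero => rfl
  | succ n ih =>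
    change Data.cons _ (enc (List.replicate n ())) = Data.cons _ (enc n)
    rw [ih]; rfl

theorem PolyTime.replicate {f : δ → ℕ} (hf : PolyTime f) :
    PolyTime fun x => List.replicate (f x) () :=
  (PolyTime.of_enc_eq (f := fun n : ℕ => List.replicate n ()) enc_replicate).comp hf

theorem PolyTime.length {l : δ → List α} (hl : PolyTime l) : PolyTime fun x => (l x).length := by
  refine ((PolyTime.of_enc_eq (f := fun l : List Unit => l.length) fun l => ?_).comp
    (hl.map (f := fun _ _ => ()) (PolyTime.const ()))).of_eq fun x => by simp
  have : List.replicate l.length () = l := (List.eq_replicate_iff.2 ⟨rfl, fun _ _ => rfl⟩).symm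
  rw [← enc_replicate, this]

theorem foldl_const_eq_iterate {σ : Type*} (f : σ → σ) (b : σ) (l : List Unit) :
    l.foldl (fun b _ => f b) b = f^[l.length] b := by
  induction l generalizing b with
  | nil => rfl
  | cons a l ih => simp [ih, Function.iterate_succ_apply]

/-- Iteration with a number of steps that is part of the input. -/
theorem PolyTime.natIterate {n : δ → ℕ} {s : δ → β} {f : δ → β → β} (hn : PolyTime n)
    (hs : PolyTime s) (hf : PolyTime fun p : δ × β => f p.1 p.2) {u : δ → ℕ} (hu : PolyBound u)
    (hb : ∀ x, ∀ i ≤ n x, sz ((f x)^[i] (s x)) ≤ u x) : PolyTime fun x => (f x)^[n x] (s x) := by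
  refine (PolyTime.foldl (step := fun x b _ => f x b) hn.replicate hs
    (hf.comp ((PolyTime.snd.comp PolyTime.fst).pair (PolyTime.fst.comp PolyTime.fst))) hu
    ?_).of_eq fun x => by rw [foldl_const_eq_iterate, List.length_replicate]
  intro x l₁ l₂ h
  rw [foldl_const_eq_iterate]
  refine hb x _ ?_
  have := congrArg List.length h
  rw [List.length_replicate, List.length_append] at this
  omega

theorem PolyTime.drop {l : δ → List α} {n : δ → ℕ} (hl : PolyTime l) (hn : PolyTime n) :
    PolyTime fun x => (l x).drop (n x) := by
  have key : ∀ (l : List α) n, List.tail^[n] l = l.drop n := by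
    intro l n
    induction n with
    | zero => rfl
    | succ n ih => rw [Function.iterate_succ_apply', ih, List.tail_drop]
  refine (PolyTime.natIterate (f := fun _ l => l.tail) hn hl PolyTime.snd.tail hl.bound
    ?_).of_eq fun x => key _ _
  intro x i _
  change sz (List.tail^[i] (l x)) ≤ _
  rw [key]
  exact sz_le_of_sublist (List.drop_sublist _ _)

theorem PolyTime.getD {l : δ → List α} {n : δ → ℕ} (hl : PolyTime l) (hn : PolyTime n) (d : α) :
    PolyTime fun x => (l x).getD (n x) d := by
  refine ((hl.drop hn).headD (PolyTime.const d)).of_eq fun x => ?_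
  rw [List.headD_eq_head?_getD, List.head?_drop, List.getD_eq_getElem?_getD]

theorem PolyTime.add {f g : δ → ℕ} (hf : PolyTime f) (hg : PolyTime g) :
    PolyTime fun x => f x + g x := by
  refine (hf.replicate.append hg.replicate).length.of_eq fun x => by simp

theorem PolyTime.sub {f g : δ → ℕ} (hf : PolyTime f) (hg : PolyTime g) :
    PolyTime fun x => f x - g x := by
  refine (hf.replicate.drop hg).length.of_eq fun x => by simp

theorem PolyTime.mul {f g : δ → ℕ} (hf : PolyTime f) (hg : PolyTime g) :
    PolyTime fun x => f x * g x := by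
  refine (hf.replicate.flatMap (f := fun x _ => List.replicate (g x) ())
    (hg.comp PolyTime.fst).replicate).length.of_eq fun x => ?_
  simp

theorem PolyTime.range {f : δ → ℕ} (hf : PolyTime f) : PolyTime fun x => List.range (f x) := by
  have key : ∀ n, (fun l : List ℕ => l ++ [l.length])^[n] [] = List.range n := by
    intro n
    induction n with
    | zero => rfl
    | succ n ih => rw [Function.iterate_succ_apply', ih, List.range_succ, List.length_range]
  refine (PolyTime.natIterate (f := fun _ l => l ++ [l.length]) (u := fun x =>
    sz (f x) * (2 * sz (f x) + 1) + 1) hf (PolyTime.const [])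
    (PolyTime.snd.append (PolyTime.snd.length.cons (PolyTime.const []))) ?_ ?_).of_eq fun x => key _
  · exact (hf.bound.mul (((PolyBound.const 2).mul hf.bound).add (PolyBound.const 1))).add
      (PolyBound.const 1)
  · intro x i hi
    rw [key]
    have h0 := sz_nat (f x)
    refine (sz_le_of_forall (B := 2 * sz (f x)) ?_).trans ?_
    · intro a ha
      rw [sz_nat]
      have := List.mem_range.1 ha
      omega
    · rw [List.length_range]
      have : i ≤ sz (f x) := by omega
      gcongr

theorem PolyTime.decide_le {f g : δ → ℕ} (hf : PolyTime f) (hg : PolyTime g) :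
    PolyTime fun x => decide (f x ≤ g x) := by
  refine (hf.sub hg).replicate.isEmpty.of_eq fun x => ?_
  rw [Bool.eq_iff_iff, List.isEmpty_iff, decide_eq_true_iff, List.replicate_eq_nil_iff]
  omega

theorem PolyTime.decide_lt {f g : δ → ℕ} (hf : PolyTime f) (hg : PolyTime g) :
    PolyTime fun x => decide (f x < g x) :=
  (hf.succ.decide_le hg).of_eq fun _ => rfl

theorem PolyTime.decide_eq {f g : δ → ℕ} (hf : PolyTime f) (hg : PolyTime g) :
    PolyTime fun x => decide (f x = g x) := by
  refine ((hf.decide_le hg).and (hg.decide_le hf)).of_eq fun x => ?_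
  rw [Bool.eq_iff_iff, Bool.and_eq_true, decide_eq_true_iff, decide_eq_true_iff, decide_eq_true_iff]
  omega

theorem PolyTime.decide_mem {f : δ → ℕ} {l : δ → List ℕ} (hf : PolyTime f) (hl : PolyTime l) :
    PolyTime fun x => decide (f x ∈ l x) := by
  refine (hl.any (f := fun x a => decide (a = f x))
    (PolyTime.snd.decide_eq (hf.comp PolyTime.fst))).of_eq fun x => ?_
  rw [Bool.eq_iff_iff, List.any_eq_true, decide_eq_true_iff]
  simp

end

end

/-! ### The branching algorithm -/

/-- Circuits as they are encoded: the output vertex and the list of the labels and columns of the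
adjacency matrix. -/
abbrev RawCircuit := ℕ × List (ℕ × List Bool)

namespace RawCircuit

def ord (c : RawCircuit) : ℕ := c.2.length

def out (c : RawCircuit) : ℕ := c.1

def kind (c : RawCircuit) (v : ℕ) : ℕ := (c.2.getD v (0, [])).1

def adj (c : RawCircuit) (u v : ℕ) : Bool := (c.2.getD v (0, [])).2.getD u false

def verts (c : RawCircuit) : List ℕ := List.range c.ord

/-- One step of the evaluation of the circuit under the assignment `X`. -/
def evalStep (c : RawCircuit) (X S : List ℕ) : List ℕ :=
  c.verts.filter fun v =>
    (decide (c.kind v = 0) && decide (v ∈ X)) ||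
    (decide (c.kind v = 1) && c.verts.all fun u => !c.adj u v || decide (u ∈ S)) ||
    (decide (c.kind v = 2) && c.verts.any fun u => c.adj u v && decide (u ∈ S))

/-- The vertices that are true under the assignment `X` (if they have height at most `t`). -/
def trueList (t : ℕ) (c : RawCircuit) (X : List ℕ) : List ℕ := (c.evalStep X)^[t + 1] []

/-- The gate to which a gate is incoming. -/
def parent (c : RawCircuit) (v : ℕ) : ℕ := (c.verts.filter fun w => c.adj v w).headD c.ord

/-- Moving up to the output through gates that are not in `T`. -/
def climb (c : RawCircuit) (T : List ℕ) (v : ℕ) : ℕ :=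
  if decide (v = c.out) then v else
    -- `c.ord` is not a vertex; it serves as a sink for climbs that must not reach the output.
    if decide (c.kind v = 0) || decide (v ∈ T) then c.ord else c.parent v

/-- A gate is live if no gate on the path to the output is in `T`. -/
def live (t : ℕ) (c : RawCircuit) (T : List ℕ) (v : ℕ) : Bool :=
  !decide (v = c.out) && decide ((c.climb T)^[t] v = c.out)

def rootStep (c : RawCircuit) (v : ℕ) : ℕ := if c.adj v c.out then v else c.parent v

/-- The critical gate above a gate. -/
def root (t : ℕ) (c : RawCircuit) (v : ℕ) : ℕ := c.rootStep^[t] v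

/-- An and-gate with exactly one input outside of `T`. -/
def single (c : RawCircuit) (T : List ℕ) (w : ℕ) : Bool :=
  decide (c.kind w = 1) &&
    decide ((c.verts.filter fun u => c.adj u w && !decide (u ∈ T)).length = 1)

/-- A gate that is merged with its parent. -/
def absorbed (c : RawCircuit) (T : List ℕ) (v : ℕ) : Bool :=
  c.single T v || (!c.adj v c.out && c.single T (c.parent v))

def repStep (c : RawCircuit) (T : List ℕ) (v : ℕ) : ℕ := if c.absorbed T v then c.parent v else v

/-- The gate with which a gate is merged. -/
def rep (t : ℕ) (c : RawCircuit) (T : List ℕ) (v : ℕ) : ℕ := (c.repStep T)^[t] v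

/-- The critical gates outside of `T`. -/
def crit (c : RawCircuit) (T : List ℕ) : List ℕ :=
  c.verts.filter fun p => decide (c.kind p = 2) && c.adj p c.out && !decide (p ∈ T)

/-- The variable `x` is incoming to a live gate below the critical gate `p`. -/
def feeds (t : ℕ) (c : RawCircuit) (T : List ℕ) (x p : ℕ) : Bool :=
  c.verts.any fun q => c.live t T q && decide (c.root t q = p) && c.adj x q

/-- The quantity that must be at most two for the variables that survive. -/
def deg (t : ℕ) (c : RawCircuit) (T : List ℕ) (x : ℕ) : ℕ :=
  ((c.crit T).filter fun p => c.feeds t T x p).length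

/-- The variables on which the algorithm branches when `r` variables remain to be chosen. -/
def isCand (t : ℕ) (c : RawCircuit) (T : List ℕ) (r x : ℕ) : Bool :=
  -- The threshold 3 is what violates the desired bound. The second one reflects that `r` variables
  -- reach all critical subtrees only if one of them reaches at least the `r`-th part.
  decide (c.kind x = 0) && !decide (x ∈ T) && decide (3 ≤ c.deg t T x) &&
    decide ((c.crit T).length ≤ c.deg t T x * r)

def children (t k : ℕ) (c : RawCircuit) (X : List ℕ) : List (List ℕ) :=
  if decide (X.length < k) then
    (c.verts.filter fun x => c.isCand t (c.trueList t X) (k - X.length) x).map fun x => x :: X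
  else []

/-- The variables that are incoming to the output. -/
def mand (c : RawCircuit) : List ℕ :=
  c.verts.filter fun v => decide (c.kind v = 0) && c.adj v c.out

/-- Starting from the empty list, `i` steps produce the search tree down to depth `i - 1`. The root
is put back every time because inner nodes emit instances too: they stand for the solutions without
candidates. -/
def branchStep (t k : ℕ) (c : RawCircuit) (A : List (List ℕ)) : List (List ℕ) :=
  (if decide (c.mand.length ≤ k) then [c.mand] else []) ++ A.flatMap (c.children t k)

/-- The live gates that are not merged with their parents. -/
def kept (t : ℕ) (c : RawCircuit) (T : List ℕ) (q : ℕ) : Bool :=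
  c.live t T q && !c.absorbed T q

/-- There is an edge from `a` to a gate that is merged with `b`. -/
def merged (t : ℕ) (c : RawCircuit) (T : List ℕ) (a b : ℕ) : Bool :=
  c.verts.any fun q => c.live t T q && decide (c.rep t T q = b) && c.adj a q

/-- The variables of the residual circuit that stem from the given circuit. -/
def low (t : ℕ) (c : RawCircuit) (T : List ℕ) (r x : ℕ) : Bool :=
  decide (c.kind x = 0) && !decide (x ∈ T) && !c.isCand t T r x &&
    c.verts.any fun q => c.live t T q && c.adj x q

/-- Candidates count here: the variable only serves to replace an additional variable in a solution
of the given circuit. -/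
def hasVar (t : ℕ) (c : RawCircuit) (T : List ℕ) (q : ℕ) : Bool :=
  c.verts.any fun x => decide (c.kind x = 0) && !decide (x ∈ T) && c.merged t T x q

/-- For a kept and-gate this means that it becomes false when the candidates are set to 0. It stays
in the circuit and is made unsatisfiable by padding. -/
def hasCand (t : ℕ) (c : RawCircuit) (T : List ℕ) (r w : ℕ) : Bool :=
  c.verts.any fun x => c.isCand t T r x && c.adj x w

/-- The or-gates that need an additional and-gate as input. -/
def needsAnd (t : ℕ) (c : RawCircuit) (T : List ℕ) (q : ℕ) : Bool :=
  decide (c.kind q = 2) && !c.hasVar t T q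

/-- The gates that get additional variables. -/
def padded (t : ℕ) (c : RawCircuit) (T : List ℕ) (r q : ℕ) : Bool :=
  decide (c.kind q = 2) || c.hasCand t T r q

/-- The vertices of the residual circuit: the output gate, the gates, the old variables, the
additional and-gates, and the additional variables. -/
def resVerts (t : ℕ) (c : RawCircuit) (T : List ℕ) (r : ℕ) : List (ℕ × ℕ × ℕ) :=
  (0, 0, 0) ::
    ((c.verts.filter fun q => c.kept t T q).map (fun q => (1, q, 0)) ++
    ((c.verts.filter fun x => c.low t T r x).map (fun x => (2, x, 0)) ++
    ((c.verts.filter fun q => c.kept t T q && c.needsAnd t T q).map (fun q => (3, q, 0)) ++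
    (c.verts.filter fun q => c.kept t T q && c.padded t T r q).flatMap fun q =>
      -- With `r + 2` new variables, an assignment of weight `r` misses one of them, and the gate
      -- has two inputs even if `r = 0`.
      (List.range (r + 2)).map fun i => (4, q, i))))

/-- The first entry of a descriptor is a tag: 0 output, 1 gate, 2 old variable, 3 additional
and-gate, 4 additional variable. The second entry is the vertex it belongs to, the third numbers the
additional variables of a gate. -/
def resKind (c : RawCircuit) (d : ℕ × ℕ × ℕ) : ℕ :=
  if decide (d.1 = 0) then 1 else if decide (d.1 = 1) then c.kind d.2.1 else
    if decide (d.1 = 3) then 1 else 0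

def resAdj (t : ℕ) (c : RawCircuit) (T : List ℕ) (d e : ℕ × ℕ × ℕ) : Bool :=
  (decide (e.1 = 0) && decide (d.1 = 1) && c.adj d.2.1 c.out) ||
  (decide (e.1 = 1) && (decide (d.1 = 1) || decide (d.1 = 2)) && c.merged t T d.2.1 e.2.1) ||
  (decide (e.1 = 1) && decide (d.1 = 3) && decide (d.2.1 = e.2.1)) ||
  (decide (e.1 = 1) && decide (d.1 = 4) && decide (d.2.1 = e.2.1) && !c.needsAnd t T e.2.1) ||
  (decide (e.1 = 3) && decide (d.1 = 4) && decide (d.2.1 = e.2.1))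

def residual (t : ℕ) (c : RawCircuit) (T : List ℕ) (r : ℕ) : RawCircuit :=
  (0, (c.resVerts t T r).map fun e =>
    (c.resKind e, (c.resVerts t T r).map fun d => c.resAdj t T d e))

/-- The circuit with a single variable, which is incoming to the output. -/
def trivialRaw : RawCircuit := (0, [(1, [false, true]), (0, [false, false])])

/-- The instances that are produced for the assignment `X`. -/
def emit (t k : ℕ) (c : RawCircuit) (X : List ℕ) : List (RawCircuit × ℕ) :=
  -- Without critical gates outside of `T`, the assignment `X` already satisfies the circuit.
  if decide ((c.crit (c.trueList t X)).length = 0) then [(trivialRaw, 1)] else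
    -- With more critical gates every solution contains a candidate and is found below a child of
    -- `X`.
    if decide ((c.crit (c.trueList t X)).length ≤ 2 * (k - X.length)) then
      [(c.residual t (c.trueList t X) (k - X.length), k - X.length)]
    else []

/-- By monotonicity a solution of weight at most `k` can be enlarged to weight `k`, provided that
there are `k` variables at all. -/
def finish (t k : ℕ) (c : RawCircuit) (A : List (List ℕ)) : List (RawCircuit × ℕ) :=
  if decide (k ≤ (c.verts.filter fun v => decide (c.kind v = 0)).length) then
    A.flatMap (c.emit t k)
  else []

/-! ### Polynomial running time of the constituents of the algorithm. -/

section PolyTime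

variable {δ : Type} [Enc δ] {c : δ → RawCircuit} {T X S : δ → List ℕ} {k r u v : δ → ℕ}
  {d e : δ → ℕ × ℕ × ℕ} (t : ℕ)

open _root_.PolyTime (fst snd)

theorem polyTime_ord (hc : PolyTime c) : PolyTime fun x => (c x).ord := (snd.comp hc).length

theorem polyTime_out (hc : PolyTime c) : PolyTime fun x => (c x).out := fst.comp hc

theorem polyTime_kind (hc : PolyTime c) (hv : PolyTime v) : PolyTime fun x => (c x).kind (v x) :=
  fst.comp ((snd.comp hc).getD hv (0, []))

theorem polyTime_adj (hc : PolyTime c) (hu : PolyTime u) (hv : PolyTime v) :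
    PolyTime fun x => (c x).adj (u x) (v x) :=
  (snd.comp ((snd.comp hc).getD hv (0, []))).getD hu false

theorem polyTime_verts (hc : PolyTime c) : PolyTime fun x => (c x).verts :=
  (polyTime_ord hc).range

theorem polyTime_trueList (hc : PolyTime c) (hX : PolyTime X) :
    PolyTime fun x => (c x).trueList t (X x) := by
  refine PolyTime.iterate (f := fun x S => (c x).evalStep (X x) S) ?_ (PolyTime.const []) (t + 1)
  refine (polyTime_verts (hc.comp fst)).filter ?_
  have hc₁ : PolyTime fun p : (δ × List ℕ) × ℕ => c p.1.1 := hc.comp (fst.comp fst)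
  have hk : PolyTime fun p : (δ × List ℕ) × ℕ => (c p.1.1).kind p.2 := polyTime_kind hc₁ snd
  have hadj : PolyTime fun p : ((δ × List ℕ) × ℕ) × ℕ => (c p.1.1.1).adj p.2 p.1.2 :=
    polyTime_adj (hc₁.comp fst) snd (snd.comp fst)
  have hmem : PolyTime fun p : ((δ × List ℕ) × ℕ) × ℕ => decide (p.2 ∈ p.1.1.2) :=
    PolyTime.decide_mem snd (snd.comp (fst.comp fst))
  refine (((hk.decide_eq (.const 0)).and
    (PolyTime.decide_mem snd (hX.comp (fst.comp fst)))).or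
    ((hk.decide_eq (.const 1)).and ?_)).or ((hk.decide_eq (.const 2)).and ?_)
  · exact (polyTime_verts hc₁).all (hadj.not.or hmem)
  · exact (polyTime_verts hc₁).any (hadj.and hmem)

theorem polyTime_parent (hc : PolyTime c) (hv : PolyTime v) :
    PolyTime fun x => (c x).parent (v x) :=
  ((polyTime_verts hc).filter (f := fun x w => (c x).adj (v x) w)
    (polyTime_adj (hc.comp fst) (hv.comp fst) snd)).headD (polyTime_ord hc)

theorem polyTime_live (hc : PolyTime c) (hT : PolyTime T) (hv : PolyTime v) :
    PolyTime fun x => (c x).live t (T x) (v x) := by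
  refine ((hv.decide_eq (polyTime_out hc)).not).and (PolyTime.decide_eq ?_ (polyTime_out hc))
  refine PolyTime.iterate (f := fun x v => (c x).climb (T x) v) ?_ hv t
  have hc₁ : PolyTime fun p : δ × ℕ => c p.1 := hc.comp fst
  exact (snd.decide_eq (polyTime_out hc₁)).ite snd
    ((((polyTime_kind hc₁ snd).decide_eq (.const 0)).or (snd.decide_mem (hT.comp fst))).ite
      (polyTime_ord hc₁) (polyTime_parent hc₁ snd))

theorem polyTime_root (hc : PolyTime c) (hv : PolyTime v) :
    PolyTime fun x => (c x).root t (v x) := by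
  have hc₁ : PolyTime fun p : δ × ℕ => c p.1 := hc.comp fst
  exact PolyTime.iterate (f := fun x v => (c x).rootStep v)
    ((polyTime_adj hc₁ snd (polyTime_out hc₁)).ite snd (polyTime_parent hc₁ snd)) hv t

theorem polyTime_single (hc : PolyTime c) (hT : PolyTime T) (hv : PolyTime v) :
    PolyTime fun x => (c x).single (T x) (v x) :=
  ((polyTime_kind hc hv).decide_eq (.const 1)).and
    (((polyTime_verts hc).filter (f := fun x u => (c x).adj u (v x) && !decide (u ∈ T x))
      ((polyTime_adj (hc.comp fst) snd (hv.comp fst)).and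
        (snd.decide_mem (hT.comp fst)).not)).length.decide_eq (.const 1))

theorem polyTime_absorbed (hc : PolyTime c) (hT : PolyTime T) (hv : PolyTime v) :
    PolyTime fun x => (c x).absorbed (T x) (v x) :=
  (polyTime_single hc hT hv).or
    ((polyTime_adj hc hv (polyTime_out hc)).not.and (polyTime_single hc hT (polyTime_parent hc hv)))

theorem polyTime_rep (hc : PolyTime c) (hT : PolyTime T) (hv : PolyTime v) :
    PolyTime fun x => (c x).rep t (T x) (v x) := by
  have hc₁ : PolyTime fun p : δ × ℕ => c p.1 := hc.comp fst
  exact PolyTime.iterate (f := fun x v => (c x).repStep (T x) v)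
    ((polyTime_absorbed hc₁ (hT.comp fst) snd).ite (polyTime_parent hc₁ snd) snd) hv t

theorem polyTime_crit (hc : PolyTime c) (hT : PolyTime T) :
    PolyTime fun x => (c x).crit (T x) := by
  have hc₁ : PolyTime fun p : δ × ℕ => c p.1 := hc.comp fst
  exact (polyTime_verts hc).filter
    ((((polyTime_kind hc₁ snd).decide_eq (.const 2)).and
      (polyTime_adj hc₁ snd (polyTime_out hc₁))).and (snd.decide_mem (hT.comp fst)).not)

theorem polyTime_feeds (hc : PolyTime c) (hT : PolyTime T) (hu : PolyTime u) (hv : PolyTime v) :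
    PolyTime fun x => (c x).feeds t (T x) (u x) (v x) := by
  have hc₁ : PolyTime fun p : δ × ℕ => c p.1 := hc.comp fst
  exact (polyTime_verts hc).any
    (((polyTime_live t hc₁ (hT.comp fst) snd).and
      ((polyTime_root t hc₁ snd).decide_eq (hv.comp fst))).and
      (polyTime_adj hc₁ (hu.comp fst) snd))

theorem polyTime_deg (hc : PolyTime c) (hT : PolyTime T) (hv : PolyTime v) :
    PolyTime fun x => (c x).deg t (T x) (v x) :=
  ((polyTime_crit hc hT).filter (f := fun x p => (c x).feeds t (T x) (v x) p)
    (polyTime_feeds t (hc.comp fst) (hT.comp fst) (hv.comp fst) snd)).length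

theorem polyTime_isCand (hc : PolyTime c) (hT : PolyTime T) (hr : PolyTime r) (hv : PolyTime v) :
    PolyTime fun x => (c x).isCand t (T x) (r x) (v x) :=
  ((((polyTime_kind hc hv).decide_eq (.const 0)).and (hv.decide_mem hT).not).and
    ((PolyTime.const 3).decide_le (polyTime_deg t hc hT hv))).and
    ((polyTime_crit hc hT).length.decide_le ((polyTime_deg t hc hT hv).mul hr))

theorem polyTime_children (hk : PolyTime k) (hc : PolyTime c) (hX : PolyTime X) :
    PolyTime fun x => (c x).children t (k x) (X x) :=
  (hX.length.decide_lt hk).ite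
    (((polyTime_verts hc).filter
      (f := fun x v => (c x).isCand t ((c x).trueList t (X x)) (k x - (X x).length) v)
      (polyTime_isCand t (hc.comp fst) (polyTime_trueList t (hc.comp fst) (hX.comp fst))
        ((hk.comp fst).sub (hX.comp fst).length) snd)).map (snd.cons (hX.comp fst)))
    (.const [])

theorem polyTime_mand (hc : PolyTime c) : PolyTime fun x => (c x).mand := by
  have hc₁ : PolyTime fun p : δ × ℕ => c p.1 := hc.comp fst
  exact (polyTime_verts hc).filter
    (((polyTime_kind hc₁ snd).decide_eq (.const 0)).and (polyTime_adj hc₁ snd (polyTime_out hc₁)))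

theorem polyTime_branchStep {A : δ → List (List ℕ)} (hk : PolyTime k) (hc : PolyTime c)
    (hA : PolyTime A) : PolyTime fun x => (c x).branchStep t (k x) (A x) :=
  (((polyTime_mand hc).length.decide_le hk).ite ((polyTime_mand hc).cons (.const []))
    (.const [])).append
    (hA.flatMap (f := fun x X => (c x).children t (k x) X)
      (polyTime_children t (hk.comp fst) (hc.comp fst) snd))

theorem polyTime_kept (hc : PolyTime c) (hT : PolyTime T) (hv : PolyTime v) :
    PolyTime fun x => (c x).kept t (T x) (v x) :=
  (polyTime_live t hc hT hv).and (polyTime_absorbed hc hT hv).not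

theorem polyTime_merged (hc : PolyTime c) (hT : PolyTime T) (hu : PolyTime u) (hv : PolyTime v) :
    PolyTime fun x => (c x).merged t (T x) (u x) (v x) := by
  have hc₁ : PolyTime fun p : δ × ℕ => c p.1 := hc.comp fst
  exact (polyTime_verts hc).any
    (((polyTime_live t hc₁ (hT.comp fst) snd).and
      ((polyTime_rep t hc₁ (hT.comp fst) snd).decide_eq (hv.comp fst))).and
      (polyTime_adj hc₁ (hu.comp fst) snd))

theorem polyTime_low (hc : PolyTime c) (hT : PolyTime T) (hr : PolyTime r) (hv : PolyTime v) :
    PolyTime fun x => (c x).low t (T x) (r x) (v x) :=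
  ((((polyTime_kind hc hv).decide_eq (.const 0)).and (hv.decide_mem hT).not).and
    (polyTime_isCand t hc hT hr hv).not).and
    ((polyTime_verts hc).any (f := fun x q => (c x).live t (T x) q && (c x).adj (v x) q)
      ((polyTime_live t (hc.comp fst) (hT.comp fst) snd).and
        (polyTime_adj (hc.comp fst) (hv.comp fst) snd)))

theorem polyTime_hasVar (hc : PolyTime c) (hT : PolyTime T) (hv : PolyTime v) :
    PolyTime fun x => (c x).hasVar t (T x) (v x) :=
  (polyTime_verts hc).any (f := fun x u =>
      decide ((c x).kind u = 0) && !decide (u ∈ T x) && (c x).merged t (T x) u (v x))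
    ((((polyTime_kind (hc.comp fst) snd).decide_eq (.const 0)).and
      (snd.decide_mem (hT.comp fst)).not).and
      (polyTime_merged t (hc.comp fst) (hT.comp fst) snd (hv.comp fst)))

theorem polyTime_hasCand (hc : PolyTime c) (hT : PolyTime T) (hr : PolyTime r) (hv : PolyTime v) :
    PolyTime fun x => (c x).hasCand t (T x) (r x) (v x) :=
  (polyTime_verts hc).any (f := fun x u => (c x).isCand t (T x) (r x) u && (c x).adj u (v x))
    ((polyTime_isCand t (hc.comp fst) (hT.comp fst) (hr.comp fst) snd).and
      (polyTime_adj (hc.comp fst) snd (hv.comp fst)))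

theorem polyTime_needsAnd (hc : PolyTime c) (hT : PolyTime T) (hv : PolyTime v) :
    PolyTime fun x => (c x).needsAnd t (T x) (v x) :=
  ((polyTime_kind hc hv).decide_eq (.const 2)).and (polyTime_hasVar t hc hT hv).not

theorem polyTime_padded (hc : PolyTime c) (hT : PolyTime T) (hr : PolyTime r) (hv : PolyTime v) :
    PolyTime fun x => (c x).padded t (T x) (r x) (v x) :=
  ((polyTime_kind hc hv).decide_eq (.const 2)).or (polyTime_hasCand t hc hT hr hv)

theorem polyTime_resVerts (hc : PolyTime c) (hT : PolyTime T) (hr : PolyTime r) :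
    PolyTime fun x => (c x).resVerts t (T x) (r x) := by
  have hc₁ : PolyTime fun p : δ × ℕ => c p.1 := hc.comp fst
  have hT₁ : PolyTime fun p : δ × ℕ => T p.1 := hT.comp fst
  have hr₁ : PolyTime fun p : δ × ℕ => r p.1 := hr.comp fst
  have h0 : PolyTime fun _ : δ × ℕ => 0 := .const 0
  have hv := polyTime_verts hc
  have hkept := polyTime_kept t hc₁ hT₁ snd
  refine (PolyTime.const (0, 0, 0)).cons (PolyTime.append ?_ (.append ?_ (.append ?_ ?_)))
  · exact (hv.filter hkept).map ((PolyTime.const 1).pair (snd.pair h0))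
  · exact (hv.filter (polyTime_low t hc₁ hT₁ hr₁ snd)).map ((PolyTime.const 2).pair (snd.pair h0))
  · exact (hv.filter (hkept.and (polyTime_needsAnd t hc₁ hT₁ snd))).map
      ((PolyTime.const 3).pair (snd.pair h0))
  · exact (hv.filter (hkept.and (polyTime_padded t hc₁ hT₁ hr₁ snd))).flatMap
      (f := fun x q => (List.range (r x + 2)).map fun i => (4, q, i))
      ((hr₁.add (.const 2)).range.map (f := fun p i => (4, p.2, i))
        ((PolyTime.const 4).pair ((snd.comp fst).pair snd)))

theorem polyTime_resKind (hc : PolyTime c) (hd : PolyTime d) :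
    PolyTime fun x => (c x).resKind (d x) := by
  have h1 : PolyTime fun x => (d x).1 := fst.comp hd
  exact (h1.decide_eq (.const 0)).ite (.const 1) ((h1.decide_eq (.const 1)).ite
    (polyTime_kind hc (fst.comp (snd.comp hd))) ((h1.decide_eq (.const 3)).ite (.const 1) (.const 0)))

theorem polyTime_resAdj (hc : PolyTime c) (hT : PolyTime T) (hd : PolyTime d) (he : PolyTime e) :
    PolyTime fun x => (c x).resAdj t (T x) (d x) (e x) := by
  have hd1 : PolyTime fun x => (d x).1 := fst.comp hd
  have he1 : PolyTime fun x => (e x).1 := fst.comp he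
  have hd2 : PolyTime fun x => (d x).2.1 := fst.comp (snd.comp hd)
  have he2 : PolyTime fun x => (e x).2.1 := fst.comp (snd.comp he)
  exact ((((((he1.decide_eq (.const 0)).and (hd1.decide_eq (.const 1))).and
      (polyTime_adj hc hd2 (polyTime_out hc))).or
    (((he1.decide_eq (.const 1)).and ((hd1.decide_eq (.const 1)).or (hd1.decide_eq (.const 2)))).and
      (polyTime_merged t hc hT hd2 he2))).or
    (((he1.decide_eq (.const 1)).and (hd1.decide_eq (.const 3))).and (hd2.decide_eq he2))).or
    ((((he1.decide_eq (.const 1)).and (hd1.decide_eq (.const 4))).and (hd2.decide_eq he2)).and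
      (polyTime_needsAnd t hc hT he2).not)).or
    (((he1.decide_eq (.const 3)).and (hd1.decide_eq (.const 4))).and (hd2.decide_eq he2))

theorem polyTime_residual (hc : PolyTime c) (hT : PolyTime T) (hr : PolyTime r) :
    PolyTime fun x => (c x).residual t (T x) (r x) := by
  have hc₁ : PolyTime fun p : δ × (ℕ × ℕ × ℕ) => c p.1 := hc.comp fst
  have hT₁ : PolyTime fun p : δ × (ℕ × ℕ × ℕ) => T p.1 := hT.comp fst
  have hr₁ : PolyTime fun p : δ × (ℕ × ℕ × ℕ) => r p.1 := hr.comp fst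
  have hc₂ : PolyTime fun p : (δ × (ℕ × ℕ × ℕ)) × (ℕ × ℕ × ℕ) => c p.1.1 := hc₁.comp fst
  have hT₂ : PolyTime fun p : (δ × (ℕ × ℕ × ℕ)) × (ℕ × ℕ × ℕ) => T p.1.1 := hT₁.comp fst
  have hadj := polyTime_resAdj t hc₂ hT₂ snd (snd.comp fst)
  have hcol := (polyTime_resVerts t hc₁ hT₁ hr₁).map
    (f := fun p d => (c p.1).resAdj t (T p.1) d p.2) hadj
  have hrow := (polyTime_resKind hc₁ snd).pair hcol
  have hrows := (polyTime_resVerts t hc hT hr).map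
    (f := fun x e => ((c x).resKind e, ((c x).resVerts t (T x) (r x)).map
      fun d => (c x).resAdj t (T x) d e)) hrow
  exact (PolyTime.const 0).pair hrows

theorem polyTime_emit (hk : PolyTime k) (hc : PolyTime c) (hX : PolyTime X) :
    PolyTime fun x => (c x).emit t (k x) (X x) := by
  have hT := polyTime_trueList t hc hX
  have hr := hk.sub hX.length
  have hm := (polyTime_crit hc hT).length
  have hres := ((polyTime_residual t hc hT hr).pair hr).cons (.const [])
  have hle := hm.decide_le ((PolyTime.const 2).mul hr)
  have htriv : PolyTime fun _ : δ => [(trivialRaw, 1)] := .const _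
  exact (hm.decide_eq (.const 0)).ite htriv (hle.ite hres (.const []))

theorem polyTime_finish {A : δ → List (List ℕ)} (hk : PolyTime k) (hc : PolyTime c)
    (hA : PolyTime A) : PolyTime fun x => (c x).finish t (k x) (A x) :=
  (hk.decide_le ((polyTime_verts hc).filter (f := fun x v => decide ((c x).kind v = 0))
    ((polyTime_kind (hc.comp fst) snd).decide_eq (.const 0))).length).ite
    (hA.flatMap (f := fun x X => (c x).emit t (k x) X)
      (polyTime_emit t (hk.comp fst) (hc.comp fst) snd)) (.const [])

end PolyTime

end RawCircuit

/-! ### Circuits on natural numbers -/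

namespace RawCircuit

/-- Directed paths. -/
inductive Path (c : RawCircuit) : ℕ → ℕ → ℕ → Prop
  | refl (v : ℕ) : Path c 0 v v
  | step {ℓ u v w : ℕ} : c.adj u v = true → Path c ℓ v w → Path c (ℓ + 1) u w

/-- The vertices that are true under the assignment `τ`. -/
inductive Sat (c : RawCircuit) (τ : Set ℕ) : ℕ → Prop
  | var {v : ℕ} : c.kind v = 0 → v ∈ τ → Sat c τ v
  | and {v : ℕ} : c.kind v = 1 → (∀ u, c.adj u v = true → Sat c τ u) → Sat c τ v
  | or {u v : ℕ} : c.kind v = 2 → c.adj u v = true → Sat c τ u → Sat c τ v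

theorem Path.trans {c : RawCircuit} {ℓ ℓ' u v w : ℕ} (h : c.Path ℓ u v) (h' : c.Path ℓ' v w) :
    c.Path (ℓ + ℓ') u w := by
  induction h with
  | refl v => rwa [zero_add]
  | step hadj _ ih => rw [Nat.add_right_comm]; exact .step hadj (ih h')

theorem Sat.mono {c : RawCircuit} {τ τ' : Set ℕ} (h : τ ⊆ τ') {v : ℕ} (hv : c.Sat τ v) :
    c.Sat τ' v := by
  induction hv with
  | var hk hv => exact .var hk (h hv)
  | and hk _ ih => exact .and hk ih
  | or hk hadj _ ih => exact .or hk hadj ih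

/-- The conditions on a `Π_t⁺` circuit. -/
structure IsPi (t : ℕ) (c : RawCircuit) : Prop where
  out_lt : c.out < c.ord
  adj_lt : ∀ {u v}, c.adj u v = true → u < c.ord ∧ v < c.ord
  kind_out : c.kind c.out = 1
  kind_le : ∀ v, c.kind v ≤ 2
  -- Lookups out of range give label 0; this keeps the default value `c.ord` of `parent` from being
  -- live.
  kind_ord : c.kind c.ord = 0
  not_adj_var : ∀ {u v}, c.adj u v = true → c.kind v ≠ 0
  exists_adj : ∀ {v}, c.kind v ≠ 0 → ∃ u, c.adj u v = true
  not_adj_out : ∀ v, ¬ c.adj c.out v = true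
  parent_unique : ∀ {v w w'}, c.kind v ≠ 0 → c.adj v w = true → c.adj v w' = true → w = w'
  alternating : ∀ {u v}, c.kind u ≠ 0 → c.adj u v = true → c.kind u ≠ c.kind v
  depth_le : ∀ {x ℓ}, c.kind x = 0 → c.Path ℓ x c.out → ℓ ≤ t
  exists_var_path : ∀ v, v < c.ord → ∃ x ℓ, x < c.ord ∧ c.kind x = 0 ∧ c.Path ℓ x v

end RawCircuit

/-! ### Translation between circuits and their raw form. -/

/-- The number that encodes a label. -/
def VertexKind.code : VertexKind → ℕ
  | .var => 0
  | .and => 1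
  | .or => 2

namespace MonotoneCircuit

variable (C : MonotoneCircuit)

/-- The raw form of a circuit. -/
def raw : RawCircuit :=
  (C.out, (List.finRange C.order).map fun v =>
    ((C.kind v).code, (List.finRange C.order).map fun u => C.adj u v))

theorem enc_raw : enc C.raw = C.encode := by
  have h : ∀ K : VertexKind, enc K.code = K.encode := by intro K; cases K <;> rfl
  unfold raw encode
  change Data.cons _ (Data.ofList (List.map _ (List.map _ _))) = _
  rw [List.map_map]
  congr 3
  funext v
  change Data.cons (enc (C.kind v).code) (Data.ofList (List.map _ (List.map _ _))) = _
  rw [List.map_map, h]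
  rfl

theorem enc_raw_pair (k : ℕ) : enc (C.raw, k) = encodeInstance (C, k) := by
  change Data.cons (enc C.raw) (enc k) = _
  rw [enc_raw]
  rfl

@[simp] theorem raw_ord : C.raw.ord = C.order := by simp [raw, RawCircuit.ord]

@[simp] theorem raw_out : C.raw.out = C.out := rfl

theorem raw_kind (v : Fin C.order) : C.raw.kind v = (C.kind v).code := by
  simp [raw, RawCircuit.kind, List.getD_eq_getElem?_getD]

theorem raw_kind_of_le {v : ℕ} (hv : C.order ≤ v) : C.raw.kind v = 0 := by
  simp [raw, RawCircuit.kind, List.getD_eq_getElem?_getD, hv]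

theorem raw_adj (u v : Fin C.order) : C.raw.adj u v = C.adj u v := by
  simp [raw, RawCircuit.adj, List.getD_eq_getElem?_getD]

theorem raw_adj_lt {u v : ℕ} (h : C.raw.adj u v = true) : u < C.order ∧ v < C.order := by
  by_contra hn
  rw [not_and_or, not_lt, not_lt] at hn
  by_cases hv : v < C.order
  · have hu := hn.resolve_right (by omega)
    simp [raw, RawCircuit.adj, List.getD_eq_getElem?_getD, hv, hu] at h
  · have hv' := not_lt.1 hv
    simp [raw, RawCircuit.adj, List.getD_eq_getElem?_getD, hv'] at h

theorem raw_adj_iff {u v : ℕ} : C.raw.adj u v = true ↔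
    ∃ (hu : u < C.order) (hv : v < C.order), C.Edge ⟨u, hu⟩ ⟨v, hv⟩ := by
  constructor
  · intro h
    obtain ⟨hu, hv⟩ := C.raw_adj_lt h
    exact ⟨hu, hv, by rw [Edge, ← raw_adj]; exact h⟩
  · rintro ⟨hu, hv, h⟩
    rw [Edge, ← raw_adj] at h
    exact h

theorem raw_path_iff {ℓ u v : ℕ} (hv : v < C.order) : C.raw.Path ℓ u v ↔
    ∃ hu : u < C.order, C.PathOfLength ℓ ⟨u, hu⟩ ⟨v, hv⟩ := by
  constructor
  · intro h
    induction h with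
    | refl v => exact ⟨hv, .refl _⟩
    | step hadj _ ih =>
      obtain ⟨hu, hv', he⟩ := C.raw_adj_iff.1 hadj
      obtain ⟨_, hp⟩ := ih hv
      exact ⟨hu, .step he hp⟩
  · rintro ⟨hu, h⟩
    have : ∀ a b : Fin C.order, C.PathOfLength ℓ a b → C.raw.Path ℓ a b := by
      clear h
      intro a b h
      induction h with
      | refl => exact .refl _
      | @step _ a b _ he _ ih => exact .step (C.raw_adj_iff.2 ⟨a.2, b.2, he⟩) ih
    exact this _ _ h

theorem code_eq_zero {K : VertexKind} : K.code = 0 ↔ K = .var := by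
  cases K <;> simp [VertexKind.code]

theorem code_injective : Function.Injective VertexKind.code := by
  intro K K' h; cases K <;> cases K' <;> simp_all [VertexKind.code]

theorem indegree_eq_zero_iff (v : Fin C.order) : C.indegree v = 0 ↔ ∀ u, ¬ C.Edge u v := by
  rw [indegree, Set.ncard_eq_zero, Set.eq_empty_iff_forall_notMem]
  rfl

variable {C} in
-- Acyclicity of a finite graph is well-foundedness, and descending ends at a variable. This turns
-- the depth bound, stated for paths from variables, into one for paths from any vertex.
theorem IsPiPlus.exists_var_path {t : ℕ} (h : C.IsPiPlus t) (v : Fin C.order) :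
    ∃ x ℓ, C.IsVar x ∧ C.PathOfLength ℓ x v := by
  have hwf : WellFounded (Relation.TransGen C.Edge) := by
    have : Std.Irrefl (Relation.TransGen C.Edge) := ⟨h.acyclic⟩
    have : IsTrans _ (Relation.TransGen C.Edge) := ⟨fun _ _ _ => Relation.TransGen.trans⟩
    exact Finite.wellFounded_of_trans_of_irrefl _
  induction v using hwf.induction with
  | _ v ih =>
    by_cases hv : C.IsVar v
    · exact ⟨v, 0, hv, .refl v⟩
    · rw [h.var_iff, indegree_eq_zero_iff] at hv
      push Not at hv
      obtain ⟨u, hu⟩ := hv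
      obtain ⟨x, ℓ, hx, hp⟩ := ih u (.single hu)
      refine ⟨x, ℓ + 1, hx, ?_⟩
      have : ∀ (ℓ : ℕ) (a b c : Fin C.order), C.PathOfLength ℓ a b → C.Edge b c →
          C.PathOfLength (ℓ + 1) a c := by
        intro ℓ a b c hab hbc
        induction hab with
        | refl v => exact .step hbc (.refl _)
        | step he _ ih => exact .step he (ih hbc)
      exact this _ _ _ _ hp hu

variable {C} in
theorem IsPiPlus.isPi {t : ℕ} (h : C.IsPiPlus t) : C.raw.IsPi t := by
  have hlt : ∀ {v}, C.raw.kind v ≠ 0 → v < C.order := fun {v} hv => by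
    by_contra hn
    exact hv (C.raw_kind_of_le (not_lt.1 hn))
  have hgate : ∀ (v : ℕ) (hv : v < C.order), C.raw.kind v ≠ 0 → C.IsGate ⟨v, hv⟩ :=
    fun v hv hk hvar => hk (by
      have := C.raw_kind ⟨v, hv⟩
      rw [this, hvar]; rfl)
  have hvar : ∀ (v : ℕ) (hv : v < C.order), C.raw.kind v = 0 → C.IsVar ⟨v, hv⟩ :=
    fun v hv hk => code_eq_zero.1 (by
      have := C.raw_kind ⟨v, hv⟩
      rw [← this]; exact hk)
  refine ⟨by simp, fun hadj => by simpa using C.raw_adj_lt hadj, ?_, fun v => ?_, ?_, ?_, ?_, ?_,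
    ?_, ?_, ?_, ?_⟩
  · rw [raw_out, raw_kind, h.out_and]; rfl
  · by_cases hv : v < C.order
    · rw [show v = ((⟨v, hv⟩ : Fin C.order) : ℕ) from rfl, raw_kind]
      cases C.kind ⟨v, hv⟩ <;> simp [VertexKind.code]
    · rw [C.raw_kind_of_le (not_lt.1 hv)]; omega
  · exact C.raw_kind_of_le (by simp)
  · intro u v hadj hk
    obtain ⟨hu, hv, he⟩ := C.raw_adj_iff.1 hadj
    exact (C.indegree_eq_zero_iff _).1 ((h.var_iff _).1 (hvar v hv hk)) _ he
  · intro v hk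
    have hv := hlt hk
    have := mt (h.var_iff ⟨v, hv⟩).2 (hgate v hv hk)
    rw [indegree_eq_zero_iff] at this
    push Not at this
    obtain ⟨u, hu⟩ := this
    exact ⟨u, C.raw_adj_iff.2 ⟨u.2, hv, hu⟩⟩
  · intro v hadj
    obtain ⟨hu, hv, he⟩ := C.raw_adj_iff.1 hadj
    have := h.out_outdegree
    rw [outdegree, Set.ncard_eq_zero, Set.eq_empty_iff_forall_notMem] at this
    exact this _ he
  · intro v w w' hk hw hw'
    obtain ⟨hv, hw₁, he⟩ := C.raw_adj_iff.1 hw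
    obtain ⟨_, hw₂, he'⟩ := C.raw_adj_iff.1 hw'
    have := h.gate_outdegree ⟨v, hv⟩ (hgate v hv hk)
    rw [outdegree, Set.ncard_le_one] at this
    have := this _ he _ he'
    simpa using this
  · intro u v hk hadj heq
    obtain ⟨hu, hv, he⟩ := C.raw_adj_iff.1 hadj
    refine h.alternating _ _ (hgate u hu hk) he (code_injective ?_)
    have h1 := C.raw_kind ⟨u, hu⟩
    have h2 := C.raw_kind ⟨v, hv⟩
    rw [← h1, ← h2]
    exact heq
  · intro x ℓ hk hp
    obtain ⟨hx, hp⟩ := (C.raw_path_iff C.out.2).1 hp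
    exact h.depth_le _ _ (hvar x hx hk) hp
  · intro v hv
    rw [raw_ord] at hv
    obtain ⟨x, ℓ, hx, hp⟩ := h.exists_var_path ⟨v, hv⟩
    refine ⟨x, ℓ, by simp, ?_, (C.raw_path_iff hv).2 ⟨x.2, hp⟩⟩
    rw [raw_kind, hx]; rfl

theorem sat_raw_iff (τ : Finset (Fin C.order)) (v : Fin C.order) :
    C.raw.Sat {n | ∃ h : n < C.order, ⟨n, h⟩ ∈ τ} v ↔ C.Satisfies τ v := by
  constructor
  · have : ∀ n, C.raw.Sat {n | ∃ h : n < C.order, ⟨n, h⟩ ∈ τ} n →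
        ∀ hn : n < C.order, C.Satisfies τ ⟨n, hn⟩ := by
      intro n h
      induction h with
      | @var n hk hv =>
        intro hn
        have := C.raw_kind ⟨n, hn⟩
        rw [show ((⟨n, hn⟩ : Fin C.order) : ℕ) = n from rfl, hk] at this
        obtain ⟨_, hv⟩ := hv
        exact .var (code_injective this.symm) hv
      | @and n hk _ ih =>
        intro hn
        have := C.raw_kind ⟨n, hn⟩
        rw [show ((⟨n, hn⟩ : Fin C.order) : ℕ) = n from rfl, hk] at this
        exact .and (code_injective this.symm) fun u hu => ih u (C.raw_adj_iff.2 ⟨u.2, hn, hu⟩) u.2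
      | @or u n hk hadj _ ih =>
        intro hn
        have := C.raw_kind ⟨n, hn⟩
        rw [show ((⟨n, hn⟩ : Fin C.order) : ℕ) = n from rfl, hk] at this
        obtain ⟨hu, _, he⟩ := C.raw_adj_iff.1 hadj
        exact .or (code_injective this.symm) he (ih hu)
    exact fun h => this _ h v.2
  · intro h
    induction h with
    | @var v hk hv => exact .var (by rw [raw_kind, hk]; rfl) ⟨v.2, hv⟩
    | @and v hk _ ih =>
      refine .and (by rw [raw_kind, hk]; rfl) fun u hu => ?_
      obtain ⟨hu', _, he⟩ := C.raw_adj_iff.1 hu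
      exact ih _ he
    | @or u v hk he _ ih =>
      exact .or (by rw [raw_kind, hk]; rfl) (C.raw_adj_iff.2 ⟨u.2, v.2, he⟩) ih

theorem Satisfies.mono {C : MonotoneCircuit} {τ τ' : Finset (Fin C.order)} (h : τ ⊆ τ')
    {v : Fin C.order} (hv : C.Satisfies τ v) : C.Satisfies τ' v := by
  induction hv with
  | var hk hv => exact .var hk (h hv)
  | and hk _ ih => exact .and hk ih
  | or hk hadj _ ih => exact .or hk hadj ih

/-- It suffices to find a satisfying assignment of smaller weight. -/
theorem hasWeightedSat_of_card_le {C : MonotoneCircuit} {k : ℕ} (hk : k ≤ C.numVars)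
    {τ : Finset (Fin C.order)} (hτ : ∀ v ∈ τ, C.IsVar v) (hcard : τ.card ≤ k)
    (hsat : C.Satisfies τ C.out) : C.HasWeightedSat k := by
  classical
  have h1 : τ ⊆ Finset.univ.filter fun v => C.IsVar v := fun v hv => by simpa using hτ v hv
  have h2 : k ≤ (Finset.univ.filter fun v => C.IsVar v).card := by
    rwa [numVars, Set.ncard_eq_toFinset_card', Set.toFinset_ofPred] at hk
  obtain ⟨τ', hτ', hsub, hcard'⟩ := Finset.exists_subsuperset_card_eq h1 hcard h2
  exact ⟨τ', fun v hv => by simpa using hsub hv, hcard', hsat.mono hτ'⟩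

theorem numVars_eq : C.numVars =
    (C.raw.verts.filter fun v => decide (C.raw.kind v = 0)).length := by
  classical
  rw [numVars, Set.ncard_eq_toFinset_card']
  have hnd : (C.raw.verts.filter fun v => decide (C.raw.kind v = 0)).Nodup :=
    List.Nodup.filter _ List.nodup_range
  rw [← List.toFinset_card_of_nodup hnd]
  refine Finset.card_bij (fun v _ => (v : ℕ)) ?_ ?_ ?_
  · intro v hv
    have hv' : C.kind v = .var := by
      change C.IsVar v
      simpa using hv
    simp [RawCircuit.verts, raw_kind, hv', VertexKind.code]
  · intro a _ b _ h
    exact Fin.ext h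
  · intro b hb
    simp only [List.mem_toFinset, List.mem_filter, RawCircuit.verts, List.mem_range, raw_ord,
      decide_eq_true_eq] at hb
    refine ⟨⟨b, hb.1⟩, ?_, rfl⟩
    have := C.raw_kind ⟨b, hb.1⟩
    simp only [Set.mem_toFinset, Set.mem_ofPred_eq]
    exact code_eq_zero.1 (by rw [← this]; exact hb.2)

/-- Satisfiability in terms of the raw circuit. -/
theorem hasWeightedSat_iff (k : ℕ) : C.HasWeightedSat k ↔
    k ≤ (C.raw.verts.filter fun v => decide (C.raw.kind v = 0)).length ∧
      ∃ τ : Finset ℕ, (∀ x ∈ τ, x < C.raw.ord ∧ C.raw.kind x = 0) ∧ τ.card ≤ k ∧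
        C.raw.Sat (τ : Set ℕ) C.raw.out := by
  classical
  rw [← numVars_eq]
  constructor
  · rintro ⟨τ, hτ, hcard, hsat⟩
    refine ⟨?_, τ.image (fun v : Fin C.order => (v : ℕ)), ?_, ?_, ?_⟩
    · rw [← hcard, numVars, Set.ncard_eq_toFinset_card']
      exact Finset.card_le_card fun v hv => by simpa using hτ v hv
    · intro x hx
      obtain ⟨v, hv, rfl⟩ := Finset.mem_image.1 hx
      refine ⟨by simp, ?_⟩
      rw [raw_kind, hτ v hv]; rfl
    · exact Finset.card_image_le.trans hcard.le
    · refine ((C.sat_raw_iff τ C.out).2 hsat).mono ?_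
      rintro n ⟨hn, hmem⟩
      exact Finset.mem_coe.2 (Finset.mem_image.2 ⟨_, hmem, rfl⟩)
  · rintro ⟨hk, τ, hτ, hcard, hsat⟩
    refine hasWeightedSat_of_card_le hk (τ := Finset.univ.filter fun v => (v : ℕ) ∈ τ) ?_ ?_ ?_
    · intro v hv
      have hv' : (v : ℕ) ∈ τ := by simpa using hv
      have := (hτ v hv').2
      rw [raw_kind] at this
      exact code_eq_zero.1 this
    · refine (Finset.card_le_card_of_injOn (fun v : Fin C.order => (v : ℕ)) ?_
        fun a _ b _ h => Fin.ext h).trans hcard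
      intro v hv
      simpa using hv
    · rw [← sat_raw_iff]
      refine hsat.mono fun n hn => ?_
      have h1 := (hτ n hn).1
      rw [raw_ord] at h1
      exact ⟨h1, by simpa using hn⟩

end MonotoneCircuit

namespace RawCircuit

variable {t : ℕ} {c : RawCircuit} {X T : List ℕ}

/-! ### Evaluation -/

theorem mem_verts {v : ℕ} : v ∈ c.verts ↔ v < c.ord := List.mem_range

theorem IsPi.lt_of_kind (h : c.IsPi t) {v : ℕ} (hv : c.kind v ≠ 0) : v < c.ord := by
  obtain ⟨u, hu⟩ := h.exists_adj hv
  exact (h.adj_lt hu).2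

theorem IsPi.path_lt (h : c.IsPi t) {v j : ℕ} (hp : c.Path j v c.out) : v < c.ord := by
  generalize hw : c.out = w at hp
  cases hp with
  | refl => exact hw ▸ h.out_lt
  | step hadj _ => exact (h.adj_lt hadj).1

theorem IsPi.path_le (h : c.IsPi t) {v j : ℕ} (hp : c.Path j v c.out) : j ≤ t := by
  obtain ⟨x, ℓ, -, hx, hxv⟩ := h.exists_var_path v (h.path_lt hp)
  have := h.depth_le hx (hxv.trans hp)
  omega

theorem IsPi.path_lt_of_gate (h : c.IsPi t) {v j : ℕ} (hv : c.kind v ≠ 0)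
    (hp : c.Path j v c.out) : j + 1 ≤ t := by
  obtain ⟨u, hu⟩ := h.exists_adj hv
  exact h.path_le (.step hu hp)

theorem mem_evalStep {S : List ℕ} {v : ℕ} : v ∈ c.evalStep X S ↔ v < c.ord ∧
    ((c.kind v = 0 ∧ v ∈ X) ∨ (c.kind v = 1 ∧ ∀ u < c.ord, c.adj u v = true → u ∈ S) ∨
      (c.kind v = 2 ∧ ∃ u < c.ord, c.adj u v = true ∧ u ∈ S)) := by
  simp only [evalStep, List.mem_filter, mem_verts, Bool.or_eq_true, Bool.and_eq_true,
    decide_eq_true_eq, List.all_eq_true, List.any_eq_true, Bool.not_eq_true', or_assoc]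
  refine and_congr_right fun _ => or_congr_right (or_congr_left (and_congr_right fun _ =>
    forall_congr' fun u => forall_congr' fun _ => ?_))
  cases c.adj u v <;> simp

/-- `T` is the set of the vertices that are true under `X`, as far as they matter. -/
structure IsTrue (c : RawCircuit) (X T : List ℕ) : Prop where
  sound : ∀ v ∈ T, c.Sat {x | x ∈ X} v
  complete : ∀ {v j}, c.Sat {x | x ∈ X} v → c.Path j v c.out → v ∈ T

/-- A vertex at distance `j` from the output has height at most `t - j`, so its value is settled
after `t + 1 - j` rounds. -/
theorem IsPi.isTrue_trueList (h : c.IsPi t) (X : List ℕ) : c.IsTrue X (c.trueList t X) := by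
  constructor
  · unfold trueList
    generalize t + 1 = n
    induction n with
    | zero => simp
    | succ n ih =>
      intro v hv
      rw [Function.iterate_succ_apply'] at hv
      obtain ⟨hlt, ⟨hk, hv⟩ | ⟨hk, hv⟩ | ⟨hk, u, hu, hadj, hv⟩⟩ := mem_evalStep.1 hv
      · exact .var hk hv
      · exact .and hk fun u hu => ih u (hv u (h.adj_lt hu).1 hu)
      · exact .or hk hadj (ih u hv)
  · intro v j hv hp
    have key : ∀ v, c.Sat {x | x ∈ X} v → ∀ j, c.Path j v c.out → ∀ i, t + 1 ≤ i + j →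
        v ∈ (c.evalStep X)^[i] [] := by
      intro v hv
      induction hv with
      | @var v hk hv =>
        intro j hp i hi
        obtain ⟨i, rfl⟩ : ∃ i', i = i' + 1 := ⟨i - 1, by have := h.path_le hp; omega⟩
        rw [Function.iterate_succ_apply']
        exact mem_evalStep.2 ⟨h.path_lt hp, .inl ⟨hk, hv⟩⟩
      | @and v hk _ ih =>
        intro j hp i hi
        obtain ⟨i, rfl⟩ : ∃ i', i = i' + 1 := ⟨i - 1, by have := h.path_le hp; omega⟩
        rw [Function.iterate_succ_apply']
        exact mem_evalStep.2 ⟨h.path_lt hp, .inr (.inl ⟨hk, fun u _ hu =>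
          ih u hu (j + 1) (.step hu hp) i (by omega)⟩)⟩
      | @or u v hk hadj _ ih =>
        intro j hp i hi
        obtain ⟨i, rfl⟩ : ∃ i', i = i' + 1 := ⟨i - 1, by have := h.path_le hp; omega⟩
        rw [Function.iterate_succ_apply']
        exact mem_evalStep.2 ⟨h.path_lt hp, .inr (.inr ⟨hk, u, (h.adj_lt hadj).1, hadj,
          ih (j + 1) (.step hadj hp) i (by omega)⟩)⟩
    exact key v hv j hp (t + 1) (by omega)

/-! ### Live gates -/

/-- Gates all of whose successors, apart from the output, are not in `T`. -/
inductive Live (c : RawCircuit) (T : List ℕ) : ℕ → Prop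
  | top {v : ℕ} : c.kind v ≠ 0 → v ∉ T → c.adj v c.out = true → Live c T v
  | step {v w : ℕ} : c.kind v ≠ 0 → v ∉ T → c.adj v w = true → Live c T w → Live c T v

theorem Live.kind_ne {v : ℕ} (h : c.Live T v) : c.kind v ≠ 0 := by
  cases h <;> assumption

theorem Live.not_mem {v : ℕ} (h : c.Live T v) : v ∉ T := by
  cases h <;> assumption

theorem Live.exists_path {v : ℕ} (h : c.Live T v) : ∃ j, c.Path (j + 1) v c.out := by
  induction h with
  | top _ _ hadj => exact ⟨0, .step hadj (.refl _)⟩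
  | step _ _ hadj _ ih =>
    obtain ⟨j, hj⟩ := ih
    exact ⟨j + 1, .step hadj hj⟩

theorem Live.ne_out (h : c.IsPi t) {v : ℕ} (hv : c.Live T v) : v ≠ c.out := by
  rintro rfl
  cases hv with
  | top _ _ hadj => exact h.not_adj_out _ hadj
  | step _ _ hadj _ => exact h.not_adj_out _ hadj

theorem Live.lt (h : c.IsPi t) {v : ℕ} (hv : c.Live T v) : v < c.ord := h.lt_of_kind hv.kind_ne

theorem IsPi.parent_eq (h : c.IsPi t) {v w : ℕ} (hv : c.kind v ≠ 0) (hw : c.adj v w = true) :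
    c.parent v = w := by
  unfold parent
  have hmem : w ∈ c.verts.filter fun w => c.adj v w :=
    List.mem_filter.2 ⟨mem_verts.2 (h.adj_lt hw).2, hw⟩
  match hl : c.verts.filter fun w => c.adj v w with
  | [] => rw [hl] at hmem; simp at hmem
  | a :: l =>
    have ha : a ∈ c.verts.filter fun w => c.adj v w := by rw [hl]; exact List.mem_cons_self
    exact h.parent_unique hv (List.mem_filter.1 ha).2 hw

theorem Live.not_adj_out (h : c.IsPi t) {v w : ℕ} (hw : c.Live T w) (hv : c.kind v ≠ 0)
    (hadj : c.adj v w = true) : ¬ c.adj v c.out = true := fun ho =>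
  hw.ne_out h (h.parent_unique hv hadj ho)

theorem parent_spec (v : ℕ) : c.parent v = c.ord ∨ c.adj v (c.parent v) = true := by
  unfold parent
  match hl : c.verts.filter fun w => c.adj v w with
  | [] => exact .inl rfl
  | a :: l =>
    have ha : a ∈ c.verts.filter fun w => c.adj v w := by rw [hl]; exact List.mem_cons_self
    exact .inr (List.mem_filter.1 ha).2

theorem Live.not_live_ord (h : c.IsPi t) : ¬ c.Live T c.ord := fun hl => hl.kind_ne h.kind_ord

/-- A climb ends at the output unless it meets a variable or an element of `T`. Paths to the output
have at most `t` edges and the output is a fixed point, so `t` moves suffice. -/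
theorem IsPi.live_iff (h : c.IsPi t) {v : ℕ} : c.live t T v = true ↔ c.Live T v := by
  have hout : c.climb T c.out = c.out := by simp [climb]
  have houtn : ∀ n, (c.climb T)^[n] c.out = c.out := fun n => Function.iterate_fixed hout n
  have hne : c.ord ≠ c.out := h.out_lt.ne'
  simp only [live, Bool.and_eq_true, Bool.not_eq_true', decide_eq_false_iff_not, decide_eq_true_eq]
  constructor
  · rintro ⟨hv, hcl⟩
    have key : ∀ n v, (c.climb T)^[n] v = c.out → v = c.out ∨ c.Live T v := by
      intro n
      induction n with
      | zero => intro v hv; exact .inl hv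
      | succ n ih =>
        intro v hv
        rw [Function.iterate_succ_apply] at hv
        by_cases hvo : v = c.out
        · exact .inl hvo
        right
        by_cases hk : c.kind v = 0 ∨ v ∈ T
        · have e : c.climb T v = c.ord := by
            rcases hk with hk | hk <;> simp [climb, hvo, hk]
          rcases ih _ hv with h1 | h1
          · exact absurd (e.symm.trans h1) hne
          · rw [e] at h1; exact absurd h1 (Live.not_live_ord h)
        · rw [not_or] at hk
          have e : c.climb T v = c.parent v := by simp [climb, hvo, hk]
          rw [e] at hv
          rcases parent_spec (c := c) v with hp | hp
          · rcases ih _ hv with h1 | h1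
            · exact absurd (hp.symm.trans h1) hne
            · rw [hp] at h1; exact absurd h1 (Live.not_live_ord h)
          · rcases ih _ hv with h1 | h1
            · rw [h1] at hp; exact .top hk.1 hk.2 hp
            · exact .step hk.1 hk.2 hp h1
    exact (key t v hcl).resolve_left hv
  · intro hv
    refine ⟨hv.ne_out h, ?_⟩
    have key : ∃ j, c.Path j v c.out ∧ (c.climb T)^[j] v = c.out := by
      induction hv with
      | @top v hk hT hadj =>
        refine ⟨1, .step hadj (.refl _), ?_⟩
        have hvo : v ≠ c.out := (Live.top hk hT hadj).ne_out h
        simp [climb, hvo, hk, hT, h.parent_eq hk hadj]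
      | @step v w hk hT hadj hw ih =>
        obtain ⟨j, hp, hj⟩ := ih
        refine ⟨j + 1, .step hadj hp, ?_⟩
        have hvo : v ≠ c.out := (Live.step hk hT hadj hw).ne_out h
        have e : c.climb T v = w := by simp [climb, hvo, hk, hT, h.parent_eq hk hadj]
        rw [Function.iterate_succ_apply, e, hj]
    obtain ⟨j, hp, hj⟩ := key
    have := h.path_le hp
    obtain ⟨m, rfl⟩ : ∃ m, t = m + j := ⟨t - j, by omega⟩
    rw [Function.iterate_add_apply, hj, houtn]

/-- Moving up through live gates until a gate with property `S` is met. -/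
theorem Live.iterate_spec (h : c.IsPi t) {S : ℕ → Prop} {f : ℕ → ℕ}
    (htop : ∀ v, c.Live T v → c.adj v c.out = true → S v) (hf : ∀ v, S v → f v = v)
    (hf' : ∀ v, ¬ S v → f v = c.parent v) {v : ℕ} (hv : c.Live T v) :
    c.Live T (f^[t] v) ∧ S (f^[t] v) ∧ (S v → f^[t] v = v) ∧
      ∀ w, c.adj v w = true → ¬ S v → c.Live T w ∧ f^[t] v = f^[t] w := by
  have hstay : ∀ n v, S v → f^[n] v = v := fun n v hS => Function.iterate_fixed (hf v hS) n
  -- At distance at most `n + 1` from the output, `n` moves lead at the latest to an input of the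
  -- output, where `S` holds.
  have key : ∀ n v j, c.Live T v → c.Path j v c.out → j ≤ n + 1 →
      c.Live T (f^[n] v) ∧ S (f^[n] v) := by
    intro n
    induction n with
    | zero =>
      intro v j hv hp hj
      refine ⟨hv, htop v hv ?_⟩
      generalize hw : c.out = w at hp ⊢
      cases hp with
      | refl => exact absurd hw.symm (hv.ne_out h)
      | @step ℓ _ u _ hadj hp =>
        have : ℓ = 0 := by omega
        subst this
        cases hp
        exact hadj
    | succ n ih =>
      intro v j hv hp hj
      by_cases hS : S v
      · rw [hstay _ v hS]; exact ⟨hv, hS⟩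
      · rw [Function.iterate_succ_apply, hf' v hS]
        cases hv with
        | top hk hT hadj => exact absurd (htop v (.top hk hT hadj) hadj) hS
        | @step _ w hk hT hadj hw =>
          rw [h.parent_eq hk hadj]
          generalize hwo : c.out = o at hp
          cases hp with
          | refl => exact absurd hwo.symm ((Live.step hk hT hadj hw).ne_out h)
          | @step ℓ _ u _ hadj' hp =>
            obtain rfl := h.parent_unique hk hadj hadj'
            exact ih w ℓ hw (hwo ▸ hp) (by omega)
  have main : ∀ v, c.Live T v → c.Live T (f^[t] v) ∧ S (f^[t] v) := by
    intro v hv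
    obtain ⟨j, hp⟩ := hv.exists_path
    exact key t v _ hv hp (by have := h.path_le hp; omega)
  refine ⟨(main v hv).1, (main v hv).2, hstay t v, fun w hadj hS => ?_⟩
  have hw : c.Live T w := by
    cases hv with
    | top hk hT hadj' => exact absurd (htop v (.top hk hT hadj') hadj') hS
    | step hk hT hadj' hw =>
      obtain rfl := h.parent_unique hk hadj hadj'
      exact hw
  refine ⟨hw, ?_⟩
  have e : f v = w := by rw [hf' v hS, h.parent_eq hv.kind_ne hadj]
  have : f^[t + 1] v = f^[t] v := by
    rw [Function.iterate_succ_apply', hf _ (main v hv).2]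
  rw [← this, Function.iterate_succ_apply, e]

/-! ### Roots -/

theorem Live.root_spec (h : c.IsPi t) {v : ℕ} (hv : c.Live T v) :
    c.Live T (c.root t v) ∧ c.adj (c.root t v) c.out = true ∧
      (c.adj v c.out = true → c.root t v = v) ∧
      ∀ w, c.adj v w = true → c.Live T w → c.root t v = c.root t w := by
  obtain ⟨h1, h2, h3, h4⟩ := Live.iterate_spec h (S := fun v => c.adj v c.out = true)
    (f := c.rootStep) (fun v _ hv => hv) (fun v hv => by simp [rootStep, hv])
    (fun v hv => by simp [rootStep, hv]) hv
  exact ⟨h1, h2, h3, fun w hadj hw => (h4 w hadj (hw.not_adj_out h hv.kind_ne hadj)).2⟩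

theorem mem_crit {p : ℕ} :
    p ∈ c.crit T ↔ p < c.ord ∧ c.kind p = 2 ∧ c.adj p c.out = true ∧ p ∉ T := by
  simp [crit, List.mem_filter, mem_verts, and_assoc]

theorem IsPi.kind_cases (h : c.IsPi t) {v : ℕ} (hv : c.kind v ≠ 0) :
    c.kind v = 1 ∨ c.kind v = 2 := by
  have := h.kind_le v
  omega

theorem IsPi.kind_of_adj_out (h : c.IsPi t) {v : ℕ} (hv : c.kind v ≠ 0)
    (hadj : c.adj v c.out = true) : c.kind v = 2 := by
  have h1 := h.alternating hv hadj
  rw [h.kind_out] at h1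
  exact (h.kind_cases hv).resolve_left h1

theorem Live.mem_crit (h : c.IsPi t) {v : ℕ} (hv : c.Live T v) (hadj : c.adj v c.out = true) :
    v ∈ c.crit T :=
  RawCircuit.mem_crit.2 ⟨hv.lt h, h.kind_of_adj_out hv.kind_ne hadj, hadj, hv.not_mem⟩

theorem live_of_mem_crit {p : ℕ} (hp : p ∈ c.crit T) : c.Live T p := by
  obtain ⟨-, hk, hadj, hT⟩ := mem_crit.1 hp
  exact .top (by omega) hT hadj

theorem Live.root_mem_crit (h : c.IsPi t) {v : ℕ} (hv : c.Live T v) : c.root t v ∈ c.crit T :=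
  have := hv.root_spec h
  this.1.mem_crit h this.2.1

theorem IsPi.feeds_iff (h : c.IsPi t) {x p : ℕ} : c.feeds t T x p = true ↔
    ∃ q, c.Live T q ∧ c.root t q = p ∧ c.adj x q = true := by
  simp only [feeds, List.any_eq_true, Bool.and_eq_true, decide_eq_true_eq, h.live_iff, mem_verts]
  constructor
  · rintro ⟨q, -, ⟨h1, h2⟩, h3⟩; exact ⟨q, h1, h2, h3⟩
  · rintro ⟨q, h1, h2, h3⟩; exact ⟨q, h1.lt h, ⟨h1, h2⟩, h3⟩

/-! ### Merged gates -/

theorem single_spec (h : c.IsPi t) {w : ℕ} (hw : c.single T w = true) :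
    c.kind w = 1 ∧ ∃ u, c.adj u w = true ∧ u ∉ T ∧
      ∀ u', c.adj u' w = true → u' ∉ T → u' = u := by
  simp only [single, Bool.and_eq_true, decide_eq_true_eq] at hw
  obtain ⟨hk, hlen⟩ := hw
  obtain ⟨u, hu⟩ := List.length_eq_one_iff.1 hlen
  have hmem : ∀ u', u' ∈ c.verts.filter (fun u => c.adj u w && !decide (u ∈ T)) ↔
      c.adj u' w = true ∧ u' ∉ T := by
    intro u'
    simp only [List.mem_filter, mem_verts, Bool.and_eq_true, Bool.not_eq_true',
      decide_eq_false_iff_not]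
    exact ⟨fun h => h.2, fun h' => ⟨(h.adj_lt h'.1).1, h'⟩⟩
  rw [hu] at hmem
  have := (hmem u).1 (by simp)
  exact ⟨hk, u, this.1, this.2, fun u' h1 h2 => by simpa using (hmem u').2 ⟨h1, h2⟩⟩

theorem exists_two_of_not_single (h : c.IsPi t) {w u : ℕ} (hk : c.kind w = 1)
    (hw : ¬ c.single T w = true) (hu : c.adj u w = true) (huT : u ∉ T) :
    ∃ u', u' ≠ u ∧ c.adj u' w = true ∧ u' ∉ T := by
  by_contra hn
  push Not at hn
  apply hw
  simp only [single, hk, decide_true, Bool.true_and, decide_eq_true_eq]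
  have hmem : ∀ u', u' ∈ c.verts.filter (fun u => c.adj u w && !decide (u ∈ T)) ↔ u' = u := by
    intro u'
    simp only [List.mem_filter, mem_verts, Bool.and_eq_true, Bool.not_eq_true',
      decide_eq_false_iff_not]
    constructor
    · rintro ⟨-, h1, h2⟩
      by_contra hne
      exact h2 (hn u' hne h1)
    · rintro rfl
      exact ⟨(h.adj_lt hu).1, hu, huT⟩
  have hnd : (c.verts.filter fun u => c.adj u w && !decide (u ∈ T)).Nodup :=
    List.Nodup.filter _ List.nodup_range
  rw [← List.toFinset_card_of_nodup hnd, Finset.card_eq_one]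
  exact ⟨u, Finset.ext fun w => by simpa using hmem w⟩

/-- The two reasons for merging a gate with its parent. -/
theorem IsPi.absorbed_iff (h : c.IsPi t) {v w : ℕ} (hv : c.Live T v) (hw : c.Live T w)
    (hadj : c.adj v w = true) : c.absorbed T v = true ↔ c.single T v = true ∨ c.single T w = true := by
  have h1 := hw.not_adj_out h hv.kind_ne hadj
  rw [Bool.not_eq_true] at h1
  simp [absorbed, h1, h.parent_eq hv.kind_ne hadj]

theorem IsPi.not_absorbed_of_adj_out (h : c.IsPi t) {v : ℕ} (hv : c.Live T v)
    (hadj : c.adj v c.out = true) : ¬ c.absorbed T v = true := by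
  have hk := h.kind_of_adj_out hv.kind_ne hadj
  simp [absorbed, single, hk, hadj]

theorem Live.rep_spec (h : c.IsPi t) {v : ℕ} (hv : c.Live T v) :
    c.Live T (c.rep t T v) ∧ ¬ c.absorbed T (c.rep t T v) = true ∧
      (¬ c.absorbed T v = true → c.rep t T v = v) ∧
      ∀ w, c.adj v w = true → c.absorbed T v = true →
        c.Live T w ∧ c.rep t T v = c.rep t T w := by
  obtain ⟨h1, h2, h3, h4⟩ := Live.iterate_spec h (S := fun v => ¬ c.absorbed T v = true)
    (f := c.repStep T) (fun v hv hadj => h.not_absorbed_of_adj_out hv hadj)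
    (fun v hv => by simp [repStep, hv])
    (fun v hv => by simp [repStep, not_not.1 hv]) hv
  exact ⟨h1, h2, h3, fun w hadj hab => h4 w hadj (not_not.2 hab)⟩

theorem IsPi.kept_iff (h : c.IsPi t) {q : ℕ} :
    c.kept t T q = true ↔ c.Live T q ∧ ¬ c.absorbed T q = true := by
  simp [kept, h.live_iff]

theorem Live.kept_rep (h : c.IsPi t) {v : ℕ} (hv : c.Live T v) :
    c.kept t T (c.rep t T v) = true :=
  h.kept_iff.2 ⟨(hv.rep_spec h).1, (hv.rep_spec h).2.1⟩

theorem IsPi.rep_eq_self (h : c.IsPi t) {q : ℕ} (hq : c.kept t T q = true) : c.rep t T q = q :=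
  have hq' := h.kept_iff.1 hq
  (hq'.1.rep_spec h).2.2.1 hq'.2

/-- Induction along the chain from a live gate to the gate with which it is merged. -/
theorem Live.rep_induction (h : c.IsPi t) {P : ℕ → Prop} {v : ℕ} (hv : c.Live T v)
    (h0 : P v) (hstep : ∀ u w, c.Live T u → c.Live T w → c.adj u w = true →
      c.absorbed T u = true → c.rep t T u = c.rep t T w → P u → P w) : P (c.rep t T v) := by
  induction hv with
  | @top v hk hT hadj =>
    have hv : c.Live T v := .top hk hT hadj
    rwa [(hv.rep_spec h).2.2.1 (h.not_absorbed_of_adj_out hv hadj)]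
  | @step v w hk hT hadj hw ih =>
    have hv : c.Live T v := .step hk hT hadj hw
    by_cases hab : c.absorbed T v = true
    · have e := ((hv.rep_spec h).2.2.2 w hadj hab).2
      rw [e]
      exact ih (hstep v w hv hw hadj hab e h0)
    · rwa [(hv.rep_spec h).2.2.1 hab]

theorem Live.root_rep (h : c.IsPi t) {v : ℕ} (hv : c.Live T v) :
    c.root t (c.rep t T v) = c.root t v := by
  refine hv.rep_induction h (P := fun w => c.root t w = c.root t v) rfl ?_
  intro u w hu hw hadj _ _ hP
  rw [← hP, (hu.root_spec h).2.2.2 w hadj hw]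

/-- Merged or-gates and absorbed gates end up in or-gates. -/
theorem Live.kind_rep (h : c.IsPi t) {v : ℕ} (hv : c.Live T v)
    (hk : c.kind v = 2 ∨ c.absorbed T v = true) : c.kind (c.rep t T v) = 2 := by
  have : c.kind (c.rep t T v) = 2 ∨ c.absorbed T (c.rep t T v) = true := by
    refine hv.rep_induction h (P := fun w => c.kind w = 2 ∨ c.absorbed T w = true) hk ?_
    intro u w hu hw hadj hab _ _
    rcases (h.absorbed_iff hu hw hadj).1 hab with h1 | h1
    · left
      have h2 := h.alternating hu.kind_ne hadj
      rw [(single_spec h h1).1] at h2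
      exact (h.kind_cases hw.kind_ne).resolve_left (Ne.symm h2)
    · right
      simp [absorbed, h1]
  exact this.resolve_right (hv.rep_spec h).2.1

theorem IsPi.merged_iff (h : c.IsPi t) {a b : ℕ} : c.merged t T a b = true ↔
    ∃ q, c.Live T q ∧ c.rep t T q = b ∧ c.adj a q = true := by
  simp only [merged, List.any_eq_true, Bool.and_eq_true, decide_eq_true_eq, h.live_iff, mem_verts]
  constructor
  · rintro ⟨q, -, ⟨h1, h2⟩, h3⟩; exact ⟨q, h1, h2, h3⟩
  · rintro ⟨q, h1, h2, h3⟩; exact ⟨q, h1.lt h, ⟨h1, h2⟩, h3⟩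

/-- The parent of a kept gate is an or-gate or kept. -/
theorem IsPi.parent_of_kept (h : c.IsPi t) {a q : ℕ} (ha : c.kept t T a = true)
    (hq : c.Live T q) (hadj : c.adj a q = true) :
    c.kind q = 2 ∨ (c.kind q = 1 ∧ c.kept t T q = true) := by
  obtain ⟨hal, hab⟩ := h.kept_iff.1 ha
  rcases h.kind_cases hq.kind_ne with hk | hk
  · right
    refine ⟨hk, h.kept_iff.2 ⟨hq, fun hqab => ?_⟩⟩
    cases hq with
    | top hk' hT hadj' => exact h.not_absorbed_of_adj_out (.top hk' hT hadj') hadj' hqab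
    | @step _ w hk' hT hadj' hw =>
      rcases (h.absorbed_iff (.step hk' hT hadj' hw) hw hadj').1 hqab with h1 | h1
      · exact hab ((h.absorbed_iff hal (.step hk' hT hadj' hw) hadj).2 (.inr h1))
      · have := h.alternating hk' hadj'
        rw [hk, (single_spec h h1).1] at this
        exact this rfl
  · exact .inl hk

/-- Merging happens across and-gates that act as the identity, and the merged gate is an or-gate
which kept gates enter at or-gates only. An and-gate that is itself kept absorbs nothing. -/
theorem IsPi.kind_ne_of_merged (h : c.IsPi t) {a b : ℕ} (ha : c.kept t T a = true)
    (hm : c.merged t T a b = true) : c.kind a ≠ c.kind b := by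
  obtain ⟨q, hq, rfl, hadj⟩ := h.merged_iff.1 hm
  have h1 := h.alternating (h.kept_iff.1 ha).1.kind_ne hadj
  rcases h.parent_of_kept ha hq hadj with hk | ⟨hk, hkept⟩
  · rw [hq.kind_rep h (.inl hk), ← hk]; exact h1
  · rw [h.rep_eq_self hkept]; exact h1

/-! ### Levels -/

open Classical in
/-- The distance to the output. -/
noncomputable def lev (c : RawCircuit) (v : ℕ) : ℕ :=
  if h : ∃ j, c.Path j v c.out then Nat.find h else 0

theorem path_lev {v j : ℕ} (hp : c.Path j v c.out) : c.Path (c.lev v) v c.out := by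
  classical
  have hex : ∃ j, c.Path j v c.out := ⟨j, hp⟩
  rw [lev, dif_pos hex]
  exact Nat.find_spec hex

theorem Live.path_lev {v : ℕ} (hv : c.Live T v) : c.Path (c.lev v) v c.out :=
  hv.exists_path.elim fun _ hp => RawCircuit.path_lev hp

theorem Live.lev_pos (h : c.IsPi t) {v : ℕ} (hv : c.Live T v) : 1 ≤ c.lev v := by
  have hp := hv.path_lev
  by_contra hn
  have h0 : c.lev v = 0 := by omega
  rw [h0] at hp
  generalize hw : c.out = w at hp
  cases hp
  exact hv.ne_out h hw.symm

theorem Live.lev_lt (h : c.IsPi t) {v : ℕ} (hv : c.Live T v) : c.lev v + 1 ≤ t :=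
  h.path_lt_of_gate hv.kind_ne hv.path_lev

theorem Live.lev_step (h : c.IsPi t) {v w : ℕ} (hv : c.kind v ≠ 0) (hw : c.Live T w)
    (hadj : c.adj v w = true) : c.lev w + 1 ≤ c.lev v := by
  classical
  have hp := RawCircuit.path_lev (Path.step hadj hw.path_lev)
  have hne : v ≠ c.out := by rintro rfl; exact h.not_adj_out _ hadj
  generalize hl : c.lev v = l at hp ⊢
  generalize ho : c.out = o at hp
  cases hp with
  | refl => exact absurd ho.symm hne
  | @step ℓ _ u _ hadj' hp =>
    obtain rfl := h.parent_unique hv hadj hadj'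
    subst ho
    have hex : ∃ j, c.Path j w c.out := ⟨_, hp⟩
    have : c.lev w ≤ ℓ := by
      rw [lev, dif_pos hex]
      exact Nat.find_min' hex hp
    omega

theorem Live.lev_rep_le (h : c.IsPi t) {v : ℕ} (hv : c.Live T v) :
    c.lev (c.rep t T v) ≤ c.lev v := by
  refine hv.rep_induction h (P := fun w => c.lev w ≤ c.lev v) le_rfl ?_
  intro u w hu hw hadj _ _ hP
  have := hw.lev_step h hu.kind_ne hadj
  omega

theorem IsPi.lev_of_merged (h : c.IsPi t) {a b : ℕ} (ha : c.kind a ≠ 0)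
    (hm : c.merged t T a b = true) : c.lev b + 1 ≤ c.lev a := by
  obtain ⟨q, hq, rfl, hadj⟩ := h.merged_iff.1 hm
  have h1 := hq.lev_step h ha hadj
  have h2 := hq.lev_rep_le h
  omega

/-! ### Inputs of live gates -/

theorem Live.input_not_mem (hT : c.IsTrue X T) {v u : ℕ} (hv : c.Live T v) (hk : c.kind v = 2)
    (hadj : c.adj u v = true) : u ∉ T := fun hu =>
  hv.not_mem (hT.complete (.or hk hadj (hT.sound u hu)) hv.path_lev)

theorem Live.exists_input (h : c.IsPi t) (hT : c.IsTrue X T) {v : ℕ} (hv : c.Live T v) :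
    ∃ u, c.adj u v = true ∧ u ∉ T := by
  rcases h.kind_cases hv.kind_ne with hk | hk
  · by_contra hn
    push Not at hn
    exact hv.not_mem (hT.complete (.and hk fun u hu => hT.sound u (hn u hu)) hv.path_lev)
  · obtain ⟨u, hu⟩ := h.exists_adj hv.kind_ne
    exact ⟨u, hu, hv.input_not_mem hT hk hu⟩

theorem IsTrue.mem_of_var (hT : c.IsTrue X T) {x q : ℕ} (hk : c.kind x = 0) (hx : x ∈ X)
    (hq : c.Live T q) (hadj : c.adj x q = true) : x ∈ T :=
  hT.complete (.var hk hx) (.step hadj hq.path_lev)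

/-- If `τ` makes an input of an absorbed gate or an or-gate true, it makes the merged gate true. -/
theorem Live.sat_rep_of_input (h : c.IsPi t) (hT : c.IsTrue X T) {τ : Set ℕ}
    (hX : {x | x ∈ X} ⊆ τ) {q a : ℕ} (hq : c.Live T q)
    (hq' : c.kind q = 2 ∨ c.absorbed T q = true) (hadj : c.adj a q = true) (haT : a ∉ T)
    (ha : c.Sat τ a) : c.Sat τ (c.rep t T q) := by
  -- All inputs of `w` but one lie in `T`, so `w` passes on the value of that input.
  have hsingle : ∀ w a, c.single T w = true → c.adj a w = true → a ∉ T → c.Sat τ a →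
      c.Sat τ w := by
    intro w a hw hadj haT ha
    obtain ⟨hk, u, -, -, huniq⟩ := single_spec h hw
    refine .and hk fun u' hu' => ?_
    by_cases hu'T : u' ∈ T
    · exact (hT.sound u' hu'T).mono hX
    · rw [huniq u' hu' hu'T, ← huniq a hadj haT]
      exact ha
  have h0 : c.Sat τ q := by
    by_cases hk : c.kind q = 2
    · exact .or hk hadj ha
    · have hab := hq'.resolve_left hk
      cases hq with
      | top hk' hqT hadj' => exact absurd hab (h.not_absorbed_of_adj_out (.top hk' hqT hadj') hadj')
      | @step _ w hk' hqT hadj' hw =>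
        rcases (h.absorbed_iff (.step hk' hqT hadj' hw) hw hadj').1 hab with h1 | h1
        · exact hsingle q a h1 hadj haT ha
        · have h2 := h.alternating hk' hadj'
          rw [(single_spec h h1).1] at h2
          exact absurd ((h.kind_cases hk').resolve_left h2) hk
  refine hq.rep_induction h (P := fun w => c.Sat τ w) h0 ?_
  intro u w hu hw hadj hab _ hP
  rcases (h.absorbed_iff hu hw hadj).1 hab with h1 | h1
  · have h2 := h.alternating hu.kind_ne hadj
    rw [(single_spec h h1).1] at h2
    exact .or ((h.kind_cases hw.kind_ne).resolve_left (Ne.symm h2)) hadj hP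
  · exact hsingle w u h1 hadj hu.not_mem hP

end RawCircuit

namespace RawCircuit

variable {t r : ℕ} {c : RawCircuit} {X T : List ℕ} {d e e' : ℕ × ℕ × ℕ}

/-! ### Vertices and edges of the residual circuit -/

/-- The vertices of the residual circuit. -/
inductive ResVert (t : ℕ) (c : RawCircuit) (T : List ℕ) (r : ℕ) : ℕ × ℕ × ℕ → Prop
  | out : ResVert t c T r (0, 0, 0)
  | gate {q : ℕ} : c.kept t T q = true → ResVert t c T r (1, q, 0)
  | var {x : ℕ} : c.low t T r x = true → ResVert t c T r (2, x, 0)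
  | aux {q : ℕ} : c.kept t T q = true → c.needsAnd t T q = true → ResVert t c T r (3, q, 0)
  | pad {q i : ℕ} : c.kept t T q = true → c.padded t T r q = true → i < r + 2 →
      ResVert t c T r (4, q, i)

/-- The edges of the residual circuit. -/
inductive ResEdge (t : ℕ) (c : RawCircuit) (T : List ℕ) (r : ℕ) : ℕ × ℕ × ℕ → ℕ × ℕ × ℕ → Prop
  | out {p : ℕ} : c.kept t T p = true → c.adj p c.out = true → ResEdge t c T r (1, p, 0) (0, 0, 0)
  | gate {a b : ℕ} : c.kept t T a = true → c.kept t T b = true → c.merged t T a b = true →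
      ResEdge t c T r (1, a, 0) (1, b, 0)
  | var {x b : ℕ} : c.low t T r x = true → c.kept t T b = true → c.merged t T x b = true →
      ResEdge t c T r (2, x, 0) (1, b, 0)
  | aux {q : ℕ} : c.kept t T q = true → c.needsAnd t T q = true →
      ResEdge t c T r (3, q, 0) (1, q, 0)
  | pad {q i : ℕ} : c.kept t T q = true → c.padded t T r q = true → ¬ c.needsAnd t T q = true →
      i < r + 2 → ResEdge t c T r (4, q, i) (1, q, 0)
  | padAux {q i : ℕ} : c.kept t T q = true → c.needsAnd t T q = true → i < r + 2 →
      ResEdge t c T r (4, q, i) (3, q, 0)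

theorem padded_of_needsAnd {q : ℕ} (h : c.needsAnd t T q = true) : c.padded t T r q = true := by
  simp only [needsAnd, Bool.and_eq_true] at h
  simp [padded, h.1]

theorem IsPi.mem_resVerts (h : c.IsPi t) :
    d ∈ c.resVerts t T r ↔ ResVert t c T r d := by
  have hk : ∀ {q}, c.kept t T q = true → q < c.ord := fun hq => (h.kept_iff.1 hq).1.lt h
  have hl : ∀ {x}, c.low t T r x = true → x < c.ord := by
    intro x hx
    simp only [low, Bool.and_eq_true, List.any_eq_true] at hx
    obtain ⟨-, q, -, -, hadj⟩ := hx
    exact (h.adj_lt hadj).1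
  simp only [resVerts, List.mem_cons, List.mem_append, List.mem_map, List.mem_filter,
    List.mem_flatMap, mem_verts, Bool.and_eq_true, List.mem_range]
  constructor
  · rintro (rfl | ⟨q, ⟨-, hq⟩, rfl⟩ | ⟨q, ⟨-, hq⟩, rfl⟩ | ⟨q, ⟨-, hq, hq'⟩, rfl⟩ |
      ⟨q, ⟨-, hq, hq'⟩, i, hi, rfl⟩)
    · exact .out
    · exact .gate hq
    · exact .var hq
    · exact .aux hq hq'
    · exact .pad hq hq' hi
  · rintro (_ | hq | hq | ⟨hq, hq'⟩ | ⟨hq, hq', hi⟩)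
    · exact .inl rfl
    · exact .inr (.inl ⟨_, ⟨hk hq, hq⟩, rfl⟩)
    · exact .inr (.inr (.inl ⟨_, ⟨hl hq, hq⟩, rfl⟩))
    · exact .inr (.inr (.inr (.inl ⟨_, ⟨hk hq, hq, hq'⟩, rfl⟩)))
    · exact .inr (.inr (.inr (.inr ⟨_, ⟨hk hq, hq, hq'⟩, _, hi, rfl⟩)))

theorem nodup_resVerts : (c.resVerts t T r).Nodup := by
  have hv : ∀ P : ℕ → Bool, (c.verts.filter P).Nodup := fun P => List.Nodup.filter _ List.nodup_range
  have hm : ∀ (P : ℕ → Bool) (a : ℕ), ((c.verts.filter P).map fun q => (a, q, 0)).Nodup :=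
    fun P a => (hv P).map fun x y hxy => by simpa using hxy
  unfold resVerts
  rw [List.nodup_cons]
  refine ⟨by simp, List.Nodup.append (hm _ 1) (List.Nodup.append (hm _ 2) (List.Nodup.append
    (hm _ 3) ?_ ?_) ?_) ?_⟩
  · rw [List.nodup_flatMap]
    refine ⟨fun q _ => List.nodup_range.map fun x y hxy => by simpa using hxy, ?_⟩
    refine List.Pairwise.imp ?_ (hv _)
    intro a b hab d hd hd'
    simp only [List.mem_map] at hd hd'
    obtain ⟨i, -, rfl⟩ := hd
    obtain ⟨j, -, hj⟩ := hd'
    simp only [Prod.mk.injEq, true_and] at hj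
    exact hab hj.1.symm
  all_goals
    intro d hd hd'
    simp only [List.mem_append, List.mem_map, List.mem_flatMap] at hd hd'
    obtain ⟨_, _, rfl⟩ := hd
    simp at hd'

theorem resAdj_iff (hd : ResVert t c T r d) (he : ResVert t c T r e) :
    c.resAdj t T d e = true ↔ ResEdge t c T r d e := by
  constructor
  · intro h
    cases hd <;> cases he <;> simp [resAdj] at h
    · exact .out ‹_› h
    · exact .gate ‹_› ‹_› h
    · exact .var ‹_› ‹_› h
    · subst h; exact .aux ‹_› ‹_›
    · obtain ⟨rfl, h⟩ := h; exact .pad ‹_› ‹_› (by simp [h]) ‹_›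
    · subst h; exact .padAux ‹_› ‹_› ‹_›
  · intro h
    cases h <;> simp_all [resAdj]

theorem ResEdge.fst (he : ResEdge t c T r d e) : ResVert t c T r d := by
  cases he
  · exact .gate ‹_›
  · exact .gate ‹_›
  · exact .var ‹_›
  · exact .aux ‹_› ‹_›
  · exact .pad ‹_› ‹_› ‹_›
  · exact .pad ‹_› (padded_of_needsAnd ‹_›) ‹_›

theorem ResEdge.snd (he : ResEdge t c T r d e) : ResVert t c T r e := by
  cases he
  · exact .out
  · exact .gate ‹_›
  · exact .gate ‹_›
  · exact .gate ‹_›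
  · exact .gate ‹_›
  · exact .aux ‹_› ‹_›

theorem IsPi.low_iff (h : c.IsPi t) {x : ℕ} : c.low t T r x = true ↔
    c.kind x = 0 ∧ x ∉ T ∧ ¬ c.isCand t T r x = true ∧ ∃ q, c.Live T q ∧ c.adj x q = true := by
  simp only [low, Bool.and_eq_true, List.any_eq_true, decide_eq_true_eq, Bool.not_eq_true',
    decide_eq_false_iff_not, h.live_iff, mem_verts, and_assoc, Bool.not_eq_true]
  refine and_congr_right fun _ => and_congr_right fun _ => and_congr_right fun _ => ?_
  constructor
  · rintro ⟨q, -, h1, h2⟩; exact ⟨q, h1, h2⟩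
  · rintro ⟨q, h1, h2⟩; exact ⟨q, h1.lt h, h1, h2⟩

theorem IsPi.hasVar_iff (h : c.IsPi t) {q : ℕ} : c.hasVar t T q = true ↔
    ∃ x, c.kind x = 0 ∧ x ∉ T ∧ c.merged t T x q = true := by
  simp only [hasVar, List.any_eq_true, Bool.and_eq_true, decide_eq_true_eq, Bool.not_eq_true',
    decide_eq_false_iff_not, mem_verts, and_assoc]
  constructor
  · rintro ⟨x, -, h1⟩; exact ⟨x, h1⟩
  · rintro ⟨x, h1⟩
    obtain ⟨q, -, -, hadj⟩ := h.merged_iff.1 h1.2.2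
    exact ⟨x, (h.adj_lt hadj).1, h1⟩

theorem IsPi.hasCand_iff (h : c.IsPi t) {w : ℕ} : c.hasCand t T r w = true ↔
    ∃ x, c.isCand t T r x = true ∧ c.adj x w = true := by
  simp only [hasCand, List.any_eq_true, Bool.and_eq_true, mem_verts]
  constructor
  · rintro ⟨x, -, h1⟩; exact ⟨x, h1⟩
  · rintro ⟨x, h1⟩; exact ⟨x, (h.adj_lt h1.2).1, h1⟩

theorem needsAnd_iff {q : ℕ} : c.needsAnd t T q = true ↔
    c.kind q = 2 ∧ ¬ c.hasVar t T q = true := by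
  simp [needsAnd]

theorem isCand_iff {x : ℕ} : c.isCand t T r x = true ↔ c.kind x = 0 ∧ x ∉ T ∧
    3 ≤ c.deg t T x ∧ (c.crit T).length ≤ c.deg t T x * r := by
  simp [isCand, and_assoc]

/-- Gates merged with an and-gate are equal to it. -/
theorem Live.eq_rep_of_kind (h : c.IsPi t) {q : ℕ} (hq : c.Live T q)
    (hk : c.kind (c.rep t T q) = 1) : c.rep t T q = q := by
  refine (hq.rep_spec h).2.2.1 fun hab => ?_
  rw [hq.kind_rep h (.inr hab)] at hk
  exact absurd hk (by decide)

theorem IsPi.kept_of_input (h : c.IsPi t) {u w : ℕ} (hw : c.Live T w) (hu : c.kind u ≠ 0)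
    (huT : u ∉ T) (hadj : c.adj u w = true) (h1 : ¬ c.single T u = true)
    (h2 : ¬ c.single T w = true) : c.kept t T u = true :=
  have hul : c.Live T u := .step hu huT hadj hw
  h.kept_iff.2 ⟨hul, fun hab => ((h.absorbed_iff hul hw hadj).1 hab).elim h1 h2⟩

theorem not_single_of_kind {u : ℕ} (hk : c.kind u = 2) : ¬ c.single T u = true := by
  simp [single, hk]

theorem IsPi.not_single_of_kept (h : c.IsPi t) {q : ℕ} (hq : c.kept t T q = true) :
    ¬ c.single T q = true := by
  intro hs
  exact (h.kept_iff.1 hq).2 (by simp [absorbed, hs])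

theorem IsPi.kept_of_input_and (h : c.IsPi t) {u w : ℕ} (hw : c.kept t T w = true)
    (hk : c.kind w = 1) (hu : c.kind u ≠ 0) (huT : u ∉ T) (hadj : c.adj u w = true) :
    c.kept t T u = true := by
  have h2 := h.alternating hu hadj
  rw [hk] at h2
  exact h.kept_of_input (h.kept_iff.1 hw).1 hu huT hadj
    (not_single_of_kind ((h.kind_cases hu).resolve_left h2)) (h.not_single_of_kept hw)

/-- An or-gate without variables among its inputs has a kept and-gate as an input. -/
theorem IsPi.exists_merged (h : c.IsPi t) (hT : c.IsTrue X T) {q : ℕ} (hq : c.kept t T q = true)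
    (hn : c.needsAnd t T q = true) :
    ∃ a, c.kept t T a = true ∧ c.merged t T a q = true := by
  obtain ⟨hk, hv⟩ := needsAnd_iff.1 hn
  rw [h.hasVar_iff] at hv
  push Not at hv
  -- Descent inside the merged gate: an input of an or-gate is an and-gate; if it is absorbed, its
  -- only input outside of `T` is again an or-gate of the same merged gate. The level rises and
  -- stays below `t`, so the descent ends at a kept and-gate.
  have key : ∀ n q₀, c.Live T q₀ → c.rep t T q₀ = q → c.kind q₀ = 2 → t ≤ n + c.lev q₀ →
      ∃ a, c.kept t T a = true ∧ c.merged t T a q = true := by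
    intro n
    induction n with
    | zero =>
      intro q₀ hq₀ _ _ hn
      have := hq₀.lev_lt h
      omega
    | succ n ih =>
      intro q₀ hq₀ hr hk₀ hn
      obtain ⟨u, hu, huT⟩ := hq₀.exists_input h hT
      have huk : c.kind u ≠ 0 := fun hu0 =>
        hv u hu0 huT (h.merged_iff.2 ⟨q₀, hq₀, hr, hu⟩)
      have hul : c.Live T u := .step huk huT hu hq₀
      by_cases hab : c.absorbed T u = true
      · have hur : c.rep t T u = q := ((hul.rep_spec h).2.2.2 q₀ hu hab).2.trans hr
        have hs : c.single T u = true := ((h.absorbed_iff hul hq₀ hu).1 hab).resolve_right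
          (not_single_of_kind hk₀)
        obtain ⟨huk1, u', hu', hu'T, -⟩ := single_spec h hs
        have hu'k : c.kind u' ≠ 0 := fun hu0 =>
          hv u' hu0 hu'T (h.merged_iff.2 ⟨u, hul, hur, hu'⟩)
        have hu'l : c.Live T u' := .step hu'k hu'T hu' hul
        have hk' := h.alternating hu'k hu'
        rw [huk1] at hk'
        refine ih u' hu'l ?_ ((h.kind_cases hu'k).resolve_left hk') ?_
        · exact ((hu'l.rep_spec h).2.2.2 u hu' ((h.absorbed_iff hu'l hul hu').2 (.inr hs))).2.trans
            hur
        · have h1 := hul.lev_step h hu'k hu'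
          have h2 := hq₀.lev_step h huk hu
          omega
      · exact ⟨u, h.kept_iff.2 ⟨hul, hab⟩, h.merged_iff.2 ⟨q₀, hq₀, hr, hu⟩⟩
  exact key t q (h.kept_iff.1 hq).1 (h.rep_eq_self hq) hk (by omega)

/-! ### The structure of the residual circuit -/

/-- A rank that decreases along the edges. -/
noncomputable def resRank (t : ℕ) (c : RawCircuit) (d : ℕ × ℕ × ℕ) : ℕ :=
  if d.1 = 0 then 0 else if d.1 = 1 then c.lev d.2.1 else if d.1 = 3 then c.lev d.2.1 + 1 else t

/-- The rank serves acyclicity and depth at once: it strictly drops along edges and never exceeds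
`t`. -/
theorem ResEdge.rank_lt (h : c.IsPi t) (hT : c.IsTrue X T) (he : ResEdge t c T r d e) :
    c.resRank t e < c.resRank t d := by
  have hlev : ∀ {q}, c.kept t T q = true → 1 ≤ c.lev q ∧ c.lev q + 1 ≤ t := fun hq =>
    ⟨(h.kept_iff.1 hq).1.lev_pos h, (h.kept_iff.1 hq).1.lev_lt h⟩
  cases he with
  | out hp _ => have := hlev hp; simp [resRank]; omega
  | gate ha hb hm =>
    have := h.lev_of_merged (h.kept_iff.1 ha).1.kind_ne hm
    simp [resRank]; omega
  | var _ hb _ => have := hlev hb; simp [resRank]; omega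
  | aux hq _ => simp [resRank]
  | pad hq _ _ _ => have := hlev hq; simp [resRank]; omega
  | padAux hq hn _ =>
    -- Room for the additional and-gate: a kept gate `a` enters `q` already, so `lev q + 1 ≤ lev a <
    -- t`.
    obtain ⟨a, ha, hm⟩ := h.exists_merged hT hq hn
    have h1 := h.lev_of_merged (h.kept_iff.1 ha).1.kind_ne hm
    have h2 := hlev ha
    simp [resRank]; omega

theorem IsPi.resRank_le (h : c.IsPi t) (hd : ResVert t c T r d) :
    c.resRank t d ≤ t := by
  have hlev : ∀ {q}, c.kept t T q = true → c.lev q + 1 ≤ t := fun hq =>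
    (h.kept_iff.1 hq).1.lev_lt h
  cases hd with
  | out => simp [resRank]
  | gate hq => have := hlev hq; simp [resRank]; omega
  | var _ => simp [resRank]
  | aux hq _ => have := hlev hq; simp [resRank]; omega
  | pad _ _ _ => simp [resRank]

theorem ResEdge.snd_kind (h : c.IsPi t) (he : ResEdge t c T r d e) : c.resKind e ≠ 0 := by
  have := he.snd
  cases he <;> simp [resKind] <;> exact (h.kept_iff.1 ‹_›).1.kind_ne

/-- Only old variables can have several outgoing edges; additional variables feed a single gate. -/
theorem ResEdge.unique (h : c.IsPi t) (he : ResEdge t c T r d e) (he' : ResEdge t c T r d e')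
    (hd : d.1 ≠ 2) : e = e' := by
  have hno : ∀ {a b}, c.kept t T a = true → c.adj a c.out = true → c.merged t T a b = true →
      False := by
    intro a b ha hadj hm
    obtain ⟨q, hq, -, hadj'⟩ := h.merged_iff.1 hm
    exact hq.not_adj_out h (h.kept_iff.1 ha).1.kind_ne hadj' hadj
  cases he with
  | out hp hadj =>
    cases he' with
    | out => rfl
    | gate _ _ hm => exact (hno hp hadj hm).elim
  | gate ha hb hm =>
    cases he' with
    | out _ hadj => exact (hno ha hadj hm).elim
    | gate _ _ hm' =>
      obtain ⟨q, hq, rfl, hadj⟩ := h.merged_iff.1 hm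
      obtain ⟨q', hq', rfl, hadj'⟩ := h.merged_iff.1 hm'
      rw [h.parent_unique (h.kept_iff.1 ha).1.kind_ne hadj hadj']
  | var => exact absurd rfl hd
  | aux => cases he'; rfl
  | pad _ _ hn _ =>
    cases he' with
    | pad => rfl
    | padAux _ hn' _ => exact absurd hn' hn
  | padAux _ hn _ =>
    cases he' with
    | pad _ _ hn' _ => exact absurd hn hn'
    | padAux => rfl

theorem ResEdge.alternating (h : c.IsPi t) (he : ResEdge t c T r d e) (hd : c.resKind d ≠ 0) :
    c.resKind d ≠ c.resKind e := by
  cases he with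
  | out hp hadj =>
    have := h.kind_of_adj_out (h.kept_iff.1 hp).1.kind_ne hadj
    simp [resKind, this]
  | gate ha hb hm => simpa [resKind] using h.kind_ne_of_merged ha hm
  | aux hq hn => simp [resKind, (needsAnd_iff.1 hn).1]
  | var => simp [resKind] at hd
  | pad => simp [resKind] at hd
  | padAux => simp [resKind] at hd

theorem ResVert.exists_edge (h : c.IsPi t) (hd : ResVert t c T r d) (hne : d ≠ (0, 0, 0)) :
    ∃ e, ResEdge t c T r d e := by
  cases hd with
  | out => exact absurd rfl hne
  | gate hq =>
    have hl := (h.kept_iff.1 hq).1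
    cases hl with
    | top _ _ hadj => exact ⟨_, .out hq hadj⟩
    | step _ _ hadj hw => exact ⟨_, .gate hq (hw.kept_rep h) (h.merged_iff.2 ⟨_, hw, rfl, hadj⟩)⟩
  | var hx =>
    obtain ⟨-, -, -, q, hq, hadj⟩ := h.low_iff.1 hx
    exact ⟨_, .var hx (hq.kept_rep h) (h.merged_iff.2 ⟨_, hq, rfl, hadj⟩)⟩
  | aux hq hn => exact ⟨_, .aux hq hn⟩
  | @pad q i hq hp hi =>
    by_cases hn : c.needsAnd t T q = true
    · exact ⟨_, .padAux hq hn hi⟩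
    · exact ⟨_, .pad hq hp hn hi⟩

/-- The inputs of a kept and-gate that are not in `T`. -/
theorem IsPi.exists_edge_of_input (h : c.IsPi t) {u w : ℕ} (hw : c.kept t T w = true)
    (hk : c.kind w = 1) (hc : ¬ c.hasCand t T r w = true) (hadj : c.adj u w = true) (huT : u ∉ T) :
    (c.kind u = 0 ∧ ResEdge t c T r (2, u, 0) (1, w, 0)) ∨
      (c.kind u ≠ 0 ∧ ResEdge t c T r (1, u, 0) (1, w, 0)) := by
  have hm : c.merged t T u w = true :=
    h.merged_iff.2 ⟨w, (h.kept_iff.1 hw).1, h.rep_eq_self hw, hadj⟩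
  by_cases hu : c.kind u = 0
  · refine .inl ⟨hu, .var (h.low_iff.2 ⟨hu, huT, fun hcu => hc (h.hasCand_iff.2 ⟨u, hcu, hadj⟩), w,
      (h.kept_iff.1 hw).1, hadj⟩) hw hm⟩
  · exact .inr ⟨hu, .gate (h.kept_of_input_and hw hk hu huT hadj) hw hm⟩

/-- An or-gate without genuine variables has the additional and-gate and a kept one as inputs. Other
padded gates have the additional variables. The remaining gates are and-gates that lost no
candidate, and not being merged means that two inputs lie outside of `T`. -/
theorem ResVert.two_inputs (h : c.IsPi t) (hT : c.IsTrue X T) (hd : ResVert t c T r d)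
    (hk : c.resKind d ≠ 0) (hne : d ≠ (0, 0, 0)) :
    ∃ e e', e ≠ e' ∧ ResEdge t c T r e d ∧ ResEdge t c T r e' d := by
  cases hd with
  | out => exact absurd rfl hne
  | @gate q hq =>
    by_cases hn : c.needsAnd t T q = true
    · obtain ⟨a, ha, hm⟩ := h.exists_merged hT hq hn
      exact ⟨_, _, by simp, .aux hq hn, .gate ha hq hm⟩
    by_cases hp : c.padded t T r q = true
    · exact ⟨(4, q, 0), (4, q, 1), by simp, .pad hq hp hn (by omega), .pad hq hp hn (by omega)⟩
    · simp only [padded, Bool.or_eq_true, decide_eq_true_eq, not_or] at hp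
      have hql := (h.kept_iff.1 hq).1
      have hk1 := (h.kind_cases hql.kind_ne).resolve_right hp.1
      obtain ⟨u, hu, huT⟩ := hql.exists_input h hT
      obtain ⟨u', hne', hu', hu'T⟩ := exists_two_of_not_single h hk1 (h.not_single_of_kept hq) hu huT
      rcases h.exists_edge_of_input hq hk1 hp.2 hu huT with ⟨-, h1⟩ | ⟨-, h1⟩ <;>
      rcases h.exists_edge_of_input hq hk1 hp.2 hu' hu'T with ⟨-, h2⟩ | ⟨-, h2⟩ <;>
      exact ⟨_, _, by simp [hne'.symm], h1, h2⟩
  | var => simp [resKind] at hk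
  | @aux q hq hn =>
    exact ⟨(4, q, 0), (4, q, 1), by simp, .padAux hq hn (by omega), .padAux hq hn (by omega)⟩
  | pad => simp [resKind] at hk

/-- The critical gate above a gate of the residual circuit. -/
theorem ResEdge.root_eq (h : c.IsPi t) (he : ResEdge t c T r d e) (hd : d.1 ≠ 2)
    (he0 : e ≠ (0, 0, 0)) : c.root t d.2.1 = c.root t e.2.1 := by
  cases he with
  | out => exact absurd rfl he0
  | gate ha hb hm =>
    obtain ⟨q, hq, rfl, hadj⟩ := h.merged_iff.1 hm
    have hal := (h.kept_iff.1 ha).1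
    rw [hq.root_rep h, (hal.root_spec h).2.2.2 q hadj hq]
  | var => exact absurd rfl hd
  | aux => rfl
  | pad => rfl
  | padAux => rfl

theorem ResEdge.feeds (h : c.IsPi t) {x : ℕ} (he : ResEdge t c T r (2, x, 0) e) :
    c.feeds t T x (c.root t e.2.1) = true := by
  cases he with
  | var _ _ hm =>
    obtain ⟨q, hq, rfl, hadj⟩ := h.merged_iff.1 hm
    exact h.feeds_iff.2 ⟨q, hq, (hq.root_rep h).symm, hadj⟩

/-- With at most `2 * r` critical gates the second threshold holds for every degree from 2 on, so
degree 3 alone makes a candidate. -/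
theorem IsPi.deg_le_two (h : c.IsPi t) {x : ℕ} (hx : c.low t T r x = true)
    (hm : (c.crit T).length ≤ 2 * r) : c.deg t T x ≤ 2 := by
  obtain ⟨hk, hxT, hc, -⟩ := h.low_iff.1 hx
  by_contra hn
  apply hc
  refine isCand_iff.2 ⟨hk, hxT, by omega, hm.trans (Nat.mul_le_mul_right _ (by omega))⟩

end RawCircuit

/-! ### The residual circuit meets the structural conditions. -/

/-- The label with a given code. -/
def VertexKind.ofCode (n : ℕ) : VertexKind := if n = 0 then .var else if n = 1 then .and else .or

theorem VertexKind.code_ofCode {n : ℕ} (hn : n ≤ 2) : (VertexKind.ofCode n).code = n := by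
  interval_cases n <;> rfl

namespace RawCircuit

variable {t r : ℕ} {c : RawCircuit} {X T : List ℕ} {d e : ℕ × ℕ × ℕ}

/-- The residual circuit. -/
def residualCircuit (t : ℕ) (c : RawCircuit) (T : List ℕ) (r : ℕ) : MonotoneCircuit where
  order := (c.resVerts t T r).length
  kind i := .ofCode (c.resKind ((c.resVerts t T r).get i))
  adj i j := c.resAdj t T ((c.resVerts t T r).get i) ((c.resVerts t T r).get j)
  out := ⟨0, by simp [resVerts]⟩

theorem IsPi.resKind_le (h : c.IsPi t) (d : ℕ × ℕ × ℕ) : c.resKind d ≤ 2 := by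
  unfold resKind
  split_ifs
  · omega
  · exact h.kind_le _
  · omega
  · omega

theorem IsPi.raw_residualCircuit (h : c.IsPi t) :
    (c.residualCircuit t T r).raw = c.residual t T r := by
  have hmap : ∀ {α : Type} (f : ℕ × ℕ × ℕ → α), (List.finRange (c.resVerts t T r).length).map
      (fun i => f ((c.resVerts t T r).get i)) = (c.resVerts t T r).map f := by
    intro α f
    conv_rhs => rw [← List.map_get_finRange (c.resVerts t T r), List.map_map]
    rfl
  unfold MonotoneCircuit.raw residual residualCircuit
  refine Prod.ext rfl ?_
  dsimp only
  rw [← hmap]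
  refine List.map_congr_left fun i _ => Prod.ext (VertexKind.code_ofCode (h.resKind_le _)) ?_
  exact hmap fun d => c.resAdj t T d _

/-- The descriptor of a vertex. -/
abbrev desc (t : ℕ) (c : RawCircuit) (T : List ℕ) (r : ℕ)
    (i : Fin (c.residualCircuit t T r).order) : ℕ × ℕ × ℕ := (c.resVerts t T r).get i

theorem desc_injective : Function.Injective (c.desc t T r) :=
  List.nodup_iff_injective_get.1 nodup_resVerts

theorem IsPi.resVert_desc (h : c.IsPi t) (i) : ResVert t c T r (c.desc t T r i) :=
  h.mem_resVerts.1 (List.get_mem _ i)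

theorem ResVert.exists_desc (h : c.IsPi t) (hd : ResVert t c T r d) : ∃ i, c.desc t T r i = d :=
  List.mem_iff_get.1 (h.mem_resVerts.2 hd)

theorem desc_out : c.desc t T r (c.residualCircuit t T r).out = (0, 0, 0) := rfl

theorem desc_eq_out {i} : c.desc t T r i = (0, 0, 0) ↔ i = (c.residualCircuit t T r).out :=
  ⟨fun h => desc_injective (h.trans desc_out.symm), fun h => h ▸ desc_out⟩

theorem IsPi.res_edge_iff (h : c.IsPi t) {i j} : (c.residualCircuit t T r).Edge i j ↔
    ResEdge t c T r (c.desc t T r i) (c.desc t T r j) :=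
  resAdj_iff (h.resVert_desc i) (h.resVert_desc j)

theorem IsPi.exists_desc_edge (h : c.IsPi t) {i}
    (he : ResEdge t c T r (c.desc t T r i) e) :
    ∃ j, c.desc t T r j = e ∧ (c.residualCircuit t T r).Edge i j := by
  obtain ⟨j, rfl⟩ := he.snd.exists_desc h
  exact ⟨j, rfl, h.res_edge_iff.2 he⟩

theorem IsPi.exists_edge_desc (h : c.IsPi t) {i}
    (he : ResEdge t c T r e (c.desc t T r i)) :
    ∃ j, c.desc t T r j = e ∧ (c.residualCircuit t T r).Edge j i := by
  obtain ⟨j, rfl⟩ := he.fst.exists_desc h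
  exact ⟨j, rfl, h.res_edge_iff.2 he⟩

theorem IsPi.res_kind (h : c.IsPi t) (i) :
    ((c.residualCircuit t T r).kind i).code = c.resKind (c.desc t T r i) :=
  VertexKind.code_ofCode (h.resKind_le _)

theorem IsPi.res_isVar (h : c.IsPi t) {i} :
    (c.residualCircuit t T r).IsVar i ↔ c.resKind (c.desc t T r i) = 0 := by
  rw [← h.res_kind, MonotoneCircuit.code_eq_zero]
  rfl

theorem IsPi.res_isGate (h : c.IsPi t) {i} :
    (c.residualCircuit t T r).IsGate i ↔ c.resKind (c.desc t T r i) ≠ 0 :=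
  not_congr h.res_isVar

theorem IsPi.isSimplified_residual (h : c.IsPi t) (hT : c.IsTrue X T) :
    (c.residualCircuit t T r).IsSimplified := by
  constructor
  · intro i hi
    obtain ⟨e, he⟩ := (h.resVert_desc i).exists_edge h (mt desc_eq_out.1 hi)
    obtain ⟨j, -, hj⟩ := h.exists_desc_edge he
    exact (Set.ncard_pos (Set.toFinite _)).2 ⟨j, hj⟩
  · intro i hk hi
    obtain ⟨e, e', hne, he, he'⟩ := (h.resVert_desc i).two_inputs h hT (h.res_isGate.1 hk)
      (mt desc_eq_out.1 hi)
    obtain ⟨j, rfl, hj⟩ := h.exists_edge_desc he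
    obtain ⟨j', rfl, hj'⟩ := h.exists_edge_desc he'
    exact (Set.one_lt_ncard_iff (Set.toFinite _)).2 ⟨j, j', hj, hj', fun e => hne (by rw [e])⟩

theorem IsPi.kept_of_mem_crit (h : c.IsPi t) {p : ℕ} (hp : p ∈ c.crit T) : c.kept t T p = true :=
  h.kept_iff.2 ⟨live_of_mem_crit hp,
    h.not_absorbed_of_adj_out (live_of_mem_crit hp) (mem_crit.1 hp).2.2.1⟩

/-- Acyclicity and depth come from `resRank`. A critical gate must be left because otherwise the
output would have indegree 0, like a variable. -/
theorem IsPi.isPiPlus_residual (h : c.IsPi t) (hT : c.IsTrue X T) (hne : c.crit T ≠ []) :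
    (c.residualCircuit t T r).IsPiPlus t := by
  have hrank : ∀ i j, (c.residualCircuit t T r).Edge i j →
      c.resRank t (c.desc t T r j) < c.resRank t (c.desc t T r i) := fun i j hij =>
    (h.res_edge_iff.1 hij).rank_lt h hT
  refine ⟨?_, ?_, ?_, ?_, ?_, ?_, ?_⟩
  · intro i hi
    have : ∀ i j, Relation.TransGen (c.residualCircuit t T r).Edge i j →
        c.resRank t (c.desc t T r j) < c.resRank t (c.desc t T r i) := by
      intro i j hij
      induction hij with
      | single h => exact hrank _ _ h
      | tail _ h ih => exact (hrank _ _ h).trans ih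
    exact lt_irrefl _ (this i i hi)
  · intro i
    rw [MonotoneCircuit.indegree_eq_zero_iff, h.res_isVar]
    constructor
    · intro hk j hj
      exact (h.res_edge_iff.1 hj).snd_kind h hk
    · intro hi
      by_contra hk
      by_cases hi0 : c.desc t T r i = (0, 0, 0)
      · obtain ⟨p, hp⟩ := List.exists_mem_of_ne_nil _ hne
        have he : ResEdge t c T r (1, p, 0) (c.desc t T r i) :=
          hi0 ▸ .out (h.kept_of_mem_crit hp) (mem_crit.1 hp).2.2.1
        obtain ⟨j, -, hj⟩ := h.exists_edge_desc he
        exact hi j hj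
      · obtain ⟨e, _, -, he, -⟩ := (h.resVert_desc i).two_inputs h hT hk hi0
        obtain ⟨j, -, hj⟩ := h.exists_edge_desc he
        exact hi j hj
  · rfl
  · rw [MonotoneCircuit.outdegree, Set.ncard_eq_zero (Set.toFinite _),
      Set.eq_empty_iff_forall_notMem]
    intro j hj
    have := hrank _ _ hj
    rw [desc_out] at this
    simp [resRank] at this
  · intro i hi
    rw [h.res_isGate] at hi
    rw [MonotoneCircuit.outdegree, Set.ncard_le_one (Set.toFinite _)]
    intro j hj j' hj'
    refine desc_injective ((h.res_edge_iff.1 hj).unique h (h.res_edge_iff.1 hj') fun h2 => hi ?_)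
    simp [resKind, h2]
  · intro i j hi hij hk
    refine (h.res_edge_iff.1 hij).alternating h (h.res_isGate.1 hi) ?_
    rw [← h.res_kind, ← h.res_kind, hk]
  · intro i ℓ _ hp
    have : ∀ i j ℓ, (c.residualCircuit t T r).PathOfLength ℓ i j →
        ℓ ≤ c.resRank t (c.desc t T r i) := by
      intro i j ℓ hp
      induction hp with
      | refl => exact Nat.zero_le _
      | step he _ ih => have := hrank _ _ he; omega
    exact (this _ _ _ hp).trans (h.resRank_le (h.resVert_desc i))

theorem IsPi.res_isCritical (h : c.IsPi t) {i} :
    (c.residualCircuit t T r).IsCritical i → ∃ p ∈ c.crit T, c.desc t T r i = (1, p, 0) := by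
  rintro ⟨-, he⟩
  have he := h.res_edge_iff.1 he
  rw [desc_out] at he
  generalize hd : c.desc t T r i = d at he ⊢
  cases he with
  | out hp hadj => exact ⟨_, (h.kept_iff.1 hp).1.mem_crit h hadj, rfl⟩

theorem IsPi.numCritical_residual (h : c.IsPi t) :
    (c.residualCircuit t T r).numCritical ≤ (c.crit T).length := by
  classical
  refine le_trans ?_ (List.toFinset_card_le _)
  rw [MonotoneCircuit.numCritical, ← Set.ncard_coe_finset]
  refine Set.ncard_le_ncard_of_injOn (fun i => (c.desc t T r i).2.1) ?_ ?_ (Finset.finite_toSet _)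
  · intro i hi
    obtain ⟨p, hp, e⟩ := h.res_isCritical hi
    simpa [e] using hp
  · intro i hi j hj hij
    obtain ⟨p, hp, e⟩ := h.res_isCritical hi
    obtain ⟨p', hp', e'⟩ := h.res_isCritical hj
    apply desc_injective
    simp only [e, e'] at hij ⊢
    rw [hij]

/-- The critical gate above a gate is constant along residual edges that do not enter the output, so
residual subtrees lie over subtrees of the given circuit. -/
theorem IsPi.root_of_subtree (h : c.IsPi t) {p q} (hp : (c.residualCircuit t T r).IsCritical p)
    (hq : q ∈ (c.residualCircuit t T r).subtree p) :
    (c.desc t T r p).2.1 = c.root t (c.desc t T r q).2.1 := by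
  obtain ⟨hk, hq⟩ := hq
  obtain ⟨a, ha, e⟩ := h.res_isCritical hp
  have hra : c.root t a = a := ((live_of_mem_crit ha).root_spec h).2.2.1 (mem_crit.1 ha).2.2.1
  have hno : ∀ i j, c.desc t T r j = (0, 0, 0) →
      Relation.ReflTransGen (c.residualCircuit t T r).Edge j i →
      c.desc t T r i = (0, 0, 0) := by
    intro i j hj hji
    induction hji with
    | refl => exact hj
    | tail _ he ih =>
      have := h.res_edge_iff.1 he
      rw [ih] at this
      cases this
  induction hq using Relation.ReflTransGen.head_induction_on with
  | refl => rw [e]; exact hra.symm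
  | @head i j hij hjp ih =>
    have he := h.res_edge_iff.1 hij
    have hj0 : c.desc t T r j ≠ (0, 0, 0) := fun h0 => by
      have := hno _ _ h0 hjp
      rw [e] at this
      simp at this
    rw [ih (h.res_isGate.2 (he.snd_kind h)), he.root_eq h (fun h2 => ?_) hj0]
    rw [h.res_isGate] at hk
    exact hk (by simp [resKind, h2])

/-- Old variables feed only subtrees counted by `deg`, and they are not candidates. Additional
variables have a single outgoing edge and feed at most one subtree. -/
theorem IsPi.numSubtreesFed_residual (h : c.IsPi t) (hm : (c.crit T).length ≤ 2 * r) {x}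
    (hx : (c.residualCircuit t T r).IsVar x) :
    (c.residualCircuit t T r).numSubtreesFed x ≤ 2 := by
  classical
  have hx := h.res_isVar.1 hx
  have hinj : Set.InjOn (fun i => (c.desc t T r i).2.1) {p | (c.residualCircuit t T r).IsCritical p ∧
      ∃ q ∈ (c.residualCircuit t T r).subtree p, (c.residualCircuit t T r).Edge x q} := by
    intro i hi j hj hij
    obtain ⟨p, hp, e⟩ := h.res_isCritical hi.1
    obtain ⟨p', hp', e'⟩ := h.res_isCritical hj.1
    apply desc_injective
    simp only [e, e'] at hij ⊢
    rw [hij]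
  rw [MonotoneCircuit.numSubtreesFed]
  by_cases h2 : (c.desc t T r x).1 = 2
  · have hv := h.resVert_desc (T := T) (r := r) x
    obtain ⟨y, hy, hlow⟩ : ∃ y, c.desc t T r x = (2, y, 0) ∧ c.low t T r y = true := by
      generalize c.desc t T r x = d at h2 hv
      cases hv <;> simp at h2
      exact ⟨_, rfl, ‹_›⟩
    refine le_trans ?_ (h.deg_le_two hlow hm)
    refine le_trans ?_ (List.toFinset_card_le _)
    rw [← Set.ncard_coe_finset]
    refine Set.ncard_le_ncard_of_injOn _ ?_ hinj (Finset.finite_toSet _)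
    rintro i ⟨hi, q, hq, hxq⟩
    obtain ⟨p, hp, e⟩ := h.res_isCritical hi
    have he := h.res_edge_iff.1 hxq
    rw [hy] at he
    have h3 := he.feeds h
    rw [← h.root_of_subtree hi hq, e] at h3
    simpa [e] using ⟨hp, h3⟩
  · refine le_trans ?_ one_le_two
    rw [Set.ncard_le_one (Set.toFinite _)]
    rintro i ⟨hi, q, hq, hxq⟩ j ⟨hj, q', hq', hxq'⟩
    refine hinj ⟨hi, q, hq, hxq⟩ ⟨hj, q', hq', hxq'⟩ ?_
    have e := desc_injective ((h.res_edge_iff.1 hxq).unique h (h.res_edge_iff.1 hxq') h2)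
    subst e
    exact (h.root_of_subtree hi hq).trans (h.root_of_subtree hj hq').symm

end RawCircuit

namespace RawCircuit

variable {t r : ℕ} {c : RawCircuit} {X T : List ℕ} {d e : ℕ × ℕ × ℕ}

/-! ### Satisfying assignments of the residual circuit -/

/-- A critical gate is an or-gate, hence padded, which supplies enough variables to fill up
assignments to weight exactly `r`. -/
theorem IsPi.le_numVars_residual (h : c.IsPi t) (hne : c.crit T ≠ []) :
    r ≤ (c.residualCircuit t T r).numVars := by
  obtain ⟨p, hp⟩ := List.exists_mem_of_ne_nil _ hne
  have hpad : ∀ i : Fin (r + 2), ∃ j, c.desc t T r j = (4, p, (i : ℕ)) := fun i =>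
    (ResVert.pad (h.kept_of_mem_crit hp) (by simp [padded, (mem_crit.1 hp).2.1]) i.2).exists_desc h
  choose f hf using hpad
  have hinj : Function.Injective f := fun i j hij => by
    have := (hf i).symm.trans ((congrArg _ hij).trans (hf j))
    simpa [Fin.ext_iff] using this
  calc r ≤ (Set.range f).ncard := by
        rw [← Set.image_univ, Set.ncard_image_of_injective _ hinj, Set.ncard_univ, Nat.card_fin]
        omega
    _ ≤ _ := by
        refine Set.ncard_le_ncard ?_ (Set.toFinite _)
        rintro _ ⟨i, rfl⟩
        refine h.res_isVar.2 ?_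
        rw [hf]
        simp [resKind]

/-- Sets of `r` variables do not contain all the variables that are added to a gate. -/
theorem exists_pad_not_mem {τ : Finset (Fin (c.residualCircuit t T r).order)}
    (hτ : τ.card ≤ r) (q : ℕ) :
    ∃ i < r + 2, ∀ j ∈ τ, c.desc t T r j ≠ (4, q, i) := by
  by_contra hn
  push Not at hn
  have : Nonempty (Fin (c.residualCircuit t T r).order) := ⟨(c.residualCircuit t T r).out⟩
  choose! f hf using hn
  have : (Finset.range (r + 2)).card ≤ τ.card := by
    refine Finset.card_le_card_of_injOn f (fun i hi => (hf i (by simpa using hi)).1) ?_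
    intro i hi j hj hij
    have h1 := (hf i (by simpa using hi)).2
    have h2 := (hf j (by simpa using hj)).2
    rw [hij, h2] at h1
    simpa using h1.symm
  rw [Finset.card_range] at this
  omega

theorem IsPi.not_satisfies_of_pads (h : c.IsPi t)
    {τ : Finset (Fin (c.residualCircuit t T r).order)} (hτ : τ.card ≤ r) {q : ℕ} {i}
    (hedge : ∀ j < r + 2, ResEdge t c T r (4, q, j) (c.desc t T r i))
    (hsat : ∀ u, (c.residualCircuit t T r).Edge u i → (c.residualCircuit t T r).Satisfies τ u) :
    False := by
  obtain ⟨j, hj, hnot⟩ := exists_pad_not_mem hτ q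
  obtain ⟨u, hu, he⟩ := h.exists_edge_desc (hedge j hj)
  have hk : (c.residualCircuit t T r).kind u = .var :=
    h.res_isVar.2 (by rw [hu]; simp [resKind])
  cases hsat u he with
  | var _ hmem => exact hnot u hmem hu
  | and hk' => rw [hk] at hk'; exact absurd hk' (by simp)
  | or hk' => rw [hk] at hk'; exact absurd hk' (by simp)

/-- Gates into which an input is merged are true if the input is. -/
theorem IsPi.sat_of_merged (h : c.IsPi t) (hT : c.IsTrue X T) {τ : Set ℕ}
    (hX : {x | x ∈ X} ⊆ τ) {a q : ℕ} (hk : c.kind q = 2) (hm : c.merged t T a q = true)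
    (haT : a ∉ T) (ha : c.Sat τ a) : c.Sat τ q := by
  obtain ⟨q₀, hq₀, rfl, hadj⟩ := h.merged_iff.1 hm
  refine hq₀.sat_rep_of_input h hT hX ?_ hadj haT ha
  by_cases hab : c.absorbed T q₀ = true
  · exact .inr hab
  · rw [(hq₀.rep_spec h).2.2.1 hab] at hk
    exact .inl hk

/-- The solution consists of `X`, the chosen old variables, and, for each chosen additional variable
of an or-gate, a genuine variable merged into that gate. The weight does not grow, and other
additional variables have no effect at weight `r`. -/
theorem IsPi.sat_of_residual (h : c.IsPi t) (hT : c.IsTrue X T) (hmand : ∀ x ∈ c.mand, x ∈ X)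
    (hXv : ∀ x ∈ X, x < c.ord ∧ c.kind x = 0)
    (hsat : (c.residualCircuit t T r).HasWeightedSat r) :
    ∃ τ : Finset ℕ, (∀ x ∈ τ, x < c.ord ∧ c.kind x = 0) ∧ τ.card ≤ X.length + r ∧
      c.Sat (τ : Set ℕ) c.out := by
  classical
  obtain ⟨σ, hσ, hcard, hsat⟩ := hsat
  have hch : ∀ q, ∃ x, c.hasVar t T q = true →
      c.kind x = 0 ∧ x ∉ T ∧ c.merged t T x q = true := by
    intro q
    by_cases hq : c.hasVar t T q = true
    · obtain ⟨x, hx⟩ := h.hasVar_iff.1 hq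
      exact ⟨x, fun _ => hx⟩
    · exact ⟨0, fun hq' => absurd hq' hq⟩
  choose f hf using hch
  -- If a gate has no genuine variable, `f` is arbitrary there. The filter in `τ` drops values that
  -- are not variables, and superfluous variables do no harm.
  let φ : ℕ × ℕ × ℕ → ℕ := fun d => if d.1 = 2 then d.2.1 else f d.2.1
  let τ : Finset ℕ := X.toFinset ∪
    (σ.image fun i => φ (c.desc t T r i)).filter fun x => x < c.ord ∧ c.kind x = 0
  have hX : {x | x ∈ X} ⊆ (τ : Set ℕ) := fun x hx => by
    simp only [τ, Finset.coe_union, Set.mem_union, Finset.mem_coe, List.mem_toFinset]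
    exact .inl hx
  have hin : ∀ i ∈ σ, φ (c.desc t T r i) < c.ord → c.kind (φ (c.desc t T r i)) = 0 →
      c.Sat (τ : Set ℕ) (φ (c.desc t T r i)) := by
    intro i hi h1 h2
    refine .var h2 (Finset.mem_coe.2 (Finset.mem_union_right _ (Finset.mem_filter.2 ⟨?_, h1, h2⟩)))
    exact Finset.mem_image_of_mem _ hi
  have hmer : ∀ {x q}, c.merged t T x q = true → x < c.ord := fun hm => by
    obtain ⟨q, -, -, hadj⟩ := h.merged_iff.1 hm
    exact (h.adj_lt hadj).1
  refine ⟨τ, ?_, ?_, ?_⟩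
  · intro x hx
    rcases Finset.mem_union.1 hx with hx | hx
    · exact hXv x (List.mem_toFinset.1 hx)
    · exact (Finset.mem_filter.1 hx).2
  · refine (Finset.card_union_le _ _).trans (add_le_add (List.toFinset_card_le _) ?_)
    exact (Finset.card_filter_le _ _).trans (Finset.card_image_le.trans hcard.le)
  -- What truth means for each tag: gates and old variables are true in the given circuit,
  -- additional and-gates are never true, and an additional variable vouches for its substitute.
  · have key : ∀ i, (c.residualCircuit t T r).Satisfies σ i →
        (∀ q, c.desc t T r i = (1, q, 0) → c.Sat (τ : Set ℕ) q) ∧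
        (∀ x, c.desc t T r i = (2, x, 0) → c.Sat (τ : Set ℕ) x) ∧
        (∀ q, c.desc t T r i ≠ (3, q, 0)) ∧
        (∀ q j, c.desc t T r i = (4, q, j) → c.hasVar t T q = true → c.Sat (τ : Set ℕ) (f q)) ∧
        (c.desc t T r i = (0, 0, 0) → c.Sat (τ : Set ℕ) c.out) := by
      intro i hi
      induction hi with
      | @var i hk hmem =>
        have hk : c.resKind (c.desc t T r i) = 0 := h.res_isVar.1 hk
        have hv := h.resVert_desc (T := T) (r := r) i
        have hi := hin i hmem
        generalize c.desc t T r i = d at hk hv hi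
        refine ⟨?_, ?_, ?_, ?_, ?_⟩
        · rintro q rfl
          cases hv with
          | gate hq => exact absurd hk (by simpa [resKind] using (h.kept_iff.1 hq).1.kind_ne)
        · rintro x rfl
          cases hv with
          | var hx =>
            obtain ⟨h1, -, -, q, -, hadj⟩ := h.low_iff.1 hx
            exact hi (h.adj_lt hadj).1 h1
        · rintro q rfl
          simp [resKind] at hk
        · rintro q j rfl hq
          obtain ⟨h1, h2, h3⟩ := hf q hq
          exact hi (hmer h3) h1
        · rintro rfl
          simp [resKind] at hk
      | @and i hk hsub ih =>
        have hk : c.resKind (c.desc t T r i) = 1 := by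
          rw [← h.res_kind, hk]; rfl
        have hv := h.resVert_desc (T := T) (r := r) i
        refine ⟨?_, ?_, ?_, ?_, ?_⟩
        · intro q hi
          rw [hi] at hv hk
          simp only [resKind] at hk
          cases hv with
          | gate hq =>
            have hk : c.kind q = 1 := by simpa using hk
            have hn : ¬ c.needsAnd t T q = true := fun hn => by
              rw [(needsAnd_iff.1 hn).1] at hk
              exact absurd hk (by decide)
            -- A candidate input would have brought `r + 2` additional variables, not all of which
            -- are true.
            have hc : ¬ c.hasCand t T r q = true := fun hc => by
              have hp : c.padded t T r q = true := by simp [padded, hc]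
              refine h.not_satisfies_of_pads hcard.le (q := q) (i := i) (fun j hj => ?_) hsub
              rw [hi]
              exact .pad hq hp hn hj
            refine .and hk fun u hu => ?_
            by_cases huT : u ∈ T
            · exact (hT.sound u huT).mono hX
            rcases h.exists_edge_of_input hq hk hc hu huT with ⟨-, he⟩ | ⟨-, he⟩
            · rw [← hi] at he
              obtain ⟨j, hj, hji⟩ := h.exists_edge_desc he
              exact (ih j hji).2.1 u hj
            · rw [← hi] at he
              obtain ⟨j, hj, hji⟩ := h.exists_edge_desc he
              exact (ih j hji).1 u hj
        · intro x hi
          rw [hi] at hk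
          simp [resKind] at hk
        · intro q hi
          rw [hi] at hv
          cases hv with
          | aux hq hn =>
            refine h.not_satisfies_of_pads hcard.le (q := q) (i := i)
              (fun j hj => ?_) hsub
            rw [hi]
            exact .padAux hq hn hj
        · intro q j hi
          rw [hi] at hk
          simp [resKind] at hk
        · intro hi
          refine .and h.kind_out fun u hu => ?_
          by_cases hk0 : c.kind u = 0
          · refine .var hk0 (hX (hmand u ?_))
            simp only [mand, List.mem_filter, mem_verts, Bool.and_eq_true, decide_eq_true_eq]
            exact ⟨(h.adj_lt hu).1, hk0, hu⟩
          by_cases huT : u ∈ T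
          · exact (hT.sound u huT).mono hX
          have he : ResEdge t c T r (1, u, 0) (c.desc t T r i) :=
            hi ▸ .out (h.kept_of_mem_crit ((Live.top hk0 huT hu).mem_crit h hu)) hu
          obtain ⟨j, hj, hji⟩ := h.exists_edge_desc he
          exact (ih j hji).1 u hj
      | @or j i hk hji _ ih =>
        have hk : c.resKind (c.desc t T r i) = 2 := by
          rw [← h.res_kind, hk]; rfl
        have he := h.res_edge_iff.1 hji
        generalize c.desc t T r i = d at hk he
        generalize c.desc t T r j = e at ih he
        cases he with
        | out => simp [resKind] at hk
        | gate ha _ hm =>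
          refine ⟨?_, by simp, by simp, by simp, by simp⟩
          rintro q ⟨⟩
          exact h.sat_of_merged hT hX (by simpa [resKind] using hk) hm
            (h.kept_iff.1 ha).1.not_mem (ih.1 _ rfl)
        | var hx _ hm =>
          refine ⟨?_, by simp, by simp, by simp, by simp⟩
          rintro q ⟨⟩
          exact h.sat_of_merged hT hX (by simpa [resKind] using hk) hm
            (h.low_iff.1 hx).2.1 (ih.2.1 _ rfl)
        | aux => exact absurd rfl (ih.2.2.1 _)
        | @pad q' _ _ _ hn _ =>
          refine ⟨?_, by simp, by simp, by simp, by simp⟩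
          rintro q ⟨⟩
          have hk : c.kind q' = 2 := by simpa [resKind] using hk
          have hq : c.hasVar t T q' = true := by
            by_contra hq
            exact hn (needsAnd_iff.2 ⟨hk, hq⟩)
          obtain ⟨h1, h2, h3⟩ := hf q' hq
          exact h.sat_of_merged hT hX hk h3 h2 (ih.2.2.2.1 _ _ rfl hq)
        | padAux => simp [resKind] at hk
    exact (key _ hsat).2.2.2.2 desc_out

/-- The variables of `τ` outside of `X` that survive are chosen. Truth is transferred from a live
gate to the gate with which it is merged; since `τ` has no candidates, every variable that is used
survives, and no and-gate made false by padding was true. -/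
theorem IsPi.residual_of_sat (h : c.IsPi t) (hT : c.IsTrue X T) (hne : c.crit T ≠ [])
    (hnd : X.Nodup) {τ : Finset ℕ} (hX : ∀ x ∈ X, x ∈ τ) (hcard : τ.card ≤ X.length + r)
    (hcand : ∀ x ∈ τ, ¬ c.isCand t T r x = true) (hsat : c.Sat (τ : Set ℕ) c.out) :
    (c.residualCircuit t T r).HasWeightedSat r := by
  classical
  let σ : Finset (Fin (c.residualCircuit t T r).order) :=
    Finset.univ.filter fun i => ∃ x ∈ τ, x ∉ X ∧ c.desc t T r i = (2, x, 0)
  have hσ : ∀ i, i ∈ σ ↔ ∃ x ∈ τ, x ∉ X ∧ c.desc t T r i = (2, x, 0) := by simp [σ]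
  have hlow : ∀ {x q}, c.kind x = 0 → c.Sat (τ : Set ℕ) x → x ∉ T → c.Live T q →
      c.adj x q = true → c.low t T r x = true := by
    intro x q hk hx hxT hq hadj
    refine h.low_iff.2 ⟨hk, hxT, hcand x ?_, q, hq, hadj⟩
    cases hx with
    | var _ hx => exact hx
    | and hk' => rw [hk] at hk'; exact absurd hk' (by decide)
    | or hk' => rw [hk] at hk'; exact absurd hk' (by decide)
  refine MonotoneCircuit.hasWeightedSat_of_card_le (h.le_numVars_residual hne) (τ := σ) ?_ ?_ ?_
  · intro i hi
    obtain ⟨x, -, -, hx⟩ := (hσ i).1 hi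
    refine h.res_isVar.2 ?_
    rw [hx]; simp [resKind]
  · have h1 : σ.card ≤ (τ \ X.toFinset).card := by
      refine Finset.card_le_card_of_injOn (fun i => (c.desc t T r i).2.1) ?_ ?_
      · intro i hi
        obtain ⟨x, h1, h2, hx⟩ := (hσ i).1 hi
        simp [hx, h1, h2]
      · intro i hi j hj hij
        obtain ⟨x, -, -, hx⟩ := (hσ i).1 hi
        obtain ⟨y, -, -, hy⟩ := (hσ j).1 hj
        apply desc_injective
        simp only [hx, hy] at hij ⊢
        rw [hij]
    have h2 : X.toFinset ⊆ τ := fun x hx => hX x (List.mem_toFinset.1 hx)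
    rw [Finset.card_sdiff_of_subset h2, List.toFinset_card_of_nodup hnd] at h1
    omega
  · have key : ∀ v, c.Sat (τ : Set ℕ) v →
        (c.low t T r v = true → ∀ i, c.desc t T r i = (2, v, 0) →
          (c.residualCircuit t T r).Satisfies σ i) ∧
        (c.Live T v → ∀ i, c.desc t T r i = (1, c.rep t T v, 0) →
          (c.residualCircuit t T r).Satisfies σ i) := by
      have hkor : ∀ {i q}, c.desc t T r i = (1, q, 0) → c.kind q = 2 →
          (c.residualCircuit t T r).kind i = .or := fun {i q} hi hk => by
        apply MonotoneCircuit.code_injective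
        rw [h.res_kind, hi]
        simpa [resKind, VertexKind.code] using hk
      intro v hv
      induction hv with
      | @var v hk hv =>
        refine ⟨fun hlow i hi => ?_, fun hl => absurd hk hl.kind_ne⟩
        obtain ⟨-, hvT, -, q, hq, hadj⟩ := h.low_iff.1 hlow
        refine .var (h.res_isVar.2 (by rw [hi]; simp [resKind])) ((hσ i).2 ⟨v, hv, fun hvX => ?_, hi⟩)
        exact hvT (hT.mem_of_var hk hvX hq hadj)
      | @and v hk hsub ih =>
        refine ⟨fun hlow => ?_, fun hl i hi => ?_⟩
        · rw [(h.low_iff.1 hlow).1] at hk; exact absurd hk (by decide)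
        by_cases hab : c.absorbed T v = true
        · have hkr := hl.kind_rep h (.inr hab)
          have hs : c.single T v = true := by
            cases hl with
            | top hk' hvT hadj =>
              exact absurd hab (h.not_absorbed_of_adj_out (.top hk' hvT hadj) hadj)
            | @step _ w hk' hvT hadj hw =>
              refine ((h.absorbed_iff (.step hk' hvT hadj hw) hw hadj).1 hab).resolve_right
                fun hs => ?_
              have := h.alternating hk' hadj
              rw [hk, (single_spec h hs).1] at this
              exact this rfl
          obtain ⟨-, u, hu, huT, -⟩ := single_spec h hs
          by_cases huk : c.kind u = 0
          · have hul := hlow huk (hsub u hu) huT hl hu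
            have he : ResEdge t c T r (2, u, 0) (c.desc t T r i) := by
              rw [hi]
              exact .var hul (hl.kept_rep h) (h.merged_iff.2 ⟨v, hl, rfl, hu⟩)
            obtain ⟨j, hj, hji⟩ := h.exists_edge_desc he
            exact .or (hkor hi hkr) hji ((ih u hu).1 hul j hj)
          · have hul : c.Live T u := .step huk huT hu hl
            refine (ih u hu).2 hul i ?_
            rw [hi, ((hul.rep_spec h).2.2.2 v hu ((h.absorbed_iff hul hl hu).2 (.inr hs))).2]
        · have hkept := h.kept_iff.2 ⟨hl, hab⟩
          have hr := h.rep_eq_self hkept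
          rw [hr] at hi
          refine .and ?_ fun j hji => ?_
          · apply MonotoneCircuit.code_injective
            rw [h.res_kind, hi]
            simpa [resKind, VertexKind.code] using hk
          have he := h.res_edge_iff.1 hji
          rw [hi] at he
          have hadj : ∀ {a}, c.merged t T a v = true → c.adj a v = true := by
            intro a hm
            obtain ⟨q, hq, hqr, hadj⟩ := h.merged_iff.1 hm
            rw [← hq.eq_rep_of_kind h (by rw [hqr]; exact hk), hqr] at hadj
            exact hadj
          generalize hd : c.desc t T r j = d at he
          cases he with
          | gate ha _ hm =>
            refine (ih _ (hadj hm)).2 (h.kept_iff.1 ha).1 j ?_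
            rw [hd, h.rep_eq_self ha]
          | var hx _ hm => exact (ih _ (hadj hm)).1 hx j hd
          | aux _ hn =>
            rw [(needsAnd_iff.1 hn).1] at hk; exact absurd hk (by decide)
          | pad _ hp _ _ =>
            -- A padded and-gate has a candidate among its inputs; its truth would force that
            -- candidate into `τ`.
            have hc : c.hasCand t T r v = true := by simpa [padded, hk] using hp
            obtain ⟨x, hx, hxv⟩ := h.hasCand_iff.1 hc
            obtain ⟨hxk, hxT, -⟩ := isCand_iff.1 hx
            exact absurd hx (h.low_iff.1 (hlow hxk (hsub x hxv) hxT hl hxv)).2.2.1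
      | @or u v hk hu hsu ih =>
        refine ⟨fun hlow => ?_, fun hl i hi => ?_⟩
        · rw [(h.low_iff.1 hlow).1] at hk; exact absurd hk (by decide)
        have huT := hl.input_not_mem hT hk hu
        have hkr := hl.kind_rep h (.inl hk)
        by_cases huk : c.kind u = 0
        · have hul := hlow huk hsu huT hl hu
          have he : ResEdge t c T r (2, u, 0) (c.desc t T r i) := by
            rw [hi]
            exact .var hul (hl.kept_rep h) (h.merged_iff.2 ⟨v, hl, rfl, hu⟩)
          obtain ⟨j, hj, hji⟩ := h.exists_edge_desc he
          exact .or (hkor hi hkr) hji (ih.1 hul j hj)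
        · have hul : c.Live T u := .step huk huT hu hl
          by_cases hab : c.absorbed T u = true
          · refine ih.2 hul i ?_
            rw [hi, ((hul.rep_spec h).2.2.2 v hu hab).2]
          · have hkept := h.kept_iff.2 ⟨hul, hab⟩
            have he : ResEdge t c T r (1, u, 0) (c.desc t T r i) := by
              rw [hi]
              exact .gate hkept (hl.kept_rep h) (h.merged_iff.2 ⟨v, hl, rfl, hu⟩)
            obtain ⟨j, hj, hji⟩ := h.exists_edge_desc he
            refine .or (hkor hi hkr) hji (ih.2 hul j ?_)
            rw [hj, h.rep_eq_self hkept]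
    have hout : ∀ u, c.adj u c.out = true → c.Sat (τ : Set ℕ) u := by
      have hko := h.kind_out
      generalize c.out = o at hsat hko
      cases hsat with
      | var hk => rw [hko] at hk; exact absurd hk (by decide)
      | and _ h' => exact h'
      | or hk => rw [hko] at hk; exact absurd hk (by decide)
    refine .and rfl fun j hj => ?_
    have he := h.res_edge_iff.1 hj
    rw [desc_out] at he
    generalize hd : c.desc t T r j = d at he
    cases he with
    | out hp hadj =>
      refine (key _ (hout _ hadj)).2 (h.kept_iff.1 hp).1 j ?_
      rw [hd, h.rep_eq_self hp]

end RawCircuit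

/-! ### The genus of the residual circuit -/

namespace MonotoneCircuit

/-- Minors of the graph of a circuit. -/
theorem IsPiPlus.embedsInGenus_minor {C : MonotoneCircuit} {t : ℕ} (hC : C.IsPiPlus t)
    {W : Type*} [Finite W] [LinearOrder W] {H : SimpleGraph W} (f : ℕ → Option W)
    (hlt : ∀ v w, f v = some w → v < C.raw.ord) (hout : f C.raw.out = none)
    (hconn : ∀ u v w, f u = some w → f v = some w →
      Relation.EqvGen (fun x y => C.raw.adj x y = true ∧ f x = some w ∧ f y = some w) u v)
    (hadj : ∀ a b, H.Adj a b → ∃ u v, f u = some a ∧ f v = some b ∧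
      (C.raw.adj u v = true ∨ C.raw.adj v u = true)) :
    H.EmbedsInGenus C.genus := by
  classical
  have hmem : ∀ {v w}, f v = some w → ∃ h : v < C.order, (⟨v, h⟩ : Fin C.order) ≠ C.out := by
    intro v w hv
    refine ⟨by simpa using hlt v w hv, fun e => ?_⟩
    have : v = C.raw.out := congrArg Fin.val e
    rw [this, hout] at hv
    exact absurd hv (by simp)
  have hedge : ∀ (u v : {v : Fin C.order // v ≠ C.out}), C.raw.adj u.1 v.1 = true →
      C.graph.Adj u v := by
    intro u v huv
    refine (SimpleGraph.fromRel_adj _ _ _).2 ⟨fun e => ?_, .inl ?_⟩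
    · subst e
      exact hC.isPi.alternating (hC.isPi.not_adj_var huv) huv rfl
    · obtain ⟨_, _, h⟩ := C.raw_adj_iff.1 huv
      exact h
  refine SimpleGraph.EmbedsInGenus.minor (G := C.graph) (fun v => f v.1) ?_ ?_
    (SimpleGraph.embedsInGenus_minGenus C.graph)
  · intro u v w hu hv
    let ι : ℕ → {v : Fin C.order // v ≠ C.out} := fun n =>
      if h : ∃ h : n < C.order, (⟨n, h⟩ : Fin C.order) ≠ C.out then ⟨⟨n, h.1⟩, h.2⟩ else u
    have hι : ∀ {n w}, f n = some w → ((ι n).1 : ℕ) = n := fun {n w} hn => by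
      simp only [ι, dif_pos (hmem hn)]
    have hιu : ι u.1 = u := Subtype.ext (Fin.ext (hι hu))
    have hιv : ι v.1 = v := Subtype.ext (Fin.ext (hι hv))
    rw [← hιu, ← hιv]
    refine eqvGen_map (f := ι) ?_ (hconn _ _ w hu hv)
    rintro x y ⟨hxy, hx, hy⟩
    refine .rel _ _ ⟨hedge _ _ ?_, ?_, ?_⟩
    · rw [hι hx, hι hy]; exact hxy
    · rw [hι hx]; exact hx
    · rw [hι hy]; exact hy
  · intro a b hab
    obtain ⟨u, v, hu, hv, huv⟩ := hadj a b hab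
    obtain ⟨h1, h2⟩ := hmem hu
    obtain ⟨h3, h4⟩ := hmem hv
    refine ⟨⟨⟨u, h1⟩, h2⟩, ⟨⟨v, h3⟩, h4⟩, hu, hv, ?_⟩
    rcases huv with h | h
    · exact hedge _ _ h
    · exact (hedge _ _ h).symm

end MonotoneCircuit

namespace RawCircuit

variable {t r : ℕ} {c : RawCircuit} {X T : List ℕ} {d e : ℕ × ℕ × ℕ}

/-- The subgraph of the residual circuit that consists of the edges between vertices with tags at
most `s`. -/
def tagGraph (t : ℕ) (c : RawCircuit) (T : List ℕ) (r s : ℕ) :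
    SimpleGraph {v : Fin (c.residualCircuit t T r).order // v ≠ (c.residualCircuit t T r).out} :=
  SimpleGraph.fromRel fun u v => (c.residualCircuit t T r).Edge u.1 v.1 ∧
    (c.desc t T r u.1).1 ≤ s ∧ (c.desc t T r v.1).1 ≤ s

theorem tagGraph_adj {s : ℕ} {u v} : (c.tagGraph t T r s).Adj u v ↔
    (c.residualCircuit t T r).graph.Adj u v ∧
      (c.desc t T r u.1).1 ≤ s ∧ (c.desc t T r v.1).1 ≤ s := by
  simp only [tagGraph, MonotoneCircuit.graph, SimpleGraph.fromRel_adj]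
  tauto

theorem IsPi.graph_adj (h : c.IsPi t) {u v} (huv : (c.residualCircuit t T r).graph.Adj u v) :
    ResEdge t c T r (c.desc t T r u.1) (c.desc t T r v.1) ∨
      ResEdge t c T r (c.desc t T r v.1) (c.desc t T r u.1) :=
  ((SimpleGraph.fromRel_adj _ _ _).1 huv).2.imp h.res_edge_iff.1 h.res_edge_iff.1

/-- Edges into a vertex of tag at least 3 come from larger tags, so among tags at most `s + 1` the
vertices of tag `s + 1` have only their unique outgoing edge and are leaves. -/
theorem IsPi.embedsInGenus_addTag (h : c.IsPi t) {s g : ℕ} (hs : 2 ≤ s)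
    (hG : (c.tagGraph t T r s).EmbedsInGenus g) : (c.tagGraph t T r (s + 1)).EmbedsInGenus g := by
  classical
  refine hG.addLeaves (Finset.univ.filter fun v => (c.desc t T r v.1).1 = s + 1) ?_ ?_ ?_ ?_
  · intro u v huv
    rw [tagGraph_adj] at huv ⊢
    exact ⟨huv.1, by omega, by omega⟩
  · intro u hu v huv
    have hu := (Finset.mem_filter.1 hu).2
    rw [tagGraph_adj] at huv
    omega
  · intro u v huv
    simp only [Finset.mem_filter, Finset.mem_univ, true_and]
    rw [tagGraph_adj] at huv ⊢
    have := huv.2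
    by_cases h1 : (c.desc t T r u.1).1 = s + 1
    · exact .inr (.inl h1)
    by_cases h2 : (c.desc t T r v.1).1 = s + 1
    · exact .inr (.inr h2)
    · exact .inl ⟨huv.1, by omega, by omega⟩
  · intro u hu v v' huv huv'
    have hu := (Finset.mem_filter.1 hu).2
    have key : ∀ v, (c.tagGraph t T r (s + 1)).Adj u v →
        ResEdge t c T r (c.desc t T r u.1) (c.desc t T r v.1) := by
      intro v huv
      rw [tagGraph_adj] at huv
      refine (h.graph_adj huv.1).resolve_right fun he => ?_
      have h2 := huv.2.2
      generalize c.desc t T r u.1 = d at he hu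
      generalize c.desc t T r v.1 = e at he h2
      cases he <;> simp at hu h2 <;> omega
    exact Subtype.ext (desc_injective ((key v huv).unique h (key v' huv') (by omega)))

end RawCircuit

/-- The gates and old variables form a minor: live gates are contracted onto the gates with which
they are merged, and vertices that are neither live gates nor surviving variables are deleted. The
additional and-gates and then the additional variables are attached as leaves. -/
theorem MonotoneCircuit.IsPiPlus.genus_residual_le {C : MonotoneCircuit} {t : ℕ}
    (hC : C.IsPiPlus t) {T : List ℕ} {r : ℕ} :
    (C.raw.residualCircuit t T r).genus ≤ C.genus := by
  classical
  have h := hC.isPi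
  let W := {v : Fin (C.raw.residualCircuit t T r).order // v ≠ (C.raw.residualCircuit t T r).out}
  let D : W → ℕ × ℕ × ℕ := fun w => C.raw.desc t T r w.1
  have hD : Function.Injective D := fun a b hab => Subtype.ext (RawCircuit.desc_injective hab)
  let idx : ℕ × ℕ × ℕ → Option W := fun d => if h : ∃ w, D w = d then some h.choose else none
  have hidx : ∀ d w, idx d = some w ↔ D w = d := by
    intro d w
    by_cases hd : ∃ w, D w = d
    · simp only [idx, dif_pos hd, Option.some.injEq]
      exact ⟨fun e => e ▸ hd.choose_spec, fun e => hD (hd.choose_spec.trans e.symm)⟩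
    · simp only [idx, dif_neg hd]
      exact ⟨fun e => absurd e (by simp), fun e => absurd ⟨w, e⟩ hd⟩
  let f : ℕ → Option W := fun v => if C.raw.Live T v then idx (1, C.raw.rep t T v, 0) else
    if C.raw.low t T r v = true then idx (2, v, 0) else none
  have hlive : ∀ {v}, C.raw.Live T v → f v = idx (1, C.raw.rep t T v, 0) := fun hv => by
    simp only [f, if_pos hv]
  have hlow : ∀ {v}, C.raw.low t T r v = true → f v = idx (2, v, 0) := fun {v} hv => by
    have : ¬ C.raw.Live T v := fun hl => hl.kind_ne (h.low_iff.1 hv).1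
    simp only [f, if_neg this, if_pos hv]
  have hf : ∀ {v w}, f v = some w → (C.raw.Live T v ∧ D w = (1, C.raw.rep t T v, 0)) ∨
      (C.raw.low t T r v = true ∧ D w = (2, v, 0)) := by
    intro v w hv
    by_cases h1 : C.raw.Live T v
    · rw [hlive h1, hidx] at hv
      exact .inl ⟨h1, hv⟩
    by_cases h2 : C.raw.low t T r v = true
    · rw [hlow h2, hidx] at hv
      exact .inr ⟨h2, hv⟩
    · simp only [f, if_neg h1, if_neg h2] at hv
      exact absurd hv (by simp)
  have hbase : (C.raw.tagGraph t T r 2).EmbedsInGenus C.genus := by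
    refine hC.embedsInGenus_minor f ?_ ?_ ?_ ?_
    · intro v w hv
      rcases hf hv with ⟨h1, -⟩ | ⟨h1, -⟩
      · exact h1.lt h
      · obtain ⟨-, -, -, q, -, hadj⟩ := h.low_iff.1 h1
        exact (h.adj_lt hadj).1
    · rw [Option.eq_none_iff_forall_ne_some]
      intro w hw
      rcases hf hw with ⟨h1, -⟩ | ⟨h1, -⟩
      · exact h1.ne_out h rfl
      · have := (h.low_iff.1 h1).1
        rw [h.kind_out] at this
        exact absurd this (by decide)
    · intro u v w hu hv
      have key : ∀ u, C.raw.Live T u → f u = some w → Relation.EqvGen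
          (fun x y => C.raw.adj x y = true ∧ f x = some w ∧ f y = some w) u (C.raw.rep t T u) := by
        intro u hu hfu
        refine (hu.rep_induction h (P := fun y => f y = some w ∧ Relation.EqvGen
          (fun x y => C.raw.adj x y = true ∧ f x = some w ∧ f y = some w) u y)
          ⟨hfu, .refl _⟩ ?_).2
        rintro a b ha hb hab - hr ⟨h1, h2⟩
        have h3 : f b = some w := by rw [hlive hb, ← hr, ← hlive ha, h1]
        exact ⟨h3, h2.trans _ _ _ (.rel _ _ ⟨hab, h1, h3⟩)⟩
      rcases hf hu with ⟨h1, h2⟩ | ⟨h1, h2⟩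
      · rcases hf hv with ⟨h3, h4⟩ | ⟨h3, h4⟩
        · rw [h2] at h4
          have e : C.raw.rep t T u = C.raw.rep t T v := by simpa using h4
          have k1 := key u h1 hu
          rw [e] at k1
          exact k1.trans _ _ _ ((key v h3 hv).symm _ _)
        · rw [h2] at h4; simp at h4
      · rcases hf hv with ⟨h3, h4⟩ | ⟨h3, h4⟩
        · rw [h2] at h4; simp at h4
        · rw [h2] at h4
          have e : u = v := by simpa using h4
          rw [e]
          exact .refl _
    · have key : ∀ a b : W, RawCircuit.ResEdge t C.raw T r (D a) (D b) →
          (D a).1 ≤ 2 → (D b).1 ≤ 2 →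
          ∃ u v, f u = some a ∧ f v = some b ∧ C.raw.adj u v = true := by
        intro a b he ha hb
        have hb0 : D b ≠ (0, 0, 0) := mt RawCircuit.desc_eq_out.1 b.2
        generalize hda : D a = d at he ha
        generalize hdb : D b = e at he hb hb0
        cases he with
        | out => exact absurd rfl hb0
        | gate hka _ hm =>
          obtain ⟨q, hq, rfl, hadj⟩ := h.merged_iff.1 hm
          refine ⟨_, q, ?_, ?_, hadj⟩
          · rw [hlive (h.kept_iff.1 hka).1, hidx, hda, h.rep_eq_self hka]
          · rw [hlive hq, hidx, hdb]
        | var hx _ hm =>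
          obtain ⟨q, hq, rfl, hadj⟩ := h.merged_iff.1 hm
          refine ⟨_, q, ?_, ?_, hadj⟩
          · rw [hlow hx, hidx, hda]
          · rw [hlive hq, hidx, hdb]
        | aux => simp at ha
        | pad => simp at ha
        | padAux => simp at ha
      intro a b hab
      rw [RawCircuit.tagGraph_adj] at hab
      rcases h.graph_adj hab.1 with he | he
      · obtain ⟨u, v, hu, hv, huv⟩ := key a b he hab.2.1 hab.2.2
        exact ⟨u, v, hu, hv, .inl huv⟩
      · obtain ⟨u, v, hu, hv, huv⟩ := key b a he hab.2.2 hab.2.1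
        exact ⟨v, u, hv, hu, .inr huv⟩
  have hall := h.embedsInGenus_addTag (by omega) (h.embedsInGenus_addTag le_rfl hbase)
  have e : C.raw.tagGraph t T r 4 = (C.raw.residualCircuit t T r).graph := by
    ext u v
    rw [RawCircuit.tagGraph_adj, and_iff_left]
    have : ∀ i, (C.raw.desc t T r i).1 ≤ 4 := by
      intro i
      have hv := h.resVert_desc (T := T) (r := r) i
      generalize C.raw.desc t T r i = d at hv
      cases hv <;> simp
    exact ⟨this _, this _⟩
  rw [show 2 + 1 + 1 = 4 from rfl, e] at hall
  exact hall.minGenus_le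

/-! ### The trivial instance -/

/-- The circuit with a single variable, which is incoming to the output. -/
def trivialCircuit : MonotoneCircuit where
  order := 2
  kind i := if (i : ℕ) = 0 then .and else .var
  adj i j := decide ((i : ℕ) = 1 ∧ (j : ℕ) = 0)
  out := 0

namespace MonotoneCircuit

theorem raw_trivialCircuit : trivialCircuit.raw = RawCircuit.trivialRaw := by
  decide

theorem trivialCircuit_edge {i j : Fin trivialCircuit.order} :
    trivialCircuit.Edge i j ↔ (i : ℕ) = 1 ∧ (j : ℕ) = 0 := by
  change decide _ = true ↔ _
  rw [decide_eq_true_eq]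

theorem trivialCircuit_isVar {i : Fin trivialCircuit.order} :
    trivialCircuit.IsVar i ↔ (i : ℕ) = 1 := by
  change (if (i : ℕ) = 0 then VertexKind.and else VertexKind.var) = VertexKind.var ↔ _
  have : (i : ℕ) < 2 := i.2
  split_ifs with h
  · simp [h]
  · simp only [true_iff]
    omega

theorem trivialCircuit_ne_out {i : Fin trivialCircuit.order} (hi : i ≠ trivialCircuit.out) :
    (i : ℕ) = 1 := by
  have h1 : (i : ℕ) < 2 := i.2
  have h2 : (i : ℕ) ≠ 0 := fun h => hi (Fin.ext h)
  omega

theorem isPiPlus_trivialCircuit {t : ℕ} (ht : 1 ≤ t) : trivialCircuit.IsPiPlus t := by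
  refine ⟨?_, ?_, rfl, ?_, ?_, ?_, ?_⟩
  · intro v hv
    have : ∀ i j, Relation.TransGen trivialCircuit.Edge i j → (i : ℕ) = 1 ∧ (j : ℕ) = 0 := by
      intro i j h
      induction h with
      | single h => exact trivialCircuit_edge.1 h
      | tail _ h ih => exact ⟨ih.1, (trivialCircuit_edge.1 h).2⟩
    have := this v v hv
    omega
  · intro v
    rw [indegree_eq_zero_iff, trivialCircuit_isVar]
    constructor
    · intro hv u hu
      have := (trivialCircuit_edge.1 hu).2
      omega
    · intro h
      refine trivialCircuit_ne_out fun hv => h (1 : Fin 2) (trivialCircuit_edge.2 ⟨rfl, ?_⟩)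
      rw [hv]
      rfl
  · rw [outdegree, Set.ncard_eq_zero (Set.toFinite _), Set.eq_empty_iff_forall_notMem]
    intro j hj
    exact absurd (trivialCircuit_edge.1 hj).1 (by simp [trivialCircuit])
  · intro v _
    rw [outdegree, Set.ncard_le_one (Set.toFinite _)]
    intro a ha b hb
    exact Fin.ext ((trivialCircuit_edge.1 ha).2.trans (trivialCircuit_edge.1 hb).2.symm)
  · intro u v hu huv
    exact absurd (trivialCircuit_isVar.2 (trivialCircuit_edge.1 huv).1) hu
  · intro v ℓ _ hp
    cases hp with
    | refl => exact Nat.zero_le _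
    | step he hp =>
      cases hp with
      | refl => exact ht
      | step he' _ =>
        have h1 := trivialCircuit_edge.1 he
        have h2 := trivialCircuit_edge.1 he'
        omega

theorem isSimplified_trivialCircuit : trivialCircuit.IsSimplified := by
  constructor
  · intro v hne
    exact (Set.ncard_pos (Set.toFinite _)).2
      ⟨trivialCircuit.out, trivialCircuit_edge.2 ⟨trivialCircuit_ne_out hne, rfl⟩⟩
  · intro v hg hne
    exact absurd (trivialCircuit_isVar.2 (trivialCircuit_ne_out hne)) hg

theorem not_isCritical_trivialCircuit (p) : ¬ trivialCircuit.IsCritical p := by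
  rintro ⟨h, -⟩
  change (if (p : ℕ) = 0 then VertexKind.and else VertexKind.var) = VertexKind.or at h
  split_ifs at h

theorem numCritical_trivialCircuit : trivialCircuit.numCritical = 0 := by
  rw [numCritical, Set.ncard_eq_zero (Set.toFinite _), Set.eq_empty_iff_forall_notMem]
  exact not_isCritical_trivialCircuit

theorem numSubtreesFed_trivialCircuit (x) : trivialCircuit.numSubtreesFed x = 0 := by
  rw [numSubtreesFed, Set.ncard_eq_zero (Set.toFinite _), Set.eq_empty_iff_forall_notMem]
  exact fun p hp => not_isCritical_trivialCircuit p hp.1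

/-- Without the output a single vertex is left. There are no edges to realize, so empty branch sets
suffice. -/
theorem IsPiPlus.genus_trivialCircuit_le {C : MonotoneCircuit} {t : ℕ} (hC : C.IsPiPlus t) :
    trivialCircuit.genus ≤ C.genus := by
  refine (hC.embedsInGenus_minor (H := trivialCircuit.graph) (fun _ => none) (by simp) rfl (by simp)
    ?_).minGenus_le
  intro a b hab
  exact absurd (Subtype.ext (Fin.ext ((trivialCircuit_ne_out a.2).trans
    (trivialCircuit_ne_out b.2).symm))) hab.ne

theorem hasWeightedSat_trivialCircuit : trivialCircuit.HasWeightedSat 1 := by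
  refine ⟨{(1 : Fin 2)}, ?_, Finset.card_singleton _, .and rfl fun u hu => ?_⟩
  · intro v hv
    rw [Finset.mem_singleton.1 hv]
    exact trivialCircuit_isVar.2 rfl
  · have h1 := (trivialCircuit_edge.1 hu).1
    exact .var (trivialCircuit_isVar.2 h1) (Finset.mem_singleton.2 (Fin.ext h1))

end MonotoneCircuit

namespace RawCircuit

variable {t k r : ℕ} {c : RawCircuit} {X T : List ℕ}

/-! ### Correctness of the branching -/

/-- The circuits that are produced for the assignment `X`. -/
def emitCircuits (t k : ℕ) (c : RawCircuit) (X : List ℕ) : List (MonotoneCircuit × ℕ) :=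
  if (c.crit (c.trueList t X)).length = 0 then [(trivialCircuit, 1)] else
    if (c.crit (c.trueList t X)).length ≤ 2 * (k - X.length) then
      [(c.residualCircuit t (c.trueList t X) (k - X.length), k - X.length)]
    else []

def finishCircuits (t k : ℕ) (c : RawCircuit) (A : List (List ℕ)) : List (MonotoneCircuit × ℕ) :=
  if k ≤ (c.verts.filter fun v => decide (c.kind v = 0)).length then
    A.flatMap (c.emitCircuits t k)
  else []

theorem IsPi.map_finishCircuits (h : c.IsPi t) (A : List (List ℕ)) :
    (c.finishCircuits t k A).map (fun I => (I.1.raw, I.2)) = c.finish t k A := by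
  have he : ∀ X, (c.emitCircuits t k X).map (fun I => (I.1.raw, I.2)) = c.emit t k X := by
    intro X
    simp only [emitCircuits, emit, decide_eq_true_eq]
    split_ifs
    · simp [MonotoneCircuit.raw_trivialCircuit]
    · simp [h.raw_residualCircuit]
    · rfl
  simp only [finishCircuits, finish, decide_eq_true_eq]
  split_ifs
  · rw [List.map_flatMap]
    exact List.flatMap_congr fun X _ => he X
  · rfl

theorem length_finishCircuits_le (A : List (List ℕ)) :
    (c.finishCircuits t k A).length ≤ A.length := by
  have he : ∀ X, (c.emitCircuits t k X).length ≤ 1 := by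
    intro X
    unfold emitCircuits
    split_ifs <;> simp
  unfold finishCircuits
  split_ifs
  · rw [List.length_flatMap]
    induction A with
    | nil => simp
    | cons X A ih =>
      have := he X
      simp only [List.map_cons, List.sum_cons, List.length_cons]
      omega
  · simp

/-- The invariant of the branching. -/
structure IsPartial (k : ℕ) (c : RawCircuit) (X : List ℕ) : Prop where
  nodup : X.Nodup
  isVar : ∀ x ∈ X, x < c.ord ∧ c.kind x = 0
  mand : ∀ x ∈ c.mand, x ∈ X
  length_le : X.length ≤ k

theorem IsPi.mem_mand (h : c.IsPi t) {x : ℕ} :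
    x ∈ c.mand ↔ c.kind x = 0 ∧ c.adj x c.out = true := by
  simp only [RawCircuit.mand, List.mem_filter, mem_verts, Bool.and_eq_true, decide_eq_true_eq]
  exact ⟨fun h => h.2, fun h' => ⟨(h.adj_lt h'.2).1, h'⟩⟩

theorem isPartial_mand (hk : c.mand.length ≤ k) : IsPartial k c c.mand := by
  refine ⟨List.Nodup.filter _ List.nodup_range, fun x hx => ?_, fun _ => id, hk⟩
  simp only [RawCircuit.mand, List.mem_filter, mem_verts, Bool.and_eq_true, decide_eq_true_eq] at hx
  exact ⟨hx.1, hx.2.1⟩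

theorem IsPi.exists_live_of_isCand (h : c.IsPi t) {x : ℕ} (hx : c.isCand t T r x = true) :
    ∃ q, c.Live T q ∧ c.adj x q = true := by
  have h3 := (isCand_iff.1 hx).2.2.1
  have hne : (c.crit T).filter (fun p => c.feeds t T x p) ≠ [] := fun e => by
    rw [deg, e] at h3
    simp at h3
  obtain ⟨p, hp⟩ := List.exists_mem_of_ne_nil _ hne
  obtain ⟨q, hq, -, hadj⟩ := h.feeds_iff.1 (List.mem_filter.1 hp).2
  exact ⟨q, hq, hadj⟩

theorem IsPi.not_mem_of_isCand (h : c.IsPi t) (hT : c.IsTrue X T) {x : ℕ}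
    (hx : c.isCand t T r x = true) : x ∉ X := fun hxX => by
  obtain ⟨q, hq, hadj⟩ := h.exists_live_of_isCand hx
  obtain ⟨hk, hxT, -⟩ := isCand_iff.1 hx
  exact hxT (hT.mem_of_var hk hxX hq hadj)

theorem IsPi.mem_children (h : c.IsPi t) {Y : List ℕ} : Y ∈ c.children t k X ↔
    X.length < k ∧ ∃ x, c.isCand t (c.trueList t X) (k - X.length) x = true ∧ Y = x :: X := by
  unfold children
  simp only [decide_eq_true_eq]
  split_ifs with hlt
  · simp only [hlt, true_and, List.mem_map, List.mem_filter, mem_verts]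
    constructor
    · rintro ⟨x, ⟨-, hx⟩, rfl⟩; exact ⟨x, hx, rfl⟩
    · rintro ⟨x, hx, rfl⟩
      obtain ⟨q, -, hadj⟩ := h.exists_live_of_isCand hx
      exact ⟨x, ⟨(h.adj_lt hadj).1, hx⟩, rfl⟩
  · simp [hlt]

theorem IsPi.isPartial_of_mem_children (h : c.IsPi t) (hX : IsPartial k c X) {Y : List ℕ}
    (hY : Y ∈ c.children t k X) : IsPartial k c Y := by
  obtain ⟨hlt, x, hx, rfl⟩ := h.mem_children.1 hY
  have hxX := h.not_mem_of_isCand (h.isTrue_trueList X) hx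
  obtain ⟨q, -, hadj⟩ := h.exists_live_of_isCand hx
  refine ⟨List.nodup_cons.2 ⟨hxX, hX.nodup⟩, ?_, fun y hy => .tail _ (hX.mand y hy), by simpa⟩
  intro y hy
  rcases List.mem_cons.1 hy with rfl | hy
  · exact ⟨(h.adj_lt hadj).1, (isCand_iff.1 hx).1⟩
  · exact hX.isVar y hy

theorem mem_branchStep {A : List (List ℕ)} {Y : List ℕ} : Y ∈ c.branchStep t k A ↔
    (c.mand.length ≤ k ∧ Y = c.mand) ∨ ∃ X ∈ A, Y ∈ c.children t k X := by
  simp only [branchStep, List.mem_append, List.mem_flatMap, decide_eq_true_eq]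
  refine or_congr ?_ Iff.rfl
  split_ifs with hk <;> simp [hk]

theorem IsPi.isPartial_of_mem (h : c.IsPi t) (i : ℕ) :
    ∀ X ∈ (c.branchStep t k)^[i] [], IsPartial k c X := by
  induction i with
  | zero => simp
  | succ i ih =>
    intro Y hY
    rw [Function.iterate_succ_apply'] at hY
    rcases mem_branchStep.1 hY with ⟨hk, rfl⟩ | ⟨X, hX, hY⟩
    · exact isPartial_mand hk
    · exact h.isPartial_of_mem_children (ih X hX) hY

theorem iterate_branchStep_subset {i j : ℕ} (hij : i ≤ j) :
    (c.branchStep t k)^[i] [] ⊆ (c.branchStep t k)^[j] [] := by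
  have hmono : ∀ {A B : List (List ℕ)}, A ⊆ B → c.branchStep t k A ⊆ c.branchStep t k B := by
    intro A B hAB Y hY
    rw [mem_branchStep] at hY ⊢
    exact hY.imp_right fun ⟨X, hX, hY⟩ => ⟨X, hAB hX, hY⟩
  have hstep : ∀ i, (c.branchStep t k)^[i] [] ⊆ (c.branchStep t k)^[i + 1] [] := by
    intro i
    induction i with
    | zero => simp
    | succ i ih =>
      rw [Function.iterate_succ_apply', Function.iterate_succ_apply' _ (i + 1)]
      exact hmono ih
  induction hij with
  | refl => exact List.Subset.refl _
  | step _ ih => exact List.Subset.trans ih (hstep _)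

/-- An or-gate or and-gate that is made true by `τ` is fed by a variable of `τ`. -/
theorem Live.exists_feeds (h : c.IsPi t) (hT : c.IsTrue X T) {τ : Set ℕ} {v : ℕ}
    (hsat : c.Sat τ v) (hv : c.Live T v) :
    ∃ x ∈ τ, x ∉ T ∧ c.kind x = 0 ∧ c.feeds t T x (c.root t v) = true := by
  have key : ∀ {u v}, c.Live T v → c.adj u v = true → u ∉ T → c.Sat τ u →
      (c.Live T u → ∃ x ∈ τ, x ∉ T ∧ c.kind x = 0 ∧ c.feeds t T x (c.root t u) = true) →
      ∃ x ∈ τ, x ∉ T ∧ c.kind x = 0 ∧ c.feeds t T x (c.root t v) = true := by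
    intro u v hv hadj huT hu ih
    by_cases hk : c.kind u = 0
    · cases hu with
      | var _ hu => exact ⟨u, hu, huT, hk, h.feeds_iff.2 ⟨v, hv, rfl, hadj⟩⟩
      | and hk' => rw [hk] at hk'; exact absurd hk' (by decide)
      | or hk' => rw [hk] at hk'; exact absurd hk' (by decide)
    · have hul : c.Live T u := .step hk huT hadj hv
      rw [← (hul.root_spec h).2.2.2 v hadj hv]
      exact ih hul
  induction hsat with
  | var hk _ => exact absurd hk hv.kind_ne
  | and hk hsub ih =>
    obtain ⟨u, hu, huT⟩ := hv.exists_input h hT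
    exact key hv hu huT (hsub u hu) (ih u hu)
  | or hk hu hsu ih => exact key hv hu (hv.input_not_mem hT hk hu) hsu ih

theorem IsPi.inputs_of_sat_out (h : c.IsPi t) {τ : Set ℕ} (hsat : c.Sat τ c.out) {u : ℕ}
    (hu : c.adj u c.out = true) : c.Sat τ u := by
  have hko := h.kind_out
  generalize c.out = o at hsat hko hu
  cases hsat with
  | var hk => rw [hko] at hk; exact absurd hk (by decide)
  | and _ h' => exact h' u hu
  | or hk => rw [hko] at hk; exact absurd hk (by decide)

/-- If a solution contains no candidates, there are few critical gates. -/
theorem IsPi.length_crit_le (h : c.IsPi t) (hT : c.IsTrue X T) (hnd : X.Nodup) {τ : Finset ℕ}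
    (hX : ∀ x ∈ X, x ∈ τ) (hcard : τ.card ≤ X.length + r)
    (hcand : ∀ x ∈ τ, ¬ c.isCand t T r x = true) (hsat : c.Sat (τ : Set ℕ) c.out) :
    (c.crit T).length ≤ 2 * r := by
  classical
  by_contra hn
  rw [not_le] at hn
  -- The variables of the solution that can still reach a live gate. Those of `X` that do lie in
  -- `T`, so at most `r` remain.
  let σ := τ.filter fun x => x ∉ T ∧ c.kind x = 0 ∧ ∃ q, c.Live T q ∧ c.adj x q = true
  have hσ : σ.card ≤ r := by
    have h1 : σ ⊆ τ \ X.toFinset := by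
      intro x hx
      obtain ⟨h1, h2, h3, q, hq, hadj⟩ := Finset.mem_filter.1 hx
      refine Finset.mem_sdiff.2 ⟨h1, fun hxX => ?_⟩
      exact h2 (hT.mem_of_var h3 (List.mem_toFinset.1 hxX) hq hadj)
    have h2 : X.toFinset ⊆ τ := fun x hx => hX x (List.mem_toFinset.1 hx)
    have h3 := Finset.card_le_card h1
    rw [Finset.card_sdiff_of_subset h2, List.toFinset_card_of_nodup hnd] at h3
    omega
  have hcnd : (c.crit T).Nodup := List.Nodup.filter _ List.nodup_range
  have hm : (c.crit T).length ≤ ∑ x ∈ σ, c.deg t T x := by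
    rw [← List.toFinset_card_of_nodup hcnd]
    have hsub : (c.crit T).toFinset ⊆
        σ.biUnion fun x => ((c.crit T).filter fun p => c.feeds t T x p).toFinset := by
      intro p hp
      have hp := List.mem_toFinset.1 hp
      have hl := live_of_mem_crit hp
      obtain ⟨x, hx, hxT, hxk, hf⟩ := hl.exists_feeds h hT
        (h.inputs_of_sat_out hsat (mem_crit.1 hp).2.2.1)
      rw [(hl.root_spec h).2.2.1 (mem_crit.1 hp).2.2.1] at hf
      obtain ⟨q, hq, -, hadj⟩ := h.feeds_iff.1 hf
      exact Finset.mem_biUnion.2 ⟨x, Finset.mem_filter.2 ⟨hx, hxT, hxk, q, hq, hadj⟩,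
        List.mem_toFinset.2 (List.mem_filter.2 ⟨hp, hf⟩)⟩
    refine (Finset.card_le_card hsub).trans (Finset.card_biUnion_le.trans ?_)
    exact Finset.sum_le_sum fun x _ => List.toFinset_card_le _
  -- If the degree is at least 3, the second threshold must fail; otherwise `deg * r ≤ 2 * r < m`.
  have hlt : ∀ x ∈ σ, c.deg t T x * r < (c.crit T).length := by
    intro x hx
    obtain ⟨h1, h2, h3, -⟩ := Finset.mem_filter.1 hx
    by_contra hge
    refine hcand x h1 (isCand_iff.2 ⟨h3, h2, ?_, not_lt.1 hge⟩)
    by_contra h4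
    have : c.deg t T x * r ≤ 2 * r := Nat.mul_le_mul_right _ (by omega)
    omega
  have hne : σ.Nonempty := by
    rw [Finset.nonempty_iff_ne_empty]
    intro e
    rw [e, Finset.sum_empty] at hm
    omega
  -- The contradiction by averaging: `m r ≤ ∑ deg x * r < |σ| m ≤ r m`.
  have h1 : (c.crit T).length * r ≤ ∑ x ∈ σ, c.deg t T x * r := by
    rw [← Finset.sum_mul]
    exact Nat.mul_le_mul_right _ hm
  have h2 : ∑ x ∈ σ, c.deg t T x * r < ∑ _x ∈ σ, (c.crit T).length :=
    Finset.sum_lt_sum_of_nonempty hne hlt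
  rw [Finset.sum_const, smul_eq_mul] at h2
  have h3 : σ.card * (c.crit T).length ≤ r * (c.crit T).length := Nat.mul_le_mul_right _ hσ
  rw [mul_comm] at h1
  omega

/-- The solution guides a walk down the search tree: as long as it contains a candidate, that
candidate is added to `X`. This stops by depth `k`, and where it contains none, the emitted instance
is a yes-instance. -/
theorem IsPi.exists_mem_emitCircuits (h : c.IsPi t) {τ : Finset ℕ} (hcard : τ.card ≤ k)
    (hsat : c.Sat (τ : Set ℕ) c.out) :
    ∃ X ∈ (c.branchStep t k)^[k + 1] [], ∃ I ∈ c.emitCircuits t k X, I.1.HasWeightedSat I.2 := by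
  classical
  have main : ∀ n X i, X ∈ (c.branchStep t k)^[i] [] → (∀ x ∈ X, x ∈ τ) → k - X.length = n →
      i + n ≤ k + 1 → ∃ X ∈ (c.branchStep t k)^[k + 1] [],
        ∃ I ∈ c.emitCircuits t k X, I.1.HasWeightedSat I.2 := by
    intro n
    induction n with
    | zero => ?_
    | succ n ih => ?_
    all_goals
      intro X i hXi hXτ hn hi
      have hX := h.isPartial_of_mem i X hXi
      have hT := h.isTrue_trueList (t := t) X
      have hcard' : τ.card ≤ X.length + (k - X.length) := by
        have := hX.length_le
        omega
      by_cases hc : ∃ x ∈ τ, c.isCand t (c.trueList t X) (k - X.length) x = true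
      · obtain ⟨x, hx, hxc⟩ := hc
        have hxX := h.not_mem_of_isCand hT hxc
        have hlt : X.length < k := by
          have : (insert x X.toFinset).card ≤ τ.card := by
            refine Finset.card_le_card fun y hy => ?_
            rcases Finset.mem_insert.1 hy with rfl | hy
            · exact hx
            · exact hXτ y (List.mem_toFinset.1 hy)
          rw [Finset.card_insert_of_notMem (by simpa using hxX),
            List.toFinset_card_of_nodup hX.nodup] at this
          omega
        -- For `n = 0` no further variable can be chosen, contrary to `hlt`.
        first
        | omega
        | refine ih (x :: X) (i + 1) ?_ ?_ ?_ ?_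
          · rw [Function.iterate_succ_apply']
            exact mem_branchStep.2 (.inr ⟨X, hXi, h.mem_children.2 ⟨hlt, x, hxc, rfl⟩⟩)
          · intro y hy
            rcases List.mem_cons.1 hy with rfl | hy
            · exact hx
            · exact hXτ y hy
          · rw [List.length_cons]; omega
          · omega
      · push Not at hc
        refine ⟨X, iterate_branchStep_subset (by omega) hXi, ?_⟩
        by_cases h0 : (c.crit (c.trueList t X)).length = 0
        · refine ⟨(trivialCircuit, 1), ?_, MonotoneCircuit.hasWeightedSat_trivialCircuit⟩
          simp [emitCircuits, h0]
        · have hle := h.length_crit_le hT hX.nodup hXτ hcard' (by simpa using hc) hsat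
          refine ⟨(c.residualCircuit t (c.trueList t X) (k - X.length), k - X.length), ?_, ?_⟩
          · rw [emitCircuits, if_neg h0, if_pos hle]
            exact List.mem_singleton_self _
          · exact h.residual_of_sat hT (by simpa using h0) hX.nodup hXτ hcard' (by simpa using hc)
              hsat
  have hmand : ∀ x ∈ c.mand, x ∈ τ := by
    intro x hx
    obtain ⟨hk, hadj⟩ := h.mem_mand.1 hx
    cases h.inputs_of_sat_out hsat hadj with
    | var _ hx => exact hx
    | and hk' => rw [hk] at hk'; exact absurd hk' (by decide)
    | or hk' => rw [hk] at hk'; exact absurd hk' (by decide)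
  have hlen : c.mand.length ≤ k := by
    have hnd : c.mand.Nodup := List.Nodup.filter _ List.nodup_range
    rw [← List.toFinset_card_of_nodup hnd]
    exact (Finset.card_le_card fun x hx => hmand x (List.mem_toFinset.1 hx)).trans hcard
  refine main _ c.mand 1 ?_ hmand rfl (by omega)
  exact mem_branchStep.2 (.inl ⟨hlen, rfl⟩)

theorem IsPi.sat_of_crit_eq_nil (h : c.IsPi t) (hT : c.IsTrue X T) (hmand : ∀ x ∈ c.mand, x ∈ X)
    (h0 : c.crit T = []) : c.Sat {x | x ∈ X} c.out := by
  refine .and h.kind_out fun u hu => ?_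
  by_cases hk : c.kind u = 0
  · exact .var hk (hmand u (h.mem_mand.2 ⟨hk, hu⟩))
  · by_contra hn
    have : u ∈ c.crit T := (Live.top hk (fun huT => hn (hT.sound u huT)) hu).mem_crit h hu
    rw [h0] at this
    simp at this

/-- Ensures that the trivial instance, whose parameter is 1, is never emitted for `k = 0`. -/
theorem IsPi.not_sat_empty (h : c.IsPi t) {v : ℕ} : ¬ c.Sat {x | x ∈ ([] : List ℕ)} v := by
  intro hv
  induction hv with
  | var _ hx => simp at hx
  | @and v hk _ ih =>
    obtain ⟨u, hu⟩ := h.exists_adj (v := v) (by omega)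
    exact ih u hu
  | or _ _ _ ih => exact ih

theorem IsPi.sat_of_mem_emitCircuits (h : c.IsPi t) (hX : IsPartial k c X)
    {I : MonotoneCircuit × ℕ} (hI : I ∈ c.emitCircuits t k X) (hsat : I.1.HasWeightedSat I.2) :
    ∃ τ : Finset ℕ, (∀ x ∈ τ, x < c.ord ∧ c.kind x = 0) ∧ τ.card ≤ k ∧
      c.Sat (τ : Set ℕ) c.out := by
  classical
  have hT := h.isTrue_trueList X
  unfold emitCircuits at hI
  split_ifs at hI with h0 h1
  · refine ⟨X.toFinset, fun x hx => hX.isVar x (List.mem_toFinset.1 hx),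
      (List.toFinset_card_le _).trans hX.length_le, ?_⟩
    refine (h.sat_of_crit_eq_nil hT hX.mand (by simpa using h0)).mono fun x hx => ?_
    simpa using hx
  · rw [List.mem_singleton] at hI
    subst hI
    obtain ⟨τ, h2, h3, h4⟩ := h.sat_of_residual hT hX.mand hX.isVar hsat
    exact ⟨τ, h2, h3.trans (by have := hX.length_le; omega), h4⟩
  · simp at hI

end RawCircuit

theorem MonotoneCircuit.IsPiPlus.emitCircuits_spec {C : MonotoneCircuit} {t k : ℕ}
    (hC : C.IsPiPlus t) (ht : 1 ≤ t) {X : List ℕ} (hX : C.raw.IsPartial k X)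
    {I : MonotoneCircuit × ℕ} (hI : I ∈ C.raw.emitCircuits t k X) :
    I.1.IsPiPlus t ∧ I.1.IsSimplified ∧ I.2 ≤ k ∧ I.1.numCritical ≤ 2 * I.2 ∧
      (∀ x, I.1.IsVar x → I.1.numSubtreesFed x ≤ 2) ∧ I.1.genus ≤ C.genus := by
  have h := hC.isPi
  have hT := h.isTrue_trueList X
  unfold RawCircuit.emitCircuits at hI
  split_ifs at hI with h0 h1
  · rw [List.mem_singleton] at hI
    subst hI
    refine ⟨isPiPlus_trivialCircuit ht, isSimplified_trivialCircuit, ?_,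
      by simp [numCritical_trivialCircuit], fun x _ => ?_, hC.genus_trivialCircuit_le⟩
    · by_contra hk
      have : X = [] := List.length_eq_zero_iff.1 (by have := hX.length_le; omega)
      subst this
      exact h.not_sat_empty (h.sat_of_crit_eq_nil hT hX.mand (by simpa using h0))
    · exact (numSubtreesFed_trivialCircuit x).le.trans (Nat.zero_le _)
  · rw [List.mem_singleton] at hI
    subst hI
    exact ⟨h.isPiPlus_residual hT (by simpa using h0), h.isSimplified_residual hT,
      Nat.sub_le _ _, h.numCritical_residual.trans h1, fun x hx => h.numSubtreesFed_residual h1 hx,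
      hC.genus_residual_le⟩
  · simp at hI

/-- The list of instances that is produced by the algorithm is correct. -/
theorem MonotoneCircuit.IsPiPlus.isValid_finishCircuits {C : MonotoneCircuit} {t k M : ℕ}
    (hC : C.IsPiPlus t) (ht : 1 ≤ t)
    (hM : ((C.raw.branchStep t k)^[k + 1] []).length ≤ M) :
    (Outcome.reduced (C.raw.finishCircuits t k ((C.raw.branchStep t k)^[k + 1] []))).IsValid
      t C k M := by
  have h := hC.isPi
  refine ⟨(RawCircuit.length_finishCircuits_le _).trans hM, ?_, ?_⟩
  · rw [hasWeightedSat_iff]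
    unfold RawCircuit.finishCircuits
    constructor
    · rintro ⟨hk, τ, hτ, hcard, hsat⟩
      obtain ⟨X, hX, I, hI, hsat⟩ := h.exists_mem_emitCircuits hcard hsat
      rw [if_pos hk]
      exact ⟨I, List.mem_flatMap.2 ⟨X, hX, hI⟩, hsat⟩
    · rintro ⟨I, hI, hsat⟩
      split_ifs at hI with hk
      · obtain ⟨X, hX, hI⟩ := List.mem_flatMap.1 hI
        exact ⟨hk, h.sat_of_mem_emitCircuits (h.isPartial_of_mem _ X hX) hI hsat⟩
      · simp at hI
  · intro I hI
    unfold RawCircuit.finishCircuits at hI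
    split_ifs at hI
    · obtain ⟨X, hX, hI⟩ := List.mem_flatMap.1 hI
      exact hC.emitCircuits_spec ht (h.isPartial_of_mem _ X hX) hI
    · simp at hI

/-! ### The number of candidates -/

/-- Contracting the live gates below each critical gate to a point and keeping only the candidates
besides gives a bipartite minor, whose edges are the feeding pairs. Candidates have degree at least
3 in it, so Euler's bound for bipartite graphs applies. -/
theorem MonotoneCircuit.IsPiPlus.sum_deg_le {C : MonotoneCircuit} {t : ℕ} (hC : C.IsPiPlus t)
    (T : List ℕ) (r : ℕ) {S : Finset ℕ} (hS : ∀ x, x ∈ S ↔ C.raw.isCand t T r x = true) :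
    ∑ x ∈ S, C.raw.deg t T x ≤ 2 * ((C.raw.crit T).length + S.card) + 4 * C.genus := by
  classical
  have h := hC.isPi
  let U : Finset ℕ := (C.raw.crit T).toFinset
  have hU : ∀ p, p ∈ U ↔ p ∈ C.raw.crit T := fun p => List.mem_toFinset
  have hcnd : (C.raw.crit T).Nodup := List.Nodup.filter _ List.nodup_range
  have hdisj : ∀ x, x ∈ S → x ∉ U := by
    intro x hx hxU
    have h1 := (RawCircuit.isCand_iff.1 ((hS x).1 hx)).1
    have h2 := (RawCircuit.mem_crit.1 ((hU x).1 hxU)).2.1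
    omega
  let H : SimpleGraph {v : ℕ // v ∈ U ∪ S} := SimpleGraph.fromRel fun a b =>
    a.1 ∈ S ∧ b.1 ∈ U ∧ C.raw.feeds t T a.1 b.1 = true
  have hHadj : ∀ a b, H.Adj a b ↔ (a.1 ∈ S ∧ b.1 ∈ U ∧ C.raw.feeds t T a.1 b.1 = true) ∨
      (b.1 ∈ S ∧ a.1 ∈ U ∧ C.raw.feeds t T b.1 a.1 = true) := by
    intro a b
    simp only [H, SimpleGraph.fromRel_adj, and_iff_right_iff_imp]
    rintro (⟨h1, h2, -⟩ | ⟨h1, h2, -⟩) rfl <;> exact hdisj _ h1 h2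
  have hcandS : ∀ x, x ∈ S → ¬ C.raw.Live T x := fun x hx hl =>
    hl.kind_ne (RawCircuit.isCand_iff.1 ((hS x).1 hx)).1
  let f : ℕ → Option {v : ℕ // v ∈ U ∪ S} := fun v =>
    if hv : C.raw.Live T v then
      some ⟨C.raw.root t v, Finset.mem_union_left _ ((hU _).2 (hv.root_mem_crit h))⟩
    else if hv : v ∈ S then some ⟨v, Finset.mem_union_right _ hv⟩ else none
  have hlive : ∀ {v w}, C.raw.Live T v → (f v = some w ↔ w.1 = C.raw.root t v) := by
    intro v w hv
    simp only [f, dif_pos hv, Option.some.injEq, Subtype.ext_iff]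
    exact eq_comm
  have hS' : ∀ {v w}, v ∈ S → (f v = some w ↔ w.1 = v) := by
    intro v w hv
    simp only [f, dif_neg (hcandS v hv), dif_pos hv, Option.some.injEq, Subtype.ext_iff]
    exact eq_comm
  have hf : ∀ {v w}, f v = some w → C.raw.Live T v ∨ v ∈ S := by
    intro v w hv
    by_contra hn
    rw [not_or] at hn
    simp only [f, dif_neg hn.1, dif_neg hn.2] at hv
    exact absurd hv (by simp)
  have hroot : ∀ {v}, C.raw.Live T v → C.raw.root t v ∈ U := fun hv =>
    (hU _).2 (hv.root_mem_crit h)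
  have hembed : H.EmbedsInGenus C.genus := by
    refine hC.embedsInGenus_minor f ?_ ?_ ?_ ?_
    · intro v w hv
      rcases hf hv with hv | hv
      · exact hv.lt h
      · obtain ⟨q, -, hadj⟩ := h.exists_live_of_isCand ((hS v).1 hv)
        exact (h.adj_lt hadj).1
    · rw [Option.eq_none_iff_forall_ne_some]
      intro w hw
      rcases hf hw with hv | hv
      · exact hv.ne_out h rfl
      · have := (RawCircuit.isCand_iff.1 ((hS _).1 hv)).1
        rw [h.kind_out] at this
        exact absurd this (by decide)
    · intro u v w hu hv
      have key : ∀ u, C.raw.Live T u → f u = some w → Relation.EqvGen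
          (fun x y => C.raw.adj x y = true ∧ f x = some w ∧ f y = some w) u w.1 := by
        intro u hul hu
        induction hul with
        | @top u hk hT hadj =>
          have hl : C.raw.Live T u := .top hk hT hadj
          rw [hlive hl, (hl.root_spec h).2.2.1 hadj] at hu
          rw [hu]
          exact .refl _
        | @step u q hk hT hadj hq ih =>
          have hl : C.raw.Live T u := .step hk hT hadj hq
          have hfq : f q = some w := by
            rw [hlive hq, ← (hl.root_spec h).2.2.2 q hadj hq]
            exact (hlive hl).1 hu
          exact .trans _ _ _ (.rel _ _ ⟨hadj, hu, hfq⟩) (ih hfq)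
      rcases hf hu with h1 | h1 <;> rcases hf hv with h2 | h2
      · exact .trans _ _ _ (key u h1 hu) ((key v h2 hv).symm _ _)
      · have e1 := (hlive h1).1 hu
        have e2 := (hS' h2).1 hv
        exact absurd (e1 ▸ hroot h1) (hdisj _ (e2 ▸ h2))
      · have e1 := (hS' h1).1 hu
        have e2 := (hlive h2).1 hv
        exact absurd (e2 ▸ hroot h2) (hdisj _ (e1 ▸ h1))
      · rw [← (hS' h1).1 hu, ← (hS' h2).1 hv]
        exact .refl _
    · have key : ∀ a b : {v : ℕ // v ∈ U ∪ S}, a.1 ∈ S → b.1 ∈ U →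
          C.raw.feeds t T a.1 b.1 = true →
          ∃ q, f a.1 = some a ∧ f q = some b ∧ C.raw.adj a.1 q = true := by
        intro a b ha _ hab
        obtain ⟨q, hq, hr, hadj⟩ := h.feeds_iff.1 hab
        exact ⟨q, (hS' ha).2 rfl, (hlive hq).2 hr.symm, hadj⟩
      intro a b hab
      rcases (hHadj a b).1 hab with ⟨h1, h2, h3⟩ | ⟨h1, h2, h3⟩
      · obtain ⟨q, h4, h5, h6⟩ := key a b h1 h2 h3
        exact ⟨_, q, h4, h5, .inl h6⟩
      · obtain ⟨q, h4, h5, h6⟩ := key b a h1 h2 h3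
        exact ⟨q, _, h5, h4, .inr h6⟩
  have hnbr : ∀ x, ∀ p ∈ (C.raw.crit T).filter (fun p => C.raw.feeds t T x p),
      p ∈ U ∧ C.raw.feeds t T x p = true := by
    intro x p hp
    obtain ⟨h1, h2⟩ := List.mem_filter.1 hp
    exact ⟨(hU p).2 h1, h2⟩
  have hedges := hembed.card_edgeSet_le_of_bipartite {a | a.1 ∈ S} ?_ ?_
  · have hcard : Nat.card {v : ℕ // v ∈ U ∪ S} ≤ (C.raw.crit T).length + S.card := by
      rw [Nat.card_eq_fintype_card, Fintype.card_coe]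
      exact (Finset.card_union_le _ _).trans
        (Nat.add_le_add_right (List.toFinset_card_le _) _)
    have hsum : ∑ x ∈ S, C.raw.deg t T x ≤ Nat.card H.edgeSet := by
      let P : Finset (Σ _ : ℕ, ℕ) := S.sigma fun x =>
        ((C.raw.crit T).filter fun p => C.raw.feeds t T x p).toFinset
      have hP : ∑ x ∈ S, C.raw.deg t T x = P.card := by
        rw [Finset.card_sigma]
        refine Finset.sum_congr rfl fun x _ => ?_
        rw [List.toFinset_card_of_nodup (hcnd.filter _)]
        rfl
      have hPm : ∀ y : P, y.1.1 ∈ S ∧ y.1.2 ∈ U ∧ C.raw.feeds t T y.1.1 y.1.2 = true := by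
        intro y
        obtain ⟨h1, h2⟩ := Finset.mem_sigma.1 y.2
        exact ⟨h1, hnbr _ _ (List.mem_toFinset.1 h2)⟩
      let F : P → H.edgeSet := fun y =>
        ⟨s(⟨y.1.1, Finset.mem_union_right _ (hPm y).1⟩,
          ⟨y.1.2, Finset.mem_union_left _ (hPm y).2.1⟩),
          (SimpleGraph.mem_edgeSet _).2 ((hHadj _ _).2 (.inl (hPm y)))⟩
      have hF : Function.Injective F := by
        intro y z hyz
        have e := congrArg Subtype.val hyz
        simp only [F, Sym2.eq_iff, Subtype.mk.injEq] at e
        rcases e with ⟨e1, e2⟩ | ⟨e1, -⟩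
        · exact Subtype.ext (Sigma.ext e1 (heq_of_eq e2))
        · exact absurd (e1 ▸ (hPm z).2.1) (hdisj _ (hPm y).1)
      rw [hP, ← Fintype.card_coe, ← Nat.card_eq_fintype_card]
      exact Nat.card_le_card_of_injective F hF
    omega
  · intro a b hab
    simp only [Set.mem_ofPred_eq]
    rcases (hHadj a b).1 hab with ⟨h1, h2, -⟩ | ⟨h1, h2, -⟩
    · exact iff_of_true h1 fun hb => hdisj _ hb h2
    · exact iff_of_false (fun ha => hdisj _ ha h2) (not_not.2 h1)
  · intro a ha b _
    have h3 := (RawCircuit.isCand_iff.1 ((hS _).1 ha)).2.2.1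
    have h2 : 1 < ((C.raw.crit T).filter fun p => C.raw.feeds t T a.1 p).toFinset.card := by
      rw [List.toFinset_card_of_nodup (hcnd.filter _)]
      exact lt_of_lt_of_le (by omega) h3
    obtain ⟨p, hp, hne⟩ := Finset.exists_mem_ne h2 b.1
    have hp := hnbr _ _ (List.mem_toFinset.1 hp)
    exact ⟨⟨p, Finset.mem_union_left _ hp.1⟩, fun e => hne (congrArg Subtype.val e),
      (hHadj _ _).2 (.inl ⟨ha, hp⟩)⟩

/-- Let `s` be the number of candidates. From `3 s ≤ ∑ deg ≤ 2 (m + s) + 4 g` one gets `s ≤ 2 m + 4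
g` and `∑ deg ≤ 6 m + 12 g`. The second threshold gives `s m ≤ r ∑ deg`, and division by `m`
finishes. -/
theorem MonotoneCircuit.IsPiPlus.card_cand_le {C : MonotoneCircuit} {t : ℕ} (hC : C.IsPiPlus t)
    (T : List ℕ) (r : ℕ) :
    (C.raw.verts.filter fun x => C.raw.isCand t T r x).length ≤ 6 * r + 12 * r * C.genus := by
  classical
  have h := hC.isPi
  set S := (C.raw.verts.filter fun x => C.raw.isCand t T r x).toFinset with hSdef
  have hS : ∀ x, x ∈ S ↔ C.raw.isCand t T r x = true := by
    intro x
    rw [hSdef, List.mem_toFinset, List.mem_filter, RawCircuit.mem_verts, and_iff_right_iff_imp]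
    intro hx
    obtain ⟨q, -, hadj⟩ := h.exists_live_of_isCand hx
    exact (h.adj_lt hadj).1
  have hlen : S.card = (C.raw.verts.filter fun x => C.raw.isCand t T r x).length :=
    List.toFinset_card_of_nodup (List.Nodup.filter _ List.nodup_range)
  rw [← hlen]
  have hsum := hC.sum_deg_le T r hS
  set m := (C.raw.crit T).length
  set g := C.genus
  have h3 : S.card * 3 ≤ ∑ x ∈ S, C.raw.deg t T x := by
    rw [← smul_eq_mul, ← Finset.sum_const]
    exact Finset.sum_le_sum fun x hx => (RawCircuit.isCand_iff.1 ((hS x).1 hx)).2.2.1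
  have hm : S.card * m ≤ (∑ x ∈ S, C.raw.deg t T x) * r := by
    rw [← smul_eq_mul, ← Finset.sum_const, Finset.sum_mul]
    exact Finset.sum_le_sum fun x hx => (RawCircuit.isCand_iff.1 ((hS x).1 hx)).2.2.2
  have h4 : ∑ x ∈ S, C.raw.deg t T x ≤ 6 * m + 12 * g := by omega
  have h5 : S.card * m ≤ (6 * m + 12 * g) * r := hm.trans (Nat.mul_le_mul_right _ h4)
  rcases S.eq_empty_or_nonempty with h0 | ⟨x, hx⟩
  · rw [h0]; simp
  · have hm1 : 1 ≤ m := by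
      have := (RawCircuit.isCand_iff.1 ((hS x).1 hx)).2.2.1
      have h6 : C.raw.deg t T x ≤ m := List.length_filter_le _ _
      omega
    have h6 : S.card * m ≤ (6 * r + 12 * r * g) * m := by
      refine h5.trans ?_
      have : 12 * g * r ≤ 12 * r * g * m := by
        rw [show 12 * g * r = 12 * r * g by ring]
        exact Nat.le_mul_of_pos_right _ hm1
      nlinarith
    exact Nat.le_of_mul_le_mul_right h6 hm1

/-- Takes over where the genus is not small in terms of `k`; there the number of variables is
bounded by a function of `k`. -/
theorem MonotoneCircuit.card_cand_le_numVars (C : MonotoneCircuit) (t : ℕ)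
    (T : List ℕ) (r : ℕ) :
    (C.raw.verts.filter fun x => C.raw.isCand t T r x).length ≤ C.numVars := by
  rw [numVars_eq, ← List.countP_eq_length_filter, ← List.countP_eq_length_filter]
  refine List.countP_mono_left fun x _ hx => ?_
  simpa using (RawCircuit.isCand_iff.1 hx).1

/-- The number of assignments that are produced by the branching. -/
theorem MonotoneCircuit.IsPiPlus.length_iterate_branchStep_le {C : MonotoneCircuit} {t : ℕ}
    (hC : C.IsPiPlus t) (k i : ℕ) : ((C.raw.branchStep t k)^[i] []).length ≤
      (min (6 * k + 12 * k * C.genus) C.numVars + 1) ^ i := by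
  set B := min (6 * k + 12 * k * C.genus) C.numVars with hB
  have hch : ∀ X, (C.raw.children t k X).length ≤ B := by
    intro X
    unfold RawCircuit.children
    split_ifs
    · rw [List.length_map]
      refine le_min ((hC.card_cand_le _ _).trans ?_) (C.card_cand_le_numVars _ _ _)
      gcongr <;> omega
    · simp
  induction i with
  | zero => simp
  | succ i ih =>
    rw [Function.iterate_succ_apply']
    unfold RawCircuit.branchStep at ih ⊢
    rw [List.length_append, List.length_flatMap]
    have h1 : (if decide (C.raw.mand.length ≤ k) = true then [C.raw.mand] else []).length ≤ 1 := by
      split_ifs <;> simp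
    generalize (fun A : List (List ℕ) => (if decide (C.raw.mand.length ≤ k) = true then
      [C.raw.mand] else []) ++ A.flatMap (C.raw.children t k))^[i] [] = A at ih ⊢
    have h2 : (A.map fun X => (C.raw.children t k X).length).sum ≤ A.length * B := by
      induction A with
      | nil => simp
      | cons X A ihA =>
        have := hch X
        have h3 := ihA (le_trans (by simp) ih)
        simp only [List.map_cons, List.sum_cons, List.length_cons]
        linarith [Nat.succ_mul A.length B]
    -- The root of the search tree is paid for by the summand 1 in the new factor: `1 + (B + 1)^i *
    -- B ≤ (B + 1)^(i + 1)`.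
    have h3 : 1 ≤ (B + 1) ^ i := Nat.one_le_pow _ _ (by omega)
    have h4 : A.length * B ≤ (B + 1) ^ i * B := Nat.mul_le_mul_right _ ih
    rw [pow_succ, mul_add, mul_one]
    omega

open Polynomial in
-- Bounding all monomials by the highest power separates a factor depending on `k` from a fixed
-- power of the input size.
theorem Polynomial.eval_nat_le (P : ℕ[X]) {n : ℕ} (hn : 1 ≤ n) :
    P.eval n ≤ P.eval 1 * n ^ P.natDegree := by
  rw [eval_eq_sum_range, eval_eq_sum_range, Finset.sum_mul]
  refine Finset.sum_le_sum fun i hi => ?_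
  rw [one_pow, mul_one]
  exact Nat.mul_le_mul_left _ (Nat.pow_le_pow_right hn (by simpa [Nat.lt_succ_iff] using hi))

/-! ### The program -/

open Polynomial in
/-- The running time is polynomial in the size of the input and the number of assignments that are
produced by the branching. -/
theorem exists_prog (t : ℕ) : ∃ (p : Prog) (Q : ℕ[X]), ∀ (C : MonotoneCircuit) (k M : ℕ),
    C.IsPiPlus t → (∀ i ≤ k + 1, ((C.raw.branchStep t k)^[i] []).length ≤ M) →
    ∃ T, p.Runs (encodeInstance (C, k)) (Outcome.reduced
        (C.raw.finishCircuits t k ((C.raw.branchStep t k)^[k + 1] []))).encode T ∧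
      T ≤ Q.eval ((encodeInstance (C, k)).size + M) := by
  obtain ⟨p₁, P₁, h₁⟩ := ((PolyTime.snd (α := RawCircuit) (β := ℕ)).succ.replicate).pair
    ((PolyTime.const ([] : List (List ℕ))).pair PolyTime.id)
  -- The state carries the instance unchanged next to the list of assignments; folding over `k + 1`
  -- units counts the rounds.
  let step : List (List ℕ) × (RawCircuit × ℕ) → Unit → List (List ℕ) × (RawCircuit × ℕ) :=
    fun s _ => (s.2.1.branchStep t s.2.2 s.1, s.2)
  have hstep : PolyTime fun p : (List (List ℕ) × (RawCircuit × ℕ)) × Unit => step p.1 p.2 := by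
    have h2 : PolyTime fun p : (List (List ℕ) × (RawCircuit × ℕ)) × Unit => p.1.2 :=
      PolyTime.snd.comp PolyTime.fst
    exact (RawCircuit.polyTime_branchStep t (PolyTime.snd.comp h2) (PolyTime.fst.comp h2)
      (PolyTime.fst.comp PolyTime.fst)).pair h2
  obtain ⟨p₂, P₂, h₂⟩ := exists_foldl_prog hstep
  have hfin : PolyTime fun s : List (List ℕ) × (RawCircuit × ℕ) =>
      (true, s.2.1.finish t s.2.2 s.1) :=
    (PolyTime.const true).pair (RawCircuit.polyTime_finish t (PolyTime.snd.comp PolyTime.snd)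
      (PolyTime.fst.comp PolyTime.snd) PolyTime.fst)
  obtain ⟨p₃, P₃, h₃⟩ := hfin
  -- The size of a state: at most `K` assignments, each with at most `K` entries of size at most `2
  -- * K + 1`, together with the instance.
  let S : ℕ[X] := X * (X * (2 * X + 2) + 2) + X + 2
  refine ⟨.seq p₁ (.seq p₂ p₃), X + P₁ + (P₁ + P₂.comp (X + 2 + S) + P₃.comp S), ?_⟩
  intro C k M hC hM
  have h := hC.isPi
  set K := (encodeInstance (C, k)).size + M with hK
  have hN : sz (C.raw, k) = (encodeInstance (C, k)).size := by
    rw [← C.enc_raw_pair]; rfl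
  have hszk : sz k + C.raw.ord ≤ (encodeInstance (C, k)).size := by
    rw [← hN, sz_prod]
    have h1 : sz C.raw = sz C.raw.1 + sz C.raw.2 + 1 := rfl
    have h2 : C.raw.ord < sz C.raw.2 := length_lt_sz C.raw.2
    omega
  rw [sz_nat] at hszk
  have hiter : ∀ j, (fun s => step s ())^[j] ([], (C.raw, k)) =
      ((C.raw.branchStep t k)^[j] [], (C.raw, k)) := by
    intro j
    induction j with
    | zero => rfl
    | succ j ih => rw [Function.iterate_succ_apply', ih, Function.iterate_succ_apply']
  have hfold : ∀ l : List Unit, l.foldl step ([], (C.raw, k)) =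
      ((C.raw.branchStep t k)^[l.length] [], (C.raw, k)) := by
    intro l
    rw [← hiter]
    exact foldl_const_eq_iterate (fun s => step s ()) _ l
  have hsize : ∀ j ≤ k + 1, sz ((C.raw.branchStep t k)^[j] [], (C.raw, k)) ≤ S.eval K := by
    intro j hj
    have hX : ∀ X ∈ (C.raw.branchStep t k)^[j] [], sz X ≤ K * (2 * K + 2) + 1 := by
      intro X hX
      have hp := h.isPartial_of_mem j X hX
      have h1 : ∀ x ∈ X, sz x ≤ 2 * K + 1 := by
        intro x hx
        have := (hp.isVar x hx).1
        rw [sz_nat]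
        omega
      refine (sz_le_of_forall h1).trans ?_
      have : X.length ≤ K := hp.length_le.trans (by omega)
      gcongr
    have h2 : sz ((C.raw.branchStep t k)^[j] []) ≤ K * (K * (2 * K + 2) + 1 + 1) + 1 := by
      refine (sz_le_of_forall hX).trans ?_
      have := hM j hj
      gcongr
      omega
    rw [sz_prod, hN]
    simp only [S, eval_add, eval_mul, eval_X, eval_ofNat]
    generalize K * (2 * K + 2) = B at h2 ⊢
    rw [show B + 1 + 1 = B + 2 from rfl] at h2
    omega
  obtain ⟨T₁, hT₁, hT₁'⟩ := h₁ (C.raw, k)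
  obtain ⟨T₂, hT₂, hT₂'⟩ := h₂ (List.replicate (k + 1) ()) ([], (C.raw, k)) (S.eval K) (by
    intro l₁ l₂ hl
    rw [hfold]
    refine hsize _ ?_
    have := congrArg List.length hl
    simp at this
    omega)
  obtain ⟨T₃, hT₃, hT₃'⟩ := h₃ ((C.raw.branchStep t k)^[k + 1] [], (C.raw, k))
  have hfold' := hfold (List.replicate (k + 1) ())
  rw [List.length_replicate] at hfold'
  rw [hfold'] at hT₂
  rw [C.enc_raw_pair] at hT₁
  have hout : enc (true, C.raw.finish t k ((C.raw.branchStep t k)^[k + 1] [])) =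
      (Outcome.reduced (C.raw.finishCircuits t k ((C.raw.branchStep t k)^[k + 1] []))).encode := by
    rw [← h.map_finishCircuits]
    change Data.cons _ (Data.ofList (List.map _ (List.map _ _))) = _
    rw [List.map_map]
    change _ = Data.cons _ (Data.ofList (List.map _ _))
    congr 3
    funext I
    exact I.1.enc_raw_pair I.2
  rw [← hout]
  refine ⟨_, .seq hT₁ (.seq hT₂ hT₃), ?_⟩
  have hy : (enc (List.replicate (k + 1) (), ([] : List (List ℕ)), C.raw, k)).size ≤ T₁ :=
    hT₁.size_le
  have hl : sz (List.replicate (k + 1) ()) ≤ K + 2 := by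
    have : sz (List.replicate (k + 1) ()) = sz (k + 1) := congrArg Data.size (enc_replicate (k + 1))
    rw [this, sz_nat]
    omega
  simp only [eval_add, eval_comp, eval_X, eval_ofNat]
  have e1 : P₁.eval (sz (C.raw, k)) ≤ P₁.eval K := P₁.eval_nat_mono (by omega)
  have e2 : P₂.eval (sz (List.replicate (k + 1) ()) + S.eval K) ≤ P₂.eval (K + 2 + S.eval K) :=
    P₂.eval_nat_mono (by omega)
  have e3 : P₃.eval (sz ((C.raw.branchStep t k)^[k + 1] [], (C.raw, k))) ≤ P₃.eval (S.eval K) :=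
    P₃.eval_nat_mono (hsize _ le_rfl)
  omega

/-! ### The bounds -/

theorem isComplexityFunction_of_le {f : ℕ → ℕ} (hc : Computable f) (hm : Monotone f)
    (hle : ∀ k, k ≤ f k) : IsComplexityFunction f :=
  ⟨hc, hm, Filter.tendsto_atTop_mono hle Filter.tendsto_id⟩

theorem computable₂_pow : Computable₂ fun m n : ℕ => m ^ n :=
  (Primrec₂.unpaired'.1 Nat.Primrec.pow).to_comp

theorem computable₂_add : Computable₂ fun m n : ℕ => m + n := Primrec.nat_add.to_comp

theorem computable₂_mul : Computable₂ fun m n : ℕ => m * n := Primrec.nat_mul.to_comp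

/-- The inverse of a complexity function is a complexity function. -/
theorem IsComplexityFunction.exists_inverse {μ : ℕ → ℕ} (hμ : IsComplexityFunction μ) :
    ∃ ν : ℕ → ℕ, Computable ν ∧ Monotone ν ∧ ∀ k n, μ n ≤ k → n < ν k := by
  obtain ⟨hc, hm, ht⟩ := hμ
  have hex : ∀ k, ∃ n, k + 1 ≤ μ n := fun k => (ht.eventually_ge_atTop (k + 1)).exists
  -- The first argument at which `μ` exceeds `k`, found by an unbounded search that halts because
  -- `μ` is unbounded.
  refine ⟨fun k => Nat.find (hex k), ?_, ?_, ?_⟩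
  · have hp : Computable₂ fun k n => decide (k + 1 ≤ μ n) :=
      (Primrec.nat_le.decide.to_comp : Computable₂ _).comp (Computable.succ.comp Computable.fst)
        (hc.comp Computable.snd)
    refine Partrec.of_eq (Partrec.rfind hp.partrec₂) fun k => ?_
    refine Part.eq_some_iff.2 (Nat.mem_rfind.2 ⟨?_, ?_⟩)
    · simpa using Nat.find_spec (hex k)
    · intro m hm
      simpa using Nat.find_min (hex k) hm
  · intro k k' hk
    exact Nat.find_mono fun n hn => (Nat.add_le_add_right hk 1).trans hn
  · intro k n hn
    by_contra hlt
    have h1 := Nat.find_spec (hex k)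
    have h2 : μ (Nat.find (hex k)) ≤ μ n := hm (not_lt.1 hlt)
    omega

/-- For subpolynomial genus, the number of assignments has a bound that is linear in the number of
variables. -/
theorem IsSubpolynomial.exists_bound {g : ℕ → ℕ} (hg : IsSubpolynomial g) :
    ∃ F : ℕ → ℕ, IsComplexityFunction F ∧ ∀ k n, 1 ≤ n →
      (min (6 * k + 12 * k * g n) n + 1) ^ (k + 1) ≤ F k * n := by
  obtain ⟨μ, hμ, n₀, hn₀⟩ := hg
  obtain ⟨ν, hνc, hνm, hν⟩ := hμ.exists_inverse
  refine ⟨fun k => (18 * k + 1) ^ (k + 1) + (ν k + n₀ + 1) ^ (k + 1), ?_, ?_⟩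
  · refine isComplexityFunction_of_le ?_ ?_ ?_
    · have hs : Computable fun k : ℕ => k + 1 := Computable.succ
      refine computable₂_add.comp (computable₂_pow.comp (hs.comp
        (computable₂_mul.comp (Computable.const 18) Computable.id)) hs)
        (computable₂_pow.comp (hs.comp (computable₂_add.comp hνc (Computable.const n₀))) hs)
    · intro k k' hk
      dsimp only
      have h1 := hνm hk
      have h2 : (18 * k + 1) ^ (k + 1) ≤ (18 * k' + 1) ^ (k' + 1) :=
        (Nat.pow_le_pow_left (by omega) _).trans (Nat.pow_le_pow_right (by omega) (by omega))
      have h3 : (ν k + n₀ + 1) ^ (k + 1) ≤ (ν k' + n₀ + 1) ^ (k' + 1) :=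
        (Nat.pow_le_pow_left (by omega) _).trans (Nat.pow_le_pow_right (by omega) (by omega))
      omega
    · intro k
      have := Nat.le_self_pow (n := k + 1) (by omega) (18 * k + 1)
      omega
  · intro k n hn
    -- In the first case the power `k + 1` of the genus bound is at most `n`. In the second, `n ≤ ν
    -- k + n₀`, and the bound by the number of variables depends on `k` only.
    by_cases hcase : n₀ ≤ n ∧ k + 1 ≤ μ n
    · obtain ⟨h1, h2⟩ := hcase
      -- The maximum with 1 allows `6 * k + 1` to be absorbed into a multiple of the genus bound
      -- even if `g n = 0`; hence the constant 18.
      have hpow : (max (g n) 1) ^ (k + 1) ≤ n := by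
        rcases le_total (g n) 1 with h3 | h3
        · rw [max_eq_right h3, one_pow]; exact hn
        rw [max_eq_left h3]
        have hn1 : (1 : ℝ) ≤ n := by exact_mod_cast hn
        have h4 : ((g n : ℝ)) ^ (k + 1) ≤ n := by
          calc ((g n : ℝ)) ^ (k + 1) ≤ ((n : ℝ) ^ (1 / (μ n : ℝ))) ^ (k + 1) := by
                gcongr
                exact hn₀ n h1
            _ = (n : ℝ) ^ ((1 / (μ n : ℝ)) * ((k + 1 : ℕ) : ℝ)) := by
                rw [Real.rpow_mul (by positivity), Real.rpow_natCast]
            _ ≤ (n : ℝ) ^ (1 : ℝ) := by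
                refine Real.rpow_le_rpow_of_exponent_le hn1 ?_
                have hpos : (0 : ℝ) < μ n := by
                  have : 0 < μ n := by omega
                  exact_mod_cast this
                rw [one_div, inv_mul_le_one₀ hpos]
                exact_mod_cast h2
            _ = n := Real.rpow_one _
        exact_mod_cast h4
      have hB : min (6 * k + 12 * k * g n) n + 1 ≤ (18 * k + 1) * max (g n) 1 := by
        refine (Nat.add_le_add_right (min_le_left _ _) 1).trans ?_
        have h3 : 12 * k * g n ≤ 12 * k * max (g n) 1 := Nat.mul_le_mul_left _ (le_max_left _ _)
        have h4 : 1 ≤ max (g n) 1 := le_max_right _ _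
        nlinarith
      calc _ ≤ ((18 * k + 1) * max (g n) 1) ^ (k + 1) := Nat.pow_le_pow_left hB _
        _ = (18 * k + 1) ^ (k + 1) * max (g n) 1 ^ (k + 1) := mul_pow _ _ _
        _ ≤ (18 * k + 1) ^ (k + 1) * n := Nat.mul_le_mul_left _ hpow
        _ ≤ _ := Nat.mul_le_mul_right _ (Nat.le_add_right _ _)
    · have hlt : n ≤ ν k + n₀ := by
        by_cases h1 : n₀ ≤ n
        · have := hν k n (by
            by_contra h2
            exact hcase ⟨h1, by omega⟩)
          omega
        · omega
      calc _ ≤ (ν k + n₀ + 1) ^ (k + 1) :=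
            Nat.pow_le_pow_left (Nat.add_le_add_right ((min_le_right _ _).trans hlt) 1) _
        _ ≤ ((18 * k + 1) ^ (k + 1) + (ν k + n₀ + 1) ^ (k + 1)) * 1 := by omega
        _ ≤ _ := Nat.mul_le_mul_left _ hn

theorem MonotoneCircuit.IsPiPlus.one_le_numVars {C : MonotoneCircuit} {t : ℕ}
    (hC : C.IsPiPlus t) : 1 ≤ C.numVars := by
  obtain ⟨x, ℓ, hx, -⟩ := hC.exists_var_path C.out
  exact (Set.ncard_pos (Set.toFinite _)).2 ⟨x, hx⟩

theorem MonotoneCircuit.numVars_le_size (C : MonotoneCircuit) (k : ℕ) :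
    C.numVars ≤ (encodeInstance (C, k)).size := by
  rw [numVars_eq, ← C.enc_raw_pair]
  have h1 : (enc (C.raw, k)).size = sz C.raw.1 + sz C.raw.2 + 1 + sz k + 1 := rfl
  have h2 := length_lt_sz C.raw.2
  have h3 : (C.raw.verts.filter fun v => decide (C.raw.kind v = 0)).length ≤ C.raw.2.length :=
    (List.length_filter_le _ _).trans (List.length_range).le
  omega

theorem mainTheorem5 (t : ℕ) (ht : 2 ≤ t) (g : ℕ → ℕ) (hg : IsSubpolynomial g) :
    ∃ (A : Prog) (f h : ℕ → ℕ) (c d : ℕ),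
      IsComplexityFunction f ∧ IsComplexityFunction h ∧
      ∀ (C : MonotoneCircuit) (k : ℕ), C.IsPiPlus t → C.genus ≤ g C.numVars →
        ∃ (r : Outcome) (T : ℕ),
          A.Runs (encodeInstance (C, k)) r.encode T ∧
          T ≤ f k * (encodeInstance (C, k)).size ^ c ∧
          r.IsValid t C k (h k * C.numVars ^ d) := by
  obtain ⟨F, hF, hFb⟩ := hg.exists_bound
  obtain ⟨p, Q, hp⟩ := exists_prog t
  -- The first summand comes from evaluating `Q` at `(F k + 1) * N`; the summand `k` only makes the
  -- function unbounded.
  refine ⟨p, fun k => Q.eval 1 * (F k + 1) ^ Q.natDegree + k, F, Q.natDegree, 1,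
    isComplexityFunction_of_le ?_ ?_ fun k => Nat.le_add_left _ _, hF, ?_⟩
  · exact computable₂_add.comp (computable₂_mul.comp (Computable.const _)
      (computable₂_pow.comp (Computable.succ.comp hF.1) (Computable.const _))) Computable.id
  · intro k k' hk
    have := hF.2.1 hk
    dsimp only
    gcongr
  · intro C k hC hgen
    have hn := hC.one_le_numVars
    have hM : ∀ i ≤ k + 1, ((C.raw.branchStep t k)^[i] []).length ≤ F k * C.numVars := by
      intro i hi
      refine (hC.length_iterate_branchStep_le k i).trans (le_trans ?_ (hFb k C.numVars hn))
      refine (Nat.pow_le_pow_right (by omega) hi).trans (Nat.pow_le_pow_left ?_ _)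
      gcongr
    obtain ⟨T, hT, hle⟩ := hp C k _ hC hM
    refine ⟨_, T, hT, ?_, hC.isValid_finishCircuits (by omega) ?_⟩
    · set N := (encodeInstance (C, k)).size
      have h1 : N + F k * C.numVars ≤ (F k + 1) * N := by
        have : F k * C.numVars ≤ F k * N := Nat.mul_le_mul_left _ (C.numVars_le_size k)
        rw [add_mul, one_mul]
        omega
      have h2 : 1 ≤ N := Data.size_pos _
      calc T ≤ Q.eval ((F k + 1) * N) := hle.trans (Q.eval_nat_mono h1)
        _ ≤ Q.eval 1 * ((F k + 1) * N) ^ Q.natDegree :=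
            Q.eval_nat_le (Nat.mul_pos (Nat.succ_pos _) h2)
        _ = Q.eval 1 * (F k + 1) ^ Q.natDegree * N ^ Q.natDegree := by rw [mul_pow, mul_assoc]
        _ ≤ _ := Nat.mul_le_mul_right _ (Nat.le_add_right _ _)
    · rw [pow_one]
      exact hM _ le_rfl
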